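/- Let $X$ be a smooth manifold of dimension $n$. An operator field is a smooth $(1,1)$-tensor field; products of operator fields are pointwise compositions. For operator fields $L,M$ and vector fields $\xi,\eta$ put $$\langle L,M\rangle(\xi,\eta)=LM[\xi,\eta]+[L\xi,M\eta]-L[\xi,M\eta]-M[L\xi,\eta],$$ which is tensorial in $\xi,\eta$ if $LM=ML$. Commuting operator fields $L,M$ are called symmetries of each other if $\langle L,M\rangle(\xi,\eta)+\langle L,M\rangle(\eta,\xi)=0$ for all $\xi,\eta$, and strong symmetries of each other if $\langle L,M\rangle=0$; $L$ is Nijenhuis if $\langle L,L\rangle=0$. For a 1-form $\alpha$ let $(L^*\alpha)(\xi)=\alpha(L\xi)$; a closed 1-form $\alpha$ is a conservation law of $L$ if $L^*\alpha$ is closed. A Frobenius algebra is a finite-dimensional unital commutative associative algebra with a nondegenerate symmetric bilinear form $b$ such that $b(uv,w)=b(v,uw)$. Let $M^1,\dots,M^n$ be operator fields on $X$ which commute and are symmetries of each other, such that all combinations $\sum_i c_iM^i$ with constant $c_i\in\mathbb R$ are Nijenhuis, and such that at each point $x\in X$ there are a vector $v\in T_xX$ with $M^1v,\dots,M^nv$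 linearly independent and a covector $a\in T_x^*X$ with $M^{1*}a,\dots,M^{n*}a$ linearly independent. Let $\mathsf{Sym}$ be the set of all operator fields $M$ that are strong symmetries of every $M^i$. Then: 1. Every $M\in\mathsf{Sym}$ can be uniquely written as $M=\sum_i g_iM^i$ with functions $g_i$ on $X$, and these functions are smooth. The set $\mathsf{Sym}$ is a unital real algebra, and it is commutative. At each $x\in X$ the set $\mathsf{Sym}_x=\{M(x) : M\in\mathsf{Sym}\}$ is a unital subalgebra of $\mathrm{gl}(T_xX)$ and is a Frobenius algebra. 2. Every operator field that is a symmetry of all $M^i$ is a strong symmetry of all $M^i$, hence belongs to $\mathsf{Sym}$. All $M,N\in\mathsf{Sym}$ are strong symmetries of each other. 3. If a 1-form $\alpha$ on an open set $U\subseteq X$ is a conservation law of all $M^i$, then $M^*\alpha$ is closed on $U$ for every $M\in\mathsf{Sym}$. 4. (Analytic category.) If $X$ and $M^1,\dots,M^n$ are real analytic, then every point of $X$ has an open neighbourhood $U$ with a real analytic function $f$ on $U$ such that $\alpha=\mathrm df$ is a conservation law of all $M^i$ on $U$ and $M^{1*}\alpha,\dots,M^{n*}\alpha$ are linearly independent at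 every point of $U$. (Formal category.) If $M^1,\dots,M^n$ are $n\times n$ matrices over $\mathbb R[[u^1,\dots,u^n]]$ satisfying the same assumptions, with brackets and derivatives of formal vector fields taken formally and the existence of $v$ and $a$ required at the origin, then there is $f\in\mathbb R[[u^1,\dots,u^n]]$ such that $\alpha=\mathrm df$ is a formal conservation law of all $M^i$ and $M^{1*}\alpha,\dots,M^{n*}\alpha$ are linearly independent at the origin. -/

import Mathlib

open scoped Manifold ContDiff Bundle Matrix

noncomputable section

/-! ### Operator fields and 1-forms on an `n`-dimensional manifold `X` -/

/-- A (not necessarily smooth) vector field. -/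
abbrev VecField (n : ℕ) (X : Type*) [TopologicalSpace X]
    [ChartedSpace (EuclideanSpace ℝ (Fin n)) X] : Type _ :=
  ∀ x : X, TangentSpace (𝓡 n) x

/-- A (not necessarily smooth) operator field, that is, a `(1,1)`-tensor field. All operator fields
form an algebra under pointwise composition. -/
abbrev OpField (n : ℕ) (X : Type*) [TopologicalSpace X]
    [ChartedSpace (EuclideanSpace ℝ (Fin n)) X] : Type _ :=
  ∀ x : X, TangentSpace (𝓡 n) x →L[ℝ] TangentSpace (𝓡 n) x

/-- A (not necessarily smooth) differential 1-form. -/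
abbrev CovecField (n : ℕ) (X : Type*) [TopologicalSpace X]
    [ChartedSpace (EuclideanSpace ℝ (Fin n)) X] : Type _ :=
  ∀ x : X, TangentSpace (𝓡 n) x →L[ℝ] ℝ

section Manifold

variable {n : ℕ} {X : Type*} [TopologicalSpace X] [ChartedSpace (EuclideanSpace ℝ (Fin n)) X]

/-- The vector field `ξ` is `C^∞` at `x`. -/
def VecSmoothAt [IsManifold (𝓡 n) ∞ X] (ξ : VecField n X) (x : X) : Prop :=
  ContMDiffAt (𝓡 n) ((𝓡 n).prod 𝓘(ℝ, EuclideanSpace ℝ (Fin n))) ∞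
    (fun y => Bundle.TotalSpace.mk' (EuclideanSpace ℝ (Fin n)) y (ξ y)) x

/-- The operator field `L` is of class `C^k`, as a section of `End(TX)`. -/
def OpSmooth [IsManifold (𝓡 n) ∞ X] (k : WithTop ℕ∞) (L : OpField n X) : Prop :=
  ContMDiff (𝓡 n)
    ((𝓡 n).prod 𝓘(ℝ, EuclideanSpace ℝ (Fin n) →L[ℝ] EuclideanSpace ℝ (Fin n))) k
    (fun y => Bundle.TotalSpace.mk' (EuclideanSpace ℝ (Fin n) →L[ℝ] EuclideanSpace ℝ (Fin n))
      (E := fun z : X => TangentSpace (𝓡 n) z →L[ℝ] TangentSpace (𝓡 n) z) y (L y))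

/-- The 1-form `α` is `C^∞` on `U`, as a section of the cotangent bundle. -/
def FormSmoothOn [IsManifold (𝓡 n) ∞ X] (α : CovecField n X) (U : Set X) : Prop :=
  ContMDiffOn (𝓡 n) ((𝓡 n).prod 𝓘(ℝ, EuclideanSpace ℝ (Fin n) →L[ℝ] ℝ)) ∞
    (fun y => Bundle.TotalSpace.mk' (EuclideanSpace ℝ (Fin n) →L[ℝ] ℝ)
      (E := fun z : X => TangentSpace (𝓡 n) z →L[ℝ] Bundle.Trivial X ℝ z) y (α y)) U

/-- The value at `x` of
`⟨L, M⟩(ξ, η) = L M [ξ, η] + [L ξ, M η] - L [ξ, M η] - M [L ξ, η]`. -/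
def opBracket (L M : OpField n X) (ξ η : VecField n X) (x : X) : TangentSpace (𝓡 n) x :=
  L x (M x (VectorField.mlieBracket (𝓡 n) ξ η x))
    + VectorField.mlieBracket (𝓡 n) (fun y => L y (ξ y)) (fun y => M y (η y)) x
    - L x (VectorField.mlieBracket (𝓡 n) ξ (fun y => M y (η y)) x)
    - M x (VectorField.mlieBracket (𝓡 n) (fun y => L y (ξ y)) η x)

/-- `L` and `M` commute and the part of `⟨L, M⟩` symmetric in the lower indices vanishes. The test
fields are only required to be smooth near the point of evaluation. -/
def AreSymmetries [IsManifold (𝓡 n) ∞ X] (L M : OpField n X) : Prop :=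
  L * M = M * L ∧
    ∀ (x : X) (ξ η : VecField n X), VecSmoothAt ξ x → VecSmoothAt η x →
      opBracket L M ξ η x + opBracket L M η ξ x = 0

/-- `L` and `M` commute and the tensor `⟨L, M⟩` vanishes. -/
def AreStrongSymmetries [IsManifold (𝓡 n) ∞ X] (L M : OpField n X) : Prop :=
  L * M = M * L ∧
    ∀ (x : X) (ξ η : VecField n X), VecSmoothAt ξ x → VecSmoothAt η x →
      opBracket L M ξ η x = 0

/-- The Nijenhuis torsion `⟨L, L⟩` vanishes. -/
def IsNijenhuis [IsManifold (𝓡 n) ∞ X] (L : OpField n X) : Prop :=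
  ∀ (x : X) (ξ η : VecField n X), VecSmoothAt ξ x → VecSmoothAt η x →
    opBracket L L ξ η x = 0

/-- The dual operator: `(L^* α)(ξ) = α(L ξ)`. -/
def dualApply (L : OpField n X) (α : CovecField n X) : CovecField n X :=
  fun x => (α x).comp (L x)

/-- The 1-form `α` is smooth and closed on `U`:
`dα(ξ, η) = ξ(α(η)) - η(α(ξ)) - α([ξ, η])` vanishes at all points of `U`. -/
def IsClosedFormOn [IsManifold (𝓡 n) ∞ X] (α : CovecField n X) (U : Set X) : Prop :=
  FormSmoothOn α U ∧
    ∀ x ∈ U, ∀ ξ η : VecField n X, VecSmoothAt ξ x → VecSmoothAt η x →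
      mvfderiv (𝓡 n) (fun y => α y (η y)) x (ξ x)
        - mvfderiv (𝓡 n) (fun y => α y (ξ y)) x (η x)
        - α x (VectorField.mlieBracket (𝓡 n) ξ η x) = 0

/-- The closed 1-form `α` is a conservation law of `L` on `U`. -/
def IsConservationLawOn [IsManifold (𝓡 n) ∞ X] (L : OpField n X) (α : CovecField n X)
    (U : Set X) : Prop :=
  IsClosedFormOn α U ∧ IsClosedFormOn (dualApply L α) U

/-- The standing setup: `n` smooth operator fields on an `n`-dimensional manifold that commute and
are symmetries of each other, satisfy the two regularity conditions (for a vector and for a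
covector) at each point, and all of whose combinations with constant coefficients are Nijenhuis. -/
structure IsNijenhuisFrobeniusFamily [IsManifold (𝓡 n) ∞ X] (L : Fin n → OpField n X) : Prop where
  smooth : ∀ i, OpSmooth ∞ (L i)
  symmetries : ∀ i j, AreSymmetries (L i) (L j)
  generic_vector : ∀ x : X, ∃ v : TangentSpace (𝓡 n) x,
    LinearIndependent ℝ (fun i => L i x v)
  generic_covector : ∀ x : X, ∃ a : TangentSpace (𝓡 n) x →L[ℝ] ℝ,
    LinearIndependent ℝ (fun i => a.comp (L i x))
  nijenhuis : ∀ c : Fin n → ℝ, IsNijenhuis (∑ i, c i • L i)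

/-- The set of smooth common strong symmetries of the operator fields `L i`. -/
def CommonStrongSym [IsManifold (𝓡 n) ∞ X] (L : Fin n → OpField n X) : Set (OpField n X) :=
  {M | OpSmooth ∞ M ∧ ∀ i, AreStrongSymmetries M (L i)}

end Manifold

/-- A Frobenius algebra over `ℝ`: finite-dimensional, unital, associative, commutative, with a
nondegenerate symmetric bilinear form such that `b(u v, w) = b(v, u w)`. -/
structure IsFrobeniusAlgebra (A : Type*) [Ring A] [Algebra ℝ A] : Prop where
  finite : FiniteDimensional ℝ A
  comm : ∀ u v : A, u * v = v * u
  form : ∃ b : LinearMap.BilinForm ℝ A, b.IsSymm ∧ b.Nondegenerate ∧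
    ∀ u v w : A, b (u * v) w = b v (u * w)

/-! ### The formal category: tensor fields with coefficients in `ℝ⟦u₁, …, uₙ⟧` -/

section Formal

variable {n : ℕ}

/-- Formal functions near the origin of `ℝⁿ`. -/
abbrev FormalFun (n : ℕ) : Type := MvPowerSeries (Fin n) ℝ

/-- Formal operator fields; the entry `L i j` is the component `L^i_j`. -/
abbrev FormalOp (n : ℕ) : Type := Matrix (Fin n) (Fin n) (FormalFun n)

/-- Commutator of formal vector fields, `[ξ, η]^i = ξ^j ∂_j η^i - η^j ∂_j ξ^i`. -/
def formalLie (ξ η : Fin n → FormalFun n) : Fin n → FormalFun n :=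
  fun i => ∑ j, (ξ j * MvPowerSeries.pderiv ℝ j (η i) - η j * MvPowerSeries.pderiv ℝ j (ξ i))

/-- `⟨L, M⟩(ξ, η) = L M [ξ, η] + [L ξ, M η] - L [ξ, M η] - M [L ξ, η]` for formal fields. -/
def formalBracket (L M : FormalOp n) (ξ η : Fin n → FormalFun n) : Fin n → FormalFun n :=
  L *ᵥ (M *ᵥ formalLie ξ η) + formalLie (L *ᵥ ξ) (M *ᵥ η)
    - L *ᵥ formalLie ξ (M *ᵥ η) - M *ᵥ formalLie (L *ᵥ ξ) η

/-- Formal operator fields that are symmetries of each other. -/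
def FormalSymmetries (L M : FormalOp n) : Prop :=
  L * M = M * L ∧ ∀ ξ η, formalBracket L M ξ η + formalBracket L M η ξ = 0

/-- Formal Nijenhuis operator fields. -/
def FormalNijenhuis (L : FormalOp n) : Prop :=
  ∀ ξ η, formalBracket L L ξ η = 0

/-- The formal 1-form `∑ α_j du^j` is closed. -/
def FormalClosed (α : Fin n → FormalFun n) : Prop :=
  ∀ i j, MvPowerSeries.pderiv ℝ i (α j) = MvPowerSeries.pderiv ℝ j (α i)

/-- The closed formal 1-form `α` is a conservation law of `L`;
the components of `L^* α` are `(L^* α)_j = ∑ α_k L^k_j`. -/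
def FormalConservationLaw (L : FormalOp n) (α : Fin n → FormalFun n) : Prop :=
  FormalClosed α ∧ FormalClosed (α ᵥ* L)

/-- The standing setup in the formal category; the regularity conditions are imposed at the
origin. -/
structure IsFormalNijenhuisFrobeniusFamily (L : Fin n → FormalOp n) : Prop where
  symmetries : ∀ i j, FormalSymmetries (L i) (L j)
  generic_vector : ∃ v : Fin n → ℝ,
    LinearIndependent ℝ (fun i => (L i).map MvPowerSeries.constantCoeff *ᵥ v)
  generic_covector : ∃ a : Fin n → ℝ,
    LinearIndependent ℝ (fun i => a ᵥ* (L i).map MvPowerSeries.constantCoeff)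
  nijenhuis : ∀ c : Fin n → ℝ, FormalNijenhuis (∑ i, c i • L i)

end Formal

end

/-! Write `L i` for the given operators. Polarizing the Nijenhuis condition for `L i + L j` against
the symmetry condition shows that the `L i` are pairwise strong symmetries. At each point an
operator commuting with all `L i` is determined by its value on the cyclic vector v. Hence it is a
unique combination of the `L i`, and all such operators commute. A common symmetry is therefore M =
∑ gᵢ Lᵢ with smooth gᵢ, and all its brackets are governed by the operator-valued 1-form A = ∑ dgᵢ ⊗
Lᵢ: if N is a strong symmetry of every Lᵢ, then ⟨M, N⟩(ξ, η) = N A(η) ξ - A(N η) ξ.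

Claims 1 to 3 are then pointwise algebra. For N = Lⱼ the defect D(η) = Lⱼ A(η) - A(Lⱼ η) commutes
with the family, and the symmetry condition reads D(η) ξ + D(ξ) η = 0; testing on v forces D = 0
(`eq_zero_of_skew`). So A intertwines every Lⱼ, hence every N in Sym, which gives strong symmetry.
It also makes A(ξ) η symmetric in ξ and η (`apply_apply_symm`), so that d(M^*α) = ∑ dgᵢ ∧ Lᵢ^*α
vanishes. The form b(u, w) = a(u w v) makes the fibres Frobenius algebras.

For claim 4 the unknowns are potentials Fᵢ with Lᵢ^*α = dFᵢ. Take v with constant components, let W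
be the frame with columns Lₗ v, and let Z_k be the matrix in this frame of the algebra element
sending v to e_k (`conj`). The row F = (Fᵢ) has to satisfy ∂_k F = (D_v F) Z_k. Conversely, every
solution yields α = (D_v F) W⁻¹ with Lᵢ^*α = dFᵢ (`vecMul_apply_of_op`), and this α is closed
(`closed_of_op`). The system is integrable: the products Lᵢ L_q are again strong symmetries, which
gives equations for the structure matrices (`map_deriv_conj`), then the compatibility `conj_compat`,
and then commutation of the operators ∂_k - (D_v ·) Z_k (`op_comm`).

Commuting first order operators Q_k are solved one after another by the projections ∑ (-t)^m / m!
Q^m onto ker Q, where [Q, t] = 1 (`flow_mem_ker`, `flow_commute`). The value of α at the origin can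
be prescribed, and the generic covector gives independence. Cauchy estimates make the series
converge (`vecNorm_flow_lt_top`), and Taylor expansion in a chart carries the result to analytic
manifolds. -/

noncomputable section

/-! ### Strong symmetries over a ring with derivations -/

section DerivationAlgebra

variable {n : ℕ} {R : Type*} [CommRing R] [Algebra ℝ R] {m o : Type*} [Fintype m]

/-- A derivation applied to the components of a vector. -/
def vecDeriv {m : Type*} (D : Derivation ℝ R R) (f : m → R) : m → R := fun i => D (f i)

theorem map_deriv_mul {l : Type*} (D : Derivation ℝ R R) (M : Matrix l m R) (N : Matrix m o R) :
    (M * N).map D = M.map D * N + M * N.map D := by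
  ext i j
  simp only [Matrix.map_apply, Matrix.mul_apply, Matrix.add_apply, map_sum, Derivation.leibniz,
    smul_eq_mul, ← Finset.sum_add_distrib]
  exact Finset.sum_congr rfl fun k _ => by ring

theorem vecDeriv_mulVec {l : Type*} (D : Derivation ℝ R R) (M : Matrix l m R) (f : m → R) :
    vecDeriv D (M *ᵥ f) = M.map D *ᵥ f + M *ᵥ vecDeriv D f := by
  ext i
  simp only [vecDeriv, Matrix.map_apply, Matrix.mulVec, dotProduct, Pi.add_apply, map_sum,
    Derivation.leibniz, smul_eq_mul, ← Finset.sum_add_distrib]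
  exact Finset.sum_congr rfl fun k _ => by ring

theorem vecDeriv_vecMul {l : Type*} (D : Derivation ℝ R R) (f : m → R) (M : Matrix m l R) :
    vecDeriv D (f ᵥ* M) = vecDeriv D f ᵥ* M + f ᵥ* M.map D := by
  ext i
  simp only [vecDeriv, Matrix.map_apply, Matrix.vecMul, dotProduct, Pi.add_apply, map_sum,
    Derivation.leibniz, smul_eq_mul, ← Finset.sum_add_distrib]
  exact Finset.sum_congr rfl fun k _ => by ring

omit [Fintype m] in
theorem map_deriv_smul {l : Type*} (D : Derivation ℝ R R) (f : R) (M : Matrix l m R) :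
    (f • M).map D = D f • M + f • M.map D := by
  ext i j
  simp only [Matrix.map_apply, Matrix.smul_apply, Matrix.add_apply, Derivation.leibniz,
    smul_eq_mul]
  ring

omit [Fintype m] in
theorem map_deriv_sum {l ι : Type*} (s : Finset ι) (D : Derivation ℝ R R)
    (M : ι → Matrix l m R) : (∑ i ∈ s, M i).map D = ∑ i ∈ s, (M i).map D := by
  ext i j
  simp [Matrix.sum_apply]

variable (d : Fin n → Derivation ℝ R R)

/-- The derivative in the direction of the vector field `ξ`. -/
def dirDeriv (ξ : Fin n → R) : Derivation ℝ R R := ∑ k, ξ k • d k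

theorem dirDeriv_apply (ξ : Fin n → R) (f : R) : dirDeriv d ξ f = ∑ k, ξ k * d k f := by
  have h : ∀ s : Finset (Fin n), (∑ k ∈ s, ξ k • d k) f = ∑ k ∈ s, ξ k * d k f := by
    intro s
    induction s using Finset.induction_on with
    | empty => simp
    | insert a s ha ih => rw [Finset.sum_insert ha, Finset.sum_insert ha, ← ih]; simp
  exact h _

theorem dirDeriv_sum_smul {ι : Type*} (s : Finset ι) (b : ι → R) (ξ : ι → Fin n → R) (f : R) :
    dirDeriv d (∑ j ∈ s, b j • ξ j) f = ∑ j ∈ s, b j * dirDeriv d (ξ j) f := by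
  simp only [dirDeriv_apply, Finset.sum_apply, Pi.smul_apply, smul_eq_mul, Finset.sum_mul,
    Finset.mul_sum]
  rw [Finset.sum_comm]
  exact Finset.sum_congr rfl fun _ _ => Finset.sum_congr rfl fun _ _ => by ring

theorem dirDeriv_single (k : Fin n) (f : R) : dirDeriv d (Pi.single k 1) f = d k f := by
  simp [dirDeriv_apply, Pi.single_apply]

omit [Fintype m] in
theorem map_dirDeriv_sum_smul {l ι : Type*} (s : Finset ι) (b : ι → R) (ξ : ι → Fin n → R)
    (M : Matrix l m R) :
    M.map (dirDeriv d (∑ j ∈ s, b j • ξ j)) = ∑ j ∈ s, b j • M.map (dirDeriv d (ξ j)) := by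
  ext i k
  simp [Matrix.sum_apply, dirDeriv_sum_smul]

/-- The operator fields `L` and `M`, given by matrices, satisfy `⟨L, M⟩ = 0`. -/
def StrongSym (L M : Matrix (Fin n) (Fin n) R) : Prop :=
  ∀ ξ η : Fin n → R,
    (M.map (dirDeriv d (L *ᵥ ξ)) - L * M.map (dirDeriv d ξ)) *ᵥ η
      = (L.map (dirDeriv d (M *ᵥ η)) - M * L.map (dirDeriv d η)) *ᵥ ξ

variable {d}

/-- By the Leibniz rule the defect of `M * N` at (ξ, η) is the defect of `M` at (ξ, N η) plus `M`
applied to the defect of `N` at (ξ, η). Commutation is needed to move `L` past `M`. -/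
theorem StrongSym.mul {L M N : Matrix (Fin n) (Fin n) R} (hM : StrongSym d L M)
    (hN : StrongSym d L N) (hc : L * M = M * L) : StrongSym d L (M * N) := by
  intro ξ η
  have h1 := hM ξ (N *ᵥ η)
  have h2 := congrArg (fun w => M *ᵥ w) (hN ξ η)
  simp only [map_deriv_mul, Matrix.sub_mulVec, Matrix.add_mulVec, Matrix.mulVec_sub,
    Matrix.mul_add, ← Matrix.mulVec_mulVec] at h1 h2 ⊢
  have h3 : ∀ w, L *ᵥ (M *ᵥ w) = M *ᵥ (L *ᵥ w) := fun w => by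
    rw [Matrix.mulVec_mulVec, Matrix.mulVec_mulVec, hc]
  rw [h3]
  have h4 := congrArg₂ (· + ·) h1 h2
  rw [show ∀ a b c e : Fin n → R, a + b - (c + e) = a - c + (b - e) by intros; abel, h4]
  abel

theorem StrongSym.one (L : Matrix (Fin n) (Fin n) R) : StrongSym d L 1 := by
  intro ξ η
  have : ∀ D : Derivation ℝ R R, (1 : Matrix (Fin n) (Fin n) R).map D = 0 := by
    intro D; ext i j
    by_cases h : i = j <;> simp [h]
  simp [this]

/-! ### Families with a cyclic vector -/

/-- A commuting family `L` of pairwise strong symmetries, with a constant vector `v` such that the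
matrix `W` with columns `L i v` is invertible. -/
structure CyclicFamily (d : Fin n → Derivation ℝ R R) (L : Fin n → Matrix (Fin n) (Fin n) R)
    (v : Fin n → R) (W W' : Matrix (Fin n) (Fin n) R) : Prop where
  comm : ∀ i j, L i * L j = L j * L i
  strong : ∀ i j, StrongSym d (L i) (L j)
  const : ∀ k i, d k (v i) = 0
  frame : ∀ p l, W p l = (L l *ᵥ v) p
  inv : W' * W = 1

namespace CyclicFamily

variable {L : Fin n → Matrix (Fin n) (Fin n) R} {v : Fin n → R}
  {W W' : Matrix (Fin n) (Fin n) R}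

theorem inv' (h : CyclicFamily d L v W W') : W * W' = 1 :=
  mul_eq_one_comm.mp h.inv

theorem dir_const (h : CyclicFamily d L v W W') (ξ : Fin n → R) :
    vecDeriv (dirDeriv d ξ) v = 0 := by
  ext i; simp [vecDeriv, dirDeriv_apply, h.const]

theorem mulVec_frame (h : CyclicFamily d L v W W') (τ : Fin n → R) :
    W *ᵥ τ = (∑ l, τ l • L l) *ᵥ v := by
  ext p
  simp only [Matrix.mulVec, dotProduct, h.frame, Matrix.sum_apply, Matrix.smul_apply, smul_eq_mul,
    Finset.sum_mul]
  rw [Finset.sum_comm]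
  exact Finset.sum_congr rfl fun _ _ => Finset.sum_congr rfl fun _ _ => by ring

theorem mul_frame_col (h : CyclicFamily d L v W W') (T : Matrix (Fin n) (Fin n) R) (l : Fin n) :
    (T * W).col l = T *ᵥ (L l *ᵥ v) := by
  ext p
  simp [Matrix.col_apply, Matrix.mul_apply, Matrix.mulVec, dotProduct, h.frame]

theorem eq_of_mulVec (h : CyclicFamily d L v W W') {S T : Matrix (Fin n) (Fin n) R}
    (hST : ∀ l, S *ᵥ (L l *ᵥ v) = T *ᵥ (L l *ᵥ v)) : S = T := by
  have : S * W = T * W := by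
    ext p l
    have := congrFun (hST l) p
    rw [← h.mul_frame_col, ← h.mul_frame_col] at this
    exact this
  calc S = S * W * W' := by rw [Matrix.mul_assoc, h.inv', Matrix.mul_one]
    _ = T := by rw [this, Matrix.mul_assoc, h.inv', Matrix.mul_one]

theorem comb_comm (h : CyclicFamily d L v W W') (τ : Fin n → R) (j : Fin n) :
    (∑ l, τ l • L l) * L j = L j * ∑ l, τ l • L l := by
  simp [Finset.sum_mul, Finset.mul_sum, h.comm j]

/-- Both sides commute with the family and agree on `v`, hence on every `L l *ᵥ v`, and these
vectors form a frame. -/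
theorem eq_comb (h : CyclicFamily d L v W W') {T : Matrix (Fin n) (Fin n) R}
    (hT : ∀ l, T * L l = L l * T) {τ : Fin n → R} (hτ : W *ᵥ τ = T *ᵥ v) :
    T = ∑ l, τ l • L l := by
  refine h.eq_of_mulVec fun l => ?_
  rw [Matrix.mulVec_mulVec, Matrix.mulVec_mulVec, hT, h.comb_comm, ← Matrix.mulVec_mulVec,
    ← Matrix.mulVec_mulVec, ← h.mulVec_frame, hτ]

theorem inv_mulVec (h : CyclicFamily d L v W W') (w : Fin n → R) : W *ᵥ (W' *ᵥ w) = w := by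
  rw [Matrix.mulVec_mulVec, h.inv', Matrix.one_mulVec]

theorem inv_mulVec' (h : CyclicFamily d L v W W') (w : Fin n → R) : W' *ᵥ (W *ᵥ w) = w := by
  rw [Matrix.mulVec_mulVec, h.inv, Matrix.one_mulVec]

theorem map_frame_mulVec (h : CyclicFamily d L v W W') (ξ τ : Fin n → R) :
    W.map (dirDeriv d ξ) *ᵥ τ = ∑ l, τ l • ((L l).map (dirDeriv d ξ) *ᵥ v) := by
  have : ∀ p l, dirDeriv d ξ (W p l) = ((L l).map (dirDeriv d ξ) *ᵥ v) p := by
    intro p l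
    rw [h.frame]
    have := congrFun (vecDeriv_mulVec (dirDeriv d ξ) (L l) v) p
    rw [h.dir_const, Matrix.mulVec_zero, add_zero] at this
    exact this
  ext p
  simp only [Finset.sum_apply, Pi.smul_apply, smul_eq_mul, ← this]
  simp [Matrix.mulVec, dotProduct, mul_comm]

/-- The coefficients of a strong symmetry with respect to the family satisfy a first order system
of differential equations. -/
theorem deriv_coeff (h : CyclicFamily d L v W W') {N : Matrix (Fin n) (Fin n) R}
    (hN : ∀ l, N * L l = L l * N) {j : Fin n} (hs : StrongSym d (L j) N) (η : Fin n → R)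
    {g : Fin n → R} (hg : W *ᵥ g = N *ᵥ v) :
    vecDeriv (dirDeriv d (L j *ᵥ η)) g = (W' * L j * W) *ᵥ vecDeriv (dirDeriv d η) g := by
  -- Differentiate `W g = N v` with `v` constant.
  have hD : ∀ ξ, W *ᵥ vecDeriv (dirDeriv d ξ) g
      = N.map (dirDeriv d ξ) *ᵥ v - ∑ l, g l • ((L l).map (dirDeriv d ξ) *ᵥ v) := by
    intro ξ
    have h1 := vecDeriv_mulVec (dirDeriv d ξ) W g
    rw [hg, vecDeriv_mulVec, h.dir_const, Matrix.mulVec_zero, add_zero, h.map_frame_mulVec] at h1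
    rw [h1]; abel
  have hNg : N = ∑ l, g l • L l := h.eq_comb hN hg
  have key : W *ᵥ vecDeriv (dirDeriv d (L j *ᵥ η)) g
      = L j *ᵥ (W *ᵥ vecDeriv (dirDeriv d η) g) := by
    rw [hD, hD, Matrix.mulVec_sub, sub_eq_sub_iff_sub_eq_sub]
    have h1 := hs η v
    -- The strong symmetry relations at `(η, v)` trade derivatives of `N` and of `L l` for
    -- derivatives of `L j`. Since `N = ∑ g l • L l`, the latter agree term by term.
    have h2 : ∀ l, g l • ((L l).map (dirDeriv d (L j *ᵥ η)) *ᵥ v)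
        - L j *ᵥ (g l • ((L l).map (dirDeriv d η) *ᵥ v))
        = g l • (((L j).map (dirDeriv d (L l *ᵥ v)) - L l * (L j).map (dirDeriv d v)) *ᵥ η) := by
      intro l
      rw [← h.strong j l η v, Matrix.mulVec_smul, ← smul_sub, Matrix.sub_mulVec,
        ← Matrix.mulVec_mulVec]
    rw [Matrix.sub_mulVec, ← Matrix.mulVec_mulVec] at h1
    rw [h1, Matrix.mulVec_sum, ← Finset.sum_sub_distrib, Finset.sum_congr rfl fun l _ => h2 l]
    have h3 : N *ᵥ v = ∑ l, g l • (L l *ᵥ v) := by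
      conv_lhs => rw [hNg]
      simp [Matrix.sum_mulVec, Matrix.smul_mulVec]
    rw [h3, map_dirDeriv_sum_smul]
    conv_lhs => rw [hNg]
    rw [Finset.sum_mul, ← Finset.sum_sub_distrib, Matrix.sum_mulVec]
    refine Finset.sum_congr rfl fun l _ => ?_
    rw [← Matrix.smul_mulVec, smul_sub, Matrix.smul_mul]
  calc _ = W' *ᵥ (W *ᵥ vecDeriv (dirDeriv d (L j *ᵥ η)) g) := (h.inv_mulVec' _).symm
    _ = _ := by rw [key]; simp [Matrix.mulVec_mulVec, Matrix.mul_assoc]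

/-- Column `q` of `W' * L i * W` holds the coefficients of `L i * L q` in the family. This product
is again a strong symmetry by `StrongSym.mul`, so `deriv_coeff` applies to each column. -/
theorem map_deriv_conj (h : CyclicFamily d L v W W') (i j : Fin n) (η : Fin n → R) :
    (W' * L i * W).map (dirDeriv d (L j *ᵥ η))
      = (W' * L j * W) * (W' * L i * W).map (dirDeriv d η) := by
  ext p q
  have hc : ∀ l, L i * L q * L l = L l * (L i * L q) := by
    intro l
    rw [Matrix.mul_assoc, h.comm q l, ← Matrix.mul_assoc, h.comm i l, Matrix.mul_assoc]
  have hg : W *ᵥ (W' * L i * W).col q = (L i * L q) *ᵥ v := by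
    rw [h.mul_frame_col, ← Matrix.mulVec_mulVec, h.inv_mulVec, Matrix.mulVec_mulVec]
  have := congrFun (h.deriv_coeff hc ((h.strong j i).mul (h.strong j q) (h.comm j i)) η hg) p
  exact this

/-- The element of the algebra spanned by the family that maps the cyclic vector to `ξ`. -/
def elem (L : Fin n → Matrix (Fin n) (Fin n) R) (W' : Matrix (Fin n) (Fin n) R)
    (ξ : Fin n → R) : Matrix (Fin n) (Fin n) R := ∑ l, (W' *ᵥ ξ) l • L l

theorem elem_mulVec (h : CyclicFamily d L v W W') (ξ : Fin n → R) : elem L W' ξ *ᵥ v = ξ := by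
  rw [elem, ← h.mulVec_frame, h.inv_mulVec]

theorem elem_comm (h : CyclicFamily d L v W W') (ξ : Fin n → R) (j : Fin n) :
    elem L W' ξ * L j = L j * elem L W' ξ := h.comb_comm _ j

theorem eq_elem (h : CyclicFamily d L v W W') {T : Matrix (Fin n) (Fin n) R}
    (hT : ∀ l, T * L l = L l * T) : T = elem L W' (T *ᵥ v) :=
  h.eq_comb hT (h.inv_mulVec _)

theorem elem_mul_comm (h : CyclicFamily d L v W W') (ξ η : Fin n → R) :
    elem L W' ξ * elem L W' η = elem L W' η * elem L W' ξ := by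
  conv_lhs => rw [elem]
  conv_rhs => rw [elem.eq_def L W' ξ]
  simp only [Finset.sum_mul, Finset.mul_sum, Matrix.smul_mul, Matrix.mul_smul, h.elem_comm]

/-- The elements of the algebra in the frame given by the family. -/
def conj (L : Fin n → Matrix (Fin n) (Fin n) R) (W W' : Matrix (Fin n) (Fin n) R)
    (ξ : Fin n → R) : Matrix (Fin n) (Fin n) R := W' * elem L W' ξ * W

omit [Algebra ℝ R] in
theorem conj_eq_sum (ξ : Fin n → R) :
    conj L W W' ξ = ∑ l, (W' *ᵥ ξ) l • (W' * L l * W) := by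
  simp [conj, elem, Finset.mul_sum, Finset.sum_mul]

theorem conj_mul (h : CyclicFamily d L v W W') (ξ η : Fin n → R) :
    conj L W W' ξ * conj L W W' η = W' * (elem L W' ξ * elem L W' η) * W := by
  simp only [conj]
  rw [show W' * elem L W' ξ * W * (W' * elem L W' η * W)
    = W' * elem L W' ξ * (W * W') * elem L W' η * W by simp only [Matrix.mul_assoc], h.inv']
  simp only [Matrix.mul_assoc, Matrix.one_mul]

theorem conj_comm (h : CyclicFamily d L v W W') (ξ η : Fin n → R) :
    conj L W W' ξ * conj L W W' η = conj L W W' η * conj L W W' ξ := by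
  rw [h.conj_mul, h.conj_mul, h.elem_mul_comm]

theorem conj_cyclic (h : CyclicFamily d L v W W') : conj L W W' v = 1 := by
  have := h.eq_elem (T := 1) (by simp)
  rw [Matrix.one_mulVec] at this
  rw [conj, ← this, Matrix.mul_one, h.inv]

omit [Algebra ℝ R] in
theorem conj_sum_smul {ι : Type*} (s : Finset ι) (b : ι → R) (ξ : ι → Fin n → R) :
    conj L W W' (∑ j ∈ s, b j • ξ j) = ∑ j ∈ s, b j • conj L W W' (ξ j) := by
  simp only [conj_eq_sum, Matrix.mulVec_sum, Matrix.mulVec_smul, Finset.sum_apply, Pi.smul_apply,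
    smul_eq_mul, Finset.sum_smul, Finset.smul_sum, smul_smul]
  rw [Finset.sum_comm]

/-- `conj ξ` acts on coefficient vectors as multiplication by `elem ξ` acts on the algebra, because
a product in the algebra is determined by its value on `v`. -/
theorem conj_mul_comb (h : CyclicFamily d L v W W') (ξ τ : Fin n → R) :
    conj L W W' ξ * ∑ l, τ l • (W' * L l * W)
      = ∑ l, (conj L W W' ξ *ᵥ τ) l • (W' * L l * W) := by
  have h1 : ∀ τ : Fin n → R, ∑ l, τ l • (W' * L l * W) = conj L W W' (W *ᵥ τ) := by
    intro τ; rw [conj_eq_sum, h.inv_mulVec']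
  rw [h1, h1, h.conj_mul, conj]
  congr 2
  have hc : ∀ l, elem L W' ξ * elem L W' (W *ᵥ τ) * L l
      = L l * (elem L W' ξ * elem L W' (W *ᵥ τ)) := by
    intro l
    rw [Matrix.mul_assoc, h.elem_comm, ← Matrix.mul_assoc, h.elem_comm, Matrix.mul_assoc]
  rw [h.eq_elem hc, ← Matrix.mulVec_mulVec, h.elem_mulVec, conj]
  simp only [← Matrix.mulVec_mulVec, h.inv_mulVec]

/-- Any vector field is a combination of the fields `L j v`. -/
theorem eq_sum_frame (h : CyclicFamily d L v W W') (ξ : Fin n → R) :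
    ξ = ∑ j, (W' *ᵥ ξ) j • (L j *ᵥ v) := by
  conv_lhs => rw [← h.elem_mulVec ξ]
  simp [elem, Matrix.sum_mulVec, Matrix.smul_mulVec]

/-- The fields `L j *ᵥ v` span all directions, so `map_deriv_conj` at `η = v` reduces every
derivative to the one along `v`. -/
theorem map_conj_dir (h : CyclicFamily d L v W W') (i : Fin n) (ξ : Fin n → R) :
    (W' * L i * W).map (dirDeriv d ξ)
      = conj L W W' ξ * (W' * L i * W).map (dirDeriv d v) := by
  conv_lhs => rw [h.eq_sum_frame ξ, map_dirDeriv_sum_smul]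
  rw [conj_eq_sum, Finset.sum_mul]
  exact Finset.sum_congr rfl fun j _ => by rw [h.map_deriv_conj, Matrix.smul_mul]

theorem vecDeriv_dir (h : CyclicFamily d L v W W') {N : Matrix (Fin n) (Fin n) R}
    (hN : ∀ l, N * L l = L l * N) (hs : ∀ j, StrongSym d (L j) N) (ξ : Fin n → R)
    {g : Fin n → R} (hg : W *ᵥ g = N *ᵥ v) :
    vecDeriv (dirDeriv d ξ) g = conj L W W' ξ *ᵥ vecDeriv (dirDeriv d v) g := by
  have h1 : vecDeriv (dirDeriv d ξ) g
      = ∑ j, (W' *ᵥ ξ) j • vecDeriv (dirDeriv d (L j *ᵥ v)) g := by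
    conv_lhs => rw [h.eq_sum_frame ξ]
    ext i
    simp [vecDeriv, dirDeriv_sum_smul]
  rw [h1, conj_eq_sum, Matrix.sum_mulVec]
  exact Finset.sum_congr rfl fun j _ => by
    rw [h.deriv_coeff hN (hs j) v hg, Matrix.smul_mulVec]

/-- Derivatives of the structure matrices cancel by `map_conj_dir`. What remains is the derivative
of the coefficients `W' *ᵥ η`, which is expressed through the derivatives of the `L i` because `η`
is constant. The right side is written so that its inner difference is symmetric in `i` and `j`, as
`conj_compat` requires. -/
theorem map_conj_sub (h : CyclicFamily d L v W W') (ξ : Fin n → R) {η : Fin n → R}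
    (hη : ∀ k i, d k (η i) = 0) :
    (conj L W W' η).map (dirDeriv d ξ)
        - conj L W W' ξ * (conj L W W' η).map (dirDeriv d v)
      = conj L W W' (∑ i, ∑ j, ((W' *ᵥ η) i * (W' *ᵥ ξ) j) •
          (L j *ᵥ ((L i).map (dirDeriv d v) *ᵥ v)
            - (L i).map (dirDeriv d (L j *ᵥ v)) *ᵥ v)) := by
  set b := W' *ᵥ η with hb
  have hD : ∀ ζ : Fin n → R, (conj L W W' η).map (dirDeriv d ζ)
      = ∑ i, (vecDeriv (dirDeriv d ζ) b i • (W' * L i * W)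
        + b i • (W' * L i * W).map (dirDeriv d ζ)) := by
    intro ζ
    rw [conj_eq_sum, map_deriv_sum]
    exact Finset.sum_congr rfl fun i _ => by rw [map_deriv_smul]; rfl
  -- Differentiate `W b = η` with `η` constant.
  have hb' : ∀ ζ, W *ᵥ vecDeriv (dirDeriv d ζ) b = -(W.map (dirDeriv d ζ) *ᵥ b) := by
    intro ζ
    have h1 := vecDeriv_mulVec (dirDeriv d ζ) W b
    have h2 : vecDeriv (dirDeriv d ζ) η = 0 := by
      ext i; simp [vecDeriv, dirDeriv_apply, hη]
    rw [hb, h.inv_mulVec, h2] at h1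
    rw [eq_neg_iff_add_eq_zero, add_comm]; exact h1.symm
  have step : (conj L W W' η).map (dirDeriv d ξ)
        - conj L W W' ξ * (conj L W W' η).map (dirDeriv d v)
      = ∑ l, (vecDeriv (dirDeriv d ξ) b
          - conj L W W' ξ *ᵥ vecDeriv (dirDeriv d v) b) l • (W' * L l * W) := by
    rw [hD, hD, Finset.sum_add_distrib, Finset.sum_add_distrib, Matrix.mul_add, h.conj_mul_comb]
    simp only [Pi.sub_apply, sub_smul, Finset.sum_sub_distrib, h.map_conj_dir _ ξ,
      Finset.mul_sum, Matrix.mul_smul]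
    abel
  have hW : ∑ l, (vecDeriv (dirDeriv d ξ) b
          - conj L W W' ξ *ᵥ vecDeriv (dirDeriv d v) b) l • (W' * L l * W)
      = conj L W W' (W *ᵥ (vecDeriv (dirDeriv d ξ) b
          - conj L W W' ξ *ᵥ vecDeriv (dirDeriv d v) b)) := by
    rw [conj_eq_sum (W *ᵥ _), h.inv_mulVec']
  rw [step, hW]
  congr 1
  rw [Matrix.mulVec_sub, conj]
  simp only [← Matrix.mulVec_mulVec, h.inv_mulVec, hb', h.map_frame_mulVec]
  conv_lhs => rw [h.eq_sum_frame ξ]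
  simp only [Matrix.mulVec_neg, sub_neg_eq_add, map_dirDeriv_sum_smul]
  rw [← h.eq_sum_frame ξ, elem]
  simp only [Matrix.sum_mulVec, Matrix.mulVec_sum, Matrix.smul_mulVec, Matrix.mulVec_smul,
    smul_sub, Finset.sum_sub_distrib, Finset.smul_sum, smul_smul]
  rw [neg_add_eq_sub, sub_left_inj]

/-- Compatibility of the first order system attached to the family. -/
theorem conj_compat (h : CyclicFamily d L v W W') {ξ η : Fin n → R}
    (hξ : ∀ k i, d k (ξ i) = 0) (hη : ∀ k i, d k (η i) = 0) :
    (conj L W W' η).map (dirDeriv d ξ) - (conj L W W' ξ).map (dirDeriv d η)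
      = (conj L W W' η).map (dirDeriv d v) * conj L W W' ξ
        - (conj L W W' ξ).map (dirDeriv d v) * conj L W W' η := by
  have h1 := h.map_conj_sub ξ hη
  have h2 := h.map_conj_sub η hξ
  -- This is the strong symmetry of `L i` and `L j` at `(v, v)`. It shows that the right side of
  -- `map_conj_sub` does not change when `ξ` and `η` are exchanged.
  have h3 : ∀ i j, L j *ᵥ ((L i).map (dirDeriv d v) *ᵥ v)
        - (L i).map (dirDeriv d (L j *ᵥ v)) *ᵥ v
      = L i *ᵥ ((L j).map (dirDeriv d v) *ᵥ v)
        - (L j).map (dirDeriv d (L i *ᵥ v)) *ᵥ v := by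
    intro i j
    have := h.strong i j v v
    rw [Matrix.sub_mulVec, Matrix.sub_mulVec, ← Matrix.mulVec_mulVec, ← Matrix.mulVec_mulVec]
      at this
    rw [← neg_sub, ← this, neg_sub]
  have h4 : (∑ i, ∑ j, ((W' *ᵥ η) i * (W' *ᵥ ξ) j) •
          (L j *ᵥ ((L i).map (dirDeriv d v) *ᵥ v)
            - (L i).map (dirDeriv d (L j *ᵥ v)) *ᵥ v))
      = ∑ i, ∑ j, ((W' *ᵥ ξ) i * (W' *ᵥ η) j) •
          (L j *ᵥ ((L i).map (dirDeriv d v) *ᵥ v)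
            - (L i).map (dirDeriv d (L j *ᵥ v)) *ᵥ v) := by
    rw [Finset.sum_comm]
    exact Finset.sum_congr rfl fun i _ => Finset.sum_congr rfl fun j _ => by
      rw [h3 j i, mul_comm]
  rw [h4, ← h2] at h1
  -- Differentiating the commutation of `conj ξ` and `conj η` along `v` turns the left
  -- multiplications in `h1` into right multiplications.
  have h5 := congrArg (fun A : Matrix (Fin n) (Fin n) R => A.map (dirDeriv d v)) (h.conj_comm ξ η)
  simp only [map_deriv_mul] at h5
  rw [sub_eq_sub_iff_add_eq_add] at h1 ⊢
  have h6 := congrArg₂ (· + ·) h1 h5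
  rw [← sub_eq_zero] at h6 ⊢
  rw [← h6]; abel

/-- The operators of the first order system attached to the family, on row vectors. -/
def op (d : Fin n → Derivation ℝ R R) (L : Fin n → Matrix (Fin n) (Fin n) R) (v : Fin n → R)
    (W W' : Matrix (Fin n) (Fin n) R) (k : Fin n) (F : Fin n → R) : Fin n → R :=
  vecDeriv (d k) F - vecDeriv (dirDeriv d v) F ᵥ* conj L W W' (Pi.single k 1)

theorem dirDeriv_comm (h : CyclicFamily d L v W W') (hd : ∀ k l f, d k (d l f) = d l (d k f))
    (k : Fin n) (f : R) : d k (dirDeriv d v f) = dirDeriv d v (d k f) := by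
  simp [dirDeriv_apply, h.const, hd k]

/-- In the commutator the second derivatives of `F` cancel, since partial derivatives commute and so
do the matrices `conj`. The first order part is exactly `conj_compat`. -/
theorem op_comm (h : CyclicFamily d L v W W') (hd : ∀ k l f, d k (d l f) = d l (d k f))
    (k l : Fin n) (F : Fin n → R) :
    op d L v W W' k (op d L v W W' l F) = op d L v W W' l (op d L v W W' k F) := by
  have hsingle : ∀ k : Fin n, ∀ j i, d j ((Pi.single k 1 : Fin n → R) i) = 0 := by
    intro k j i; by_cases h : i = k
    · subst h; simp
    · simp [h]
  have hsub : ∀ (D : Derivation ℝ R R) (f g : Fin n → R),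
      vecDeriv D (f - g) = vecDeriv D f - vecDeriv D g := by
    intro D f g; ext i; simp [vecDeriv]
  have hc := h.conj_compat (hsingle k) (hsingle l)
  have hm : ∀ (A : Matrix (Fin n) (Fin n) R) k,
      A.map (dirDeriv d (Pi.single k 1)) = A.map (d k) := by
    intro A k; ext i j; simp [dirDeriv_single]
  rw [hm, hm] at hc
  have hkv : ∀ k, vecDeriv (d k) (vecDeriv (dirDeriv d v) F)
      = vecDeriv (dirDeriv d v) (vecDeriv (d k) F) := by
    intro k; ext i; exact h.dirDeriv_comm hd k _
  have hkl : vecDeriv (d k) (vecDeriv (d l) F) = vecDeriv (d l) (vecDeriv (d k) F) := by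
    ext i; exact hd k l _
  have hc' := congrArg (fun A => vecDeriv (dirDeriv d v) F ᵥ* A) hc
  simp only [Matrix.vecMul_sub, ← Matrix.vecMul_vecMul] at hc'
  simp only [op, hsub, vecDeriv_vecMul, Matrix.sub_vecMul, Matrix.add_vecMul, hkv, hkl,
    Matrix.vecMul_vecMul, h.conj_comm (Pi.single k 1)] at hc' ⊢
  rw [← sub_eq_zero] at hc' ⊢
  rw [← neg_eq_zero, ← hc']; abel

/-- The covector β = (D_v F) W' is fixed by β(L_i v) = D_v F_i. Since e_k = elem(e_k) v and the
algebra commutes, β(L_i e_k) = β(elem(e_k) L_i v). This is the i-th entry of (D_v F) conj(e_k),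
which the system identifies with ∂_k F_i. -/
theorem vecMul_apply_of_op (h : CyclicFamily d L v W W') {F : Fin n → R}
    (hF : ∀ k, op d L v W W' k F = 0) (i k : Fin n) :
    ((vecDeriv (dirDeriv d v) F ᵥ* W') ᵥ* L i) k = d k (F i) := by
  have h1 := congrFun (hF k) i
  simp only [op, Pi.sub_apply, Pi.zero_apply, sub_eq_zero] at h1
  change d k (F i) = _ at h1
  rw [h1, conj, Matrix.mul_assoc, ← Matrix.vecMul_vecMul]
  have h2 : (elem L W' (Pi.single k 1) * W).col i = (L i).col k := by
    rw [h.mul_frame_col, Matrix.mulVec_mulVec, h.elem_comm, ← Matrix.mulVec_mulVec,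
      h.elem_mulVec, Matrix.mulVec_single_one]
  simp only [Matrix.vecMul, dotProduct]
  exact Finset.sum_congr rfl fun p _ => by
    rw [show L i p k = (L i).col k p from rfl, ← h2]; rfl

/-- Writing the identity as ∑ g_i L_i gives β = ∑ g_i dF_i, hence dβ = ∑ dg_i ∧ dF_i. Both dg and dF
arise from their derivatives along `v` through the commuting matrices `conj`, so ∑ ∂_k g_i ∂_m F_i
is symmetric in k and m. -/
theorem closed_of_op (h : CyclicFamily d L v W W') (hd : ∀ k l f, d k (d l f) = d l (d k f))
    {F : Fin n → R} (hF : ∀ k, op d L v W W' k F = 0) (k m : Fin n) :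
    d k ((vecDeriv (dirDeriv d v) F ᵥ* W') m) = d m ((vecDeriv (dirDeriv d v) F ᵥ* W') k) := by
  set β := vecDeriv (dirDeriv d v) F ᵥ* W' with hβ
  set g := W' *ᵥ v with hg
  have hg1 : W *ᵥ g = (1 : Matrix (Fin n) (Fin n) R) *ᵥ v := by
    rw [hg, h.inv_mulVec, Matrix.one_mulVec]
  have h1 : ∀ m, β m = ∑ i, g i * d m (F i) := by
    intro m
    have := h.eq_comb (T := 1) (by simp) hg1
    calc β m = (β ᵥ* (1 : Matrix (Fin n) (Fin n) R)) m := by rw [Matrix.vecMul_one]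
      _ = _ := by
        rw [this]
        simp only [← h.vecMul_apply_of_op hF, ← hβ, Matrix.vecMul_sum, Matrix.vecMul_smul,
          Finset.sum_apply, Pi.smul_apply, smul_eq_mul]
  have h2 : ∀ k m, ∑ i, d k (g i) * d m (F i)
      = vecDeriv (dirDeriv d v) F ⬝ᵥ ((conj L W W' (Pi.single m 1)
        * conj L W W' (Pi.single k 1)) *ᵥ vecDeriv (dirDeriv d v) g) := by
    intro k m
    have h3 := h.vecDeriv_dir (N := 1) (by simp) (fun j => StrongSym.one (L j)) (Pi.single k 1) hg1
    have h4 := hF m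
    rw [op, sub_eq_zero] at h4
    rw [← Matrix.mulVec_mulVec, ← h3, Matrix.dotProduct_mulVec, ← h4]
    simp [dotProduct, vecDeriv, dirDeriv_single, mul_comm]
  have h5 : ∀ k m, d k (β m) = ∑ i, g i * d k (d m (F i)) + ∑ i, d k (g i) * d m (F i) := by
    intro k m
    simp only [h1, map_sum, Derivation.leibniz, smul_eq_mul, Finset.sum_add_distrib]
    congr 1
    exact Finset.sum_congr rfl fun i _ => by ring
  rw [h5, h5, h2, h2, h.conj_comm]
  congr 1
  exact Finset.sum_congr rfl fun i _ => by rw [hd]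

end CyclicFamily

end DerivationAlgebra
end

noncomputable section

/-! ### Formal solutions of first order systems -/

namespace MvPowerSeries

variable {n : ℕ}

theorem le_order_iff {s : MvPowerSeries (Fin n) ℝ} {N : ℕ} :
    (N : ℕ∞) ≤ s.order ↔ ∀ d : Fin n →₀ ℕ, d.degree < N → coeff d s = 0 :=
  ⟨fun h _ hd => coeff_of_lt_order (lt_of_lt_of_le (by exact_mod_cast hd) h), nat_le_order⟩

theorem eq_zero_of_le_order {s : MvPowerSeries (Fin n) ℝ} (h : ∀ N : ℕ, (N : ℕ∞) ≤ s.order) :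
    s = 0 := by
  ext d
  exact le_order_iff.mp (h (d.degree + 1)) d (Nat.lt_succ_self _)

theorem le_order_add {s t : MvPowerSeries (Fin n) ℝ} {N : ℕ∞} (hs : N ≤ s.order)
    (ht : N ≤ t.order) : N ≤ (s + t).order :=
  le_trans (le_min hs ht) min_order_le_add

theorem le_order_sub {s t : MvPowerSeries (Fin n) ℝ} {N : ℕ∞} (hs : N ≤ s.order)
    (ht : N ≤ t.order) : N ≤ (s - t).order := by
  rw [sub_eq_add_neg]; exact le_order_add hs (by rwa [order_neg])

theorem le_order_sum {ι : Type*} (I : Finset ι) {s : ι → MvPowerSeries (Fin n) ℝ} {N : ℕ∞}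
    (hs : ∀ i ∈ I, N ≤ (s i).order) : N ≤ (∑ i ∈ I, s i).order := by
  induction I using Finset.cons_induction with
  | empty => simp
  | cons a I ha ih =>
    rw [Finset.sum_cons]
    exact le_order_add (hs a (by simp)) (ih fun i hi => hs i (by simp [hi]))

theorem le_order_mul_right {s t : MvPowerSeries (Fin n) ℝ} {N : ℕ∞} (hs : N ≤ s.order) :
    N ≤ (s * t).order := le_trans (le_trans hs le_self_add) le_order_mul

theorem le_order_pderiv {s : MvPowerSeries (Fin n) ℝ} {N : ℕ} (k : Fin n)
    (hs : ((N + 1 : ℕ) : ℕ∞) ≤ s.order) : (N : ℕ∞) ≤ (pderiv ℝ k s).order := by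
  rw [le_order_iff] at hs ⊢
  intro d hd
  rw [coeff_pderiv, hs, zero_mul]
  rw [map_add, Finsupp.degree_single]; omega

/-- The sum of a sequence of power series whose `m`-th term has order at least `m`. -/
def formalSum (a : ℕ → MvPowerSeries (Fin n) ℝ) : MvPowerSeries (Fin n) ℝ :=
  fun d => ∑ m ∈ Finset.range (d.degree + 1), coeff d (a m)

theorem coeff_formalSum (a : ℕ → MvPowerSeries (Fin n) ℝ) (d : Fin n →₀ ℕ) :
    coeff d (formalSum a) = ∑ m ∈ Finset.range (d.degree + 1), coeff d (a m) := rfl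

theorem le_order_formalSum_sub {a : ℕ → MvPowerSeries (Fin n) ℝ}
    (ha : ∀ m : ℕ, (m : ℕ∞) ≤ (a m).order) (N : ℕ) :
    (N : ℕ∞) ≤ (formalSum a - ∑ m ∈ Finset.range N, a m).order := by
  rw [le_order_iff]
  intro d hd
  rw [map_sub, coeff_formalSum, map_sum, sub_eq_zero]
  refine Finset.sum_subset (by intro; simp; omega) fun m _ hm => ?_
  exact le_order_iff.mp (ha m) d (by simpa using hm)

theorem pderiv_comm (k l : Fin n) (s : MvPowerSeries (Fin n) ℝ) :
    pderiv ℝ k (pderiv ℝ l s) = pderiv ℝ l (pderiv ℝ k s) := by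
  ext d
  simp only [coeff_pderiv, Finsupp.add_apply, add_right_comm d (Finsupp.single k 1)]
  by_cases h : k = l
  · subst h; ring
  · rw [Finsupp.single_eq_of_ne (Ne.symm h), Finsupp.single_eq_of_ne h]; push_cast; ring

/-- `Q` is a first order operator on vectors of power series: it lowers the order by at most
one. -/
structure IsFirstOrder {ι : Type*}
    (Q : (ι → MvPowerSeries (Fin n) ℝ) →ₗ[ℝ] (ι → MvPowerSeries (Fin n) ℝ)) : Prop where
  le_order : ∀ (N : ℕ) F, (∀ i, ((N + 1 : ℕ) : ℕ∞) ≤ (F i).order) → ∀ i, (N : ℕ∞) ≤ (Q F i).order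

section flow

variable {ι : Type*}

/-- The terms of the series defining the solution operator. -/
def flowTerm (t : MvPowerSeries (Fin n) ℝ)
    (Q : (ι → MvPowerSeries (Fin n) ℝ) →ₗ[ℝ] (ι → MvPowerSeries (Fin n) ℝ))
    (F : ι → MvPowerSeries (Fin n) ℝ) (m : ℕ) : ι → MvPowerSeries (Fin n) ℝ :=
  ((-1) ^ m / (m.factorial : ℝ)) • (t ^ m • (Q ^ m) F)

/-- The projection `∑ (-t)^m / m! Q^m` onto the kernel of `Q`, if `[Q, t] = 1`. -/
def flow (t : MvPowerSeries (Fin n) ℝ)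
    (Q : (ι → MvPowerSeries (Fin n) ℝ) →ₗ[ℝ] (ι → MvPowerSeries (Fin n) ℝ))
    (F : ι → MvPowerSeries (Fin n) ℝ) : ι → MvPowerSeries (Fin n) ℝ :=
  fun i => formalSum fun m => flowTerm t Q F m i

variable {t : MvPowerSeries (Fin n) ℝ}
  {Q : (ι → MvPowerSeries (Fin n) ℝ) →ₗ[ℝ] (ι → MvPowerSeries (Fin n) ℝ)}

theorem le_order_flowTerm (ht : constantCoeff t = 0) (F : ι → MvPowerSeries (Fin n) ℝ) (m : ℕ)
    (i : ι) : (m : ℕ∞) ≤ (flowTerm t Q F m i).order := by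
  refine le_trans ?_ le_order_smul
  exact le_order_mul_right (le_order_pow_of_constantCoeff_eq_zero m ht)

theorem le_order_flow_sub (ht : constantCoeff t = 0) (F : ι → MvPowerSeries (Fin n) ℝ) (N : ℕ)
    (i : ι) :
    (N : ℕ∞) ≤ ((flow t Q F - ∑ m ∈ Finset.range N, flowTerm t Q F m) i).order := by
  have := le_order_formalSum_sub (fun m => le_order_flowTerm (Q := Q) ht F m i) N
  simpa [flow] using this

theorem pow_smul_comm (hQt : ∀ F, Q (t • F) = t • Q F + F) (m : ℕ)
    (F : ι → MvPowerSeries (Fin n) ℝ) :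
    Q (t ^ (m + 1) • F) = t ^ (m + 1) • Q F + ((m + 1 : ℕ) : ℝ) • (t ^ m • F) := by
  induction m with
  | zero => simpa using hQt F
  | succ m ih =>
    rw [pow_succ' t (m + 1), mul_smul, hQt, ih, smul_add, mul_smul, smul_comm t (((m + 1 : ℕ) : ℝ)),
      smul_smul t (t ^ m), ← pow_succ', smul_smul t (t ^ (m + 1)), ← pow_succ', add_assoc]
    congr 1
    rw [Nat.cast_succ (m + 1), add_smul _ (1 : ℝ), one_smul]

/-- As [Q, t] = 1, the derivative of t^(m+1) in one term cancels the term Q^(m+1) F left over from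
the previous one. The sum telescopes to a remainder of order at least `N`. -/
theorem apply_sum_flowTerm (hQt : ∀ F, Q (t • F) = t • Q F + F)
    (F : ι → MvPowerSeries (Fin n) ℝ) (N : ℕ) :
    Q (∑ m ∈ Finset.range (N + 1), flowTerm t Q F m)
      = ((-1) ^ N / (N.factorial : ℝ)) • (t ^ N • (Q ^ (N + 1)) F) := by
  induction N with
  | zero => simp [flowTerm]
  | succ N ih =>
    rw [Finset.sum_range_succ, map_add, ih, flowTerm, map_smul, pow_smul_comm hQt, smul_add,
      pow_succ' Q (N + 1), Module.End.mul_apply, smul_smul]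
    have : (-1) ^ (N + 1) / ((N + 1).factorial : ℝ) * ((N + 1 : ℕ) : ℝ)
        = -((-1) ^ N / (N.factorial : ℝ)) := by
      rw [Nat.factorial_succ]; push_cast
      field_simp
      ring
    rw [this, neg_smul]
    abel

theorem flow_mem_ker (hQ : IsFirstOrder Q) (ht : constantCoeff t = 0)
    (hQt : ∀ F, Q (t • F) = t • Q F + F) (F : ι → MvPowerSeries (Fin n) ℝ) :
    Q (flow t Q F) = 0 := by
  ext1 i
  refine eq_zero_of_le_order fun N => ?_
  -- The tail is cut at `N + 1` because `Q` may lower the order by one.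
  have h1 := hQ.le_order N _ (le_order_flow_sub (Q := Q) ht F (N + 1)) i
  rw [map_sub, apply_sum_flowTerm hQt] at h1
  have h2 : (N : ℕ∞) ≤ ((((-1) ^ N / (N.factorial : ℝ)) • (t ^ N • (Q ^ (N + 1)) F)) i).order :=
    le_trans (le_order_mul_right (le_order_pow_of_constantCoeff_eq_zero N ht)) le_order_smul
  have := le_order_add h1 h2
  simpa using this

/-- `P` commutes with `t` and with `Q`, hence with each term of the series; order estimates for the
tails carry this over to the infinite sum. This keeps equations that are already solved. -/
theorem flow_commute {P : (ι → MvPowerSeries (Fin n) ℝ) →ₗ[ℝ] (ι → MvPowerSeries (Fin n) ℝ)}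
    (hP : IsFirstOrder P) (ht : constantCoeff t = 0) (hPt : ∀ F, P (t • F) = t • P F)
    (hPQ : ∀ F, P (Q F) = Q (P F)) (F : ι → MvPowerSeries (Fin n) ℝ) :
    P (flow t Q F) = flow t Q (P F) := by
  have hm : ∀ m, P (flowTerm t Q F m) = flowTerm t Q (P F) m := by
    intro m
    have h1 : ∀ m F, P (t ^ m • F) = t ^ m • P F := by
      intro m
      induction m with
      | zero => simp
      | succ m ih => intro F; rw [pow_succ, mul_smul, ih, hPt, mul_smul]
    have h2 : ∀ m F, P ((Q ^ m) F) = (Q ^ m) (P F) := by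
      intro m
      induction m with
      | zero => simp
      | succ m ih => intro F; rw [pow_succ, Module.End.mul_apply, ih, hPQ, Module.End.mul_apply]
    rw [flowTerm, map_smul, h1, h2, flowTerm]
  ext1 i
  rw [← sub_eq_zero]
  refine eq_zero_of_le_order fun N => ?_
  have h1 := hP.le_order N _ (le_order_flow_sub (Q := Q) ht F (N + 1)) i
  have h2 : (N : ℕ∞) ≤ _ := le_trans (by exact_mod_cast Nat.le_succ N)
    (le_order_flow_sub (Q := Q) ht (P F) (N + 1) i)
  rw [map_sub, map_sum, Finset.sum_congr rfl fun m _ => hm m] at h1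
  have := le_order_sub h1 h2
  simpa using this

/-- Modulo order two the flow is F - t Q F. As t vanishes at the origin and D t = 0, the second term
does not change the derivative at the origin, so the initial data survive. -/
theorem constantCoeff_deriv_flow (ht : constantCoeff t = 0)
    {D : Derivation ℝ (MvPowerSeries (Fin n) ℝ) (MvPowerSeries (Fin n) ℝ)}
    (hD : ∀ s : MvPowerSeries (Fin n) ℝ, ((2 : ℕ) : ℕ∞) ≤ s.order → constantCoeff (D s) = 0)
    (hDt : D t = 0) (F : ι → MvPowerSeries (Fin n) ℝ) (i : ι) :
    constantCoeff (D (flow t Q F i)) = constantCoeff (D (F i)) := by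
  have h1 := hD _ (le_order_flow_sub (Q := Q) ht F 2 i)
  simp only [Finset.sum_range_succ, Finset.sum_range_zero, flowTerm, Pi.sub_apply, Pi.add_apply,
    Pi.smul_apply, map_sub, map_add, smul_eq_mul, pow_one, pow_zero, zero_add,
    Nat.factorial] at h1
  simp [ht, hDt] at h1
  linear_combination h1

end flow

/-- The primitive of a closed formal 1-form, by the homotopy formula. -/
def primitive (β : Fin n → MvPowerSeries (Fin n) ℝ) : MvPowerSeries (Fin n) ℝ :=
  fun d => ∑ j, coeff d (X j * β j) / d.degree

/-- This is Euler's identity coefficientwise. By closedness, the product X_j β_j contributes d_j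
(plus one if j = k) times the coefficient of β_k, and these numbers add up to the total degree by
which `primitive` divides. Degree 0, where division by zero returns 0, never occurs for the exponent
d + e_k. -/
theorem pderiv_primitive {β : Fin n → MvPowerSeries (Fin n) ℝ}
    (hβ : ∀ k m, pderiv ℝ k (β m) = pderiv ℝ m (β k)) (k : Fin n) :
    pderiv ℝ k (primitive β) = β k := by
  ext d
  rw [coeff_pderiv]
  change (∑ j, coeff (d + Finsupp.single k 1) (X j * β j) /
    ((d + Finsupp.single k 1).degree : ℝ)) * _ = _
  have hdeg : ((d + Finsupp.single k 1).degree : ℝ) = (∑ j, (d j : ℝ)) + 1 := by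
    rw [map_add, Finsupp.degree_single, Finsupp.degree_eq_sum]; push_cast; rfl
  have hpos : (∑ j, (d j : ℝ)) + 1 ≠ 0 := by positivity
  have key : ∀ j, coeff (d + Finsupp.single k 1) (X j * β j) * (d k + 1)
      = (d j + if j = k then 1 else 0) * coeff d (β k) := by
    intro j
    rw [mul_comm (X j)]
    by_cases hjk : j = k
    · subst hjk
      rw [X_def, coeff_add_mul_monomial]; simp [mul_comm]
    · rw [if_neg hjk, add_zero]
      by_cases hj : d j = 0
      · have : ¬ Finsupp.single j 1 ≤ d + Finsupp.single k 1 := by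
          intro h
          have := h j
          simp [hj, Finsupp.single_eq_of_ne hjk] at this
        rw [hj]
        rw [X_def, coeff_mul_monomial]
        simp [this]
      · obtain ⟨e, rfl⟩ : ∃ e, d = e + Finsupp.single j 1 := by
          refine ⟨d - Finsupp.single j 1, (tsub_add_cancel_of_le ?_).symm⟩
          rw [Finsupp.single_le_iff]; omega
        have h1 := congrArg (coeff e) (hβ k j)
        rw [coeff_pderiv, coeff_pderiv] at h1
        rw [add_right_comm, X_def, coeff_add_mul_monomial]
        simp only [Finsupp.add_apply, Finsupp.single_eq_same,
          Finsupp.single_eq_of_ne (Ne.symm hjk), add_zero]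
        push_cast
        linarith
  rw [hdeg, ← Finset.sum_div, div_mul_eq_mul_div, div_eq_iff hpos, Finset.sum_mul,
    Finset.sum_congr rfl fun j _ => key j, ← Finset.sum_mul, Finset.sum_add_distrib]
  simp [mul_comm]

end MvPowerSeries
end

noncomputable section

/-! ### Convergent power series -/

namespace MvPowerSeries

open scoped ENNReal NNReal

variable {n : ℕ}

/-- The weighted `ℓ¹` norm of a power series with polyradius `r`. -/
def mvNorm (r : ℝ≥0) (s : MvPowerSeries (Fin n) ℝ) : ℝ≥0∞ :=
  ∑' d : Fin n →₀ ℕ, ‖coeff d s‖ₑ * (r : ℝ≥0∞) ^ d.degree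

theorem mvNorm_mono {r r' : ℝ≥0} (h : r ≤ r') (s : MvPowerSeries (Fin n) ℝ) :
    mvNorm r s ≤ mvNorm r' s :=
  ENNReal.tsum_le_tsum fun d => by gcongr

theorem mvNorm_zero (r : ℝ≥0) : mvNorm r (0 : MvPowerSeries (Fin n) ℝ) = 0 := by
  simp [mvNorm]

theorem mvNorm_add_le (r : ℝ≥0) (s t : MvPowerSeries (Fin n) ℝ) :
    mvNorm r (s + t) ≤ mvNorm r s + mvNorm r t := by
  rw [mvNorm, mvNorm, mvNorm, ← ENNReal.tsum_add]
  refine ENNReal.tsum_le_tsum fun d => ?_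
  rw [← add_mul, map_add]
  gcongr
  exact enorm_add_le _ _

theorem mvNorm_smul (r : ℝ≥0) (c : ℝ) (s : MvPowerSeries (Fin n) ℝ) :
    mvNorm r (c • s) = ‖c‖ₑ * mvNorm r s := by
  rw [mvNorm, mvNorm, ← ENNReal.tsum_mul_left]
  exact tsum_congr fun d => by rw [map_smul, smul_eq_mul, enorm_mul, mul_assoc]

theorem mvNorm_neg (r : ℝ≥0) (s : MvPowerSeries (Fin n) ℝ) : mvNorm r (-s) = mvNorm r s := by
  simp [mvNorm]

theorem mvNorm_sub_le (r : ℝ≥0) (s t : MvPowerSeries (Fin n) ℝ) :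
    mvNorm r (s - t) ≤ mvNorm r s + mvNorm r t := by
  rw [sub_eq_add_neg, ← mvNorm_neg r t]; exact mvNorm_add_le r s (-t)

theorem mvNorm_sum_le {ι : Type*} (r : ℝ≥0) (I : Finset ι) (s : ι → MvPowerSeries (Fin n) ℝ) :
    mvNorm r (∑ i ∈ I, s i) ≤ ∑ i ∈ I, mvNorm r (s i) := by
  induction I using Finset.cons_induction with
  | empty => simp [mvNorm_zero]
  | cons a I ha ih =>
    rw [Finset.sum_cons, Finset.sum_cons]
    exact (mvNorm_add_le _ _ _).trans (by gcongr)

theorem mvNorm_mul_le (r : ℝ≥0) (s t : MvPowerSeries (Fin n) ℝ) :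
    mvNorm r (s * t) ≤ mvNorm r s * mvNorm r t := by
  have h1 : mvNorm r s * mvNorm r t = ∑' x : (Fin n →₀ ℕ) × (Fin n →₀ ℕ),
      (‖coeff x.1 s‖ₑ * (r : ℝ≥0∞) ^ x.1.degree) * (‖coeff x.2 t‖ₑ * (r : ℝ≥0∞) ^ x.2.degree) := by
    rw [ENNReal.tsum_prod', mvNorm, mvNorm, ← ENNReal.tsum_mul_right]
    exact tsum_congr fun d => ENNReal.tsum_mul_left.symm
  rw [h1, ← Finset.HasAntidiagonal.sigmaAntidiagonalEquivProd.tsum_eq, ENNReal.tsum_sigma']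
  refine ENNReal.tsum_le_tsum fun d => ?_
  rw [tsum_fintype, coeff_mul]
  refine (mul_le_mul_left (enorm_sum_le _ _) _).trans ?_
  rw [Finset.sum_mul, ← Finset.sum_coe_sort]
  refine Finset.sum_le_sum fun x _ => ?_
  have hx : (x : (Fin n →₀ ℕ) × (Fin n →₀ ℕ)).1 + x.1.2 = d := by
    exact Finset.HasAntidiagonal.mem_antidiagonal.mp x.2
  change ‖coeff x.1.1 s * coeff x.1.2 t‖ₑ * _ ≤
    (‖coeff x.1.1 s‖ₑ * (r : ℝ≥0∞) ^ x.1.1.degree) *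
      (‖coeff x.1.2 t‖ₑ * (r : ℝ≥0∞) ^ x.1.2.degree)
  have hd : d.degree = x.1.1.degree + x.1.2.degree := by rw [← map_add, hx]
  rw [hd, pow_add, enorm_mul]
  apply le_of_eq
  ring

theorem mvNorm_one (r : ℝ≥0) : mvNorm r (1 : MvPowerSeries (Fin n) ℝ) = 1 := by
  classical
  rw [mvNorm, tsum_eq_single 0]
  · simp
  · intro d hd
    simp [coeff_one, hd]

theorem mvNorm_pow_le (r : ℝ≥0) (s : MvPowerSeries (Fin n) ℝ) (m : ℕ) :
    mvNorm r (s ^ m) ≤ mvNorm r s ^ m := by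
  induction m with
  | zero => simp [mvNorm_one]
  | succ m ih =>
    rw [pow_succ, pow_succ]
    exact (mvNorm_mul_le _ _ _).trans (by gcongr)

theorem mvNorm_X (r : ℝ≥0) (k : Fin n) : mvNorm r (X k : MvPowerSeries (Fin n) ℝ) = r := by
  classical
  rw [mvNorm, tsum_eq_single (Finsupp.single k 1)]
  · simp [coeff_index_single_self_X]
  · intro d hd
    simp [coeff_X, hd]

theorem succ_mul_pow_mul_le (a b : ℝ≥0∞) (m : ℕ) : (m + 1) * a ^ m * b ≤ (a + b) ^ (m + 1) := by
  induction m with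
  | zero => simp
  | succ m ih =>
    calc ((m + 1 : ℕ) + 1 : ℝ≥0∞) * a ^ (m + 1) * b
        = ((m + 1) * a ^ m * b) * a + a ^ (m + 1) * b := by push_cast; ring
      _ ≤ (a + b) ^ (m + 1) * a + (a + b) ^ (m + 1) * b := by gcongr; exact le_self_add
      _ = (a + b) ^ (m + 1 + 1) := by ring

/-- A Cauchy estimate: the factor d_k + 1 ≤ |d| + 1 created by differentiation is absorbed by the
larger radius, since (m + 1) r^m δ ≤ (r + δ)^(m + 1). -/
theorem mvNorm_pderiv_le (r δ : ℝ≥0) (k : Fin n) (s : MvPowerSeries (Fin n) ℝ) :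
    mvNorm r (pderiv ℝ k s) * δ ≤ mvNorm (r + δ) s := by
  rw [mvNorm, ← ENNReal.tsum_mul_right]
  have hinj : Function.Injective fun d : Fin n →₀ ℕ => d + Finsupp.single k 1 :=
    add_left_injective _
  refine le_trans (ENNReal.tsum_le_tsum fun d => ?_) (ENNReal.tsum_comp_le_tsum_of_injective hinj
    fun d => ‖coeff d s‖ₑ * ((r + δ : ℝ≥0) : ℝ≥0∞) ^ d.degree)
  simp only [coeff_pderiv, enorm_mul, map_add, Finsupp.degree_single]
  have h1 : ‖((d k : ℝ) + 1)‖ₑ ≤ (d.degree : ℝ≥0∞) + 1 := by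
    have : ((d k : ℝ) + 1) = ((d k + 1 : ℕ) : ℝ) := by push_cast; rfl
    rw [this, Real.enorm_natCast]
    exact_mod_cast Nat.succ_le_succ (Finsupp.le_degree k d)
  calc _ ≤ ‖coeff (d + Finsupp.single k 1) s‖ₑ * ((d.degree : ℝ≥0∞) + 1) * (r : ℝ≥0∞) ^ d.degree * δ := by
        gcongr
    _ = ‖coeff (d + Finsupp.single k 1) s‖ₑ * (((d.degree : ℝ≥0∞) + 1) * (r : ℝ≥0∞) ^ d.degree * δ) := by
        ring
    _ ≤ _ := by
        gcongr
        push_cast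
        exact succ_mul_pow_mul_le _ _ _

theorem mvNorm_formalSum_le (r : ℝ≥0) (a : ℕ → MvPowerSeries (Fin n) ℝ) :
    mvNorm r (formalSum a) ≤ ∑' m, mvNorm r (a m) := by
  simp only [mvNorm]
  rw [ENNReal.tsum_comm]
  refine ENNReal.tsum_le_tsum fun d => ?_
  rw [ENNReal.tsum_mul_right, coeff_formalSum]
  gcongr
  exact (enorm_sum_le _ _).trans (ENNReal.sum_le_tsum _)

/-- A power series that converges absolutely on some polydisc. -/
def IsConvergent (s : MvPowerSeries (Fin n) ℝ) : Prop := ∃ r : ℝ≥0, 0 < r ∧ mvNorm r s < ⊤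

theorem IsConvergent.add {s t : MvPowerSeries (Fin n) ℝ} (hs : IsConvergent s)
    (ht : IsConvergent t) : IsConvergent (s + t) := by
  obtain ⟨r, hr, hs⟩ := hs
  obtain ⟨r', hr', ht⟩ := ht
  refine ⟨min r r', lt_min hr hr', (mvNorm_add_le _ _ _).trans_lt (ENNReal.add_lt_top.mpr ⟨?_, ?_⟩)⟩
  · exact (mvNorm_mono (min_le_left _ _) _).trans_lt hs
  · exact (mvNorm_mono (min_le_right _ _) _).trans_lt ht

theorem IsConvergent.mul {s t : MvPowerSeries (Fin n) ℝ} (hs : IsConvergent s)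
    (ht : IsConvergent t) : IsConvergent (s * t) := by
  obtain ⟨r, hr, hs⟩ := hs
  obtain ⟨r', hr', ht⟩ := ht
  refine ⟨min r r', lt_min hr hr', (mvNorm_mul_le _ _ _).trans_lt (ENNReal.mul_lt_top ?_ ?_)⟩
  · exact (mvNorm_mono (min_le_left _ _) _).trans_lt hs
  · exact (mvNorm_mono (min_le_right _ _) _).trans_lt ht

theorem isConvergent_zero : IsConvergent (0 : MvPowerSeries (Fin n) ℝ) :=
  ⟨1, one_pos, by simp [mvNorm_zero]⟩

theorem IsConvergent.smul {s : MvPowerSeries (Fin n) ℝ} (c : ℝ) (hs : IsConvergent s) :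
    IsConvergent (c • s) := by
  obtain ⟨r, hr, hs⟩ := hs
  exact ⟨r, hr, by rw [mvNorm_smul]; exact ENNReal.mul_lt_top enorm_lt_top hs⟩

theorem IsConvergent.sum {ι : Type*} (I : Finset ι) {s : ι → MvPowerSeries (Fin n) ℝ}
    (hs : ∀ i ∈ I, IsConvergent (s i)) : IsConvergent (∑ i ∈ I, s i) := by
  induction I using Finset.cons_induction with
  | empty => simpa using isConvergent_zero
  | cons a I ha ih =>
    rw [Finset.sum_cons]
    exact (hs a (by simp)).add (ih fun i hi => hs i (by simp [hi]))

theorem isConvergent_X (k : Fin n) : IsConvergent (X k : MvPowerSeries (Fin n) ℝ) :=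
  ⟨1, one_pos, by rw [mvNorm_X]; exact ENNReal.coe_lt_top⟩

theorem isConvergent_C (c : ℝ) : IsConvergent (C c : MvPowerSeries (Fin n) ℝ) := by
  have : (C c : MvPowerSeries (Fin n) ℝ) = c • 1 := by rw [smul_eq_C_mul, mul_one]
  rw [this]
  exact IsConvergent.smul c ⟨1, one_pos, by simp [mvNorm_one]⟩

theorem IsConvergent.pderiv {s : MvPowerSeries (Fin n) ℝ} (hs : IsConvergent s) (k : Fin n) :
    IsConvergent (pderiv ℝ k s) := by
  obtain ⟨r, hr, hs⟩ := hs
  refine ⟨r / 2, half_pos hr, ?_⟩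
  have h := mvNorm_pderiv_le (r / 2) (r / 2) k s
  rw [add_halves] at h
  by_contra htop
  rw [not_lt, top_le_iff] at htop
  rw [htop, ENNReal.top_mul (by simpa using hr.ne')] at h
  exact (lt_of_le_of_lt h hs).ne rfl

theorem IsConvergent.primitive {β : Fin n → MvPowerSeries (Fin n) ℝ}
    (hβ : ∀ k, IsConvergent (β k)) : IsConvergent (primitive β) := by
  obtain ⟨r, hr, hs⟩ := IsConvergent.sum Finset.univ
    (s := fun j => X j * β j) fun j _ => (isConvergent_X j).mul (hβ j)
  refine ⟨r, hr, lt_of_le_of_lt (ENNReal.tsum_le_tsum fun d => ?_) hs⟩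
  gcongr
  have : coeff d (MvPowerSeries.primitive β) = coeff d (∑ j, X j * β j) / d.degree := by
    rw [map_sum, Finset.sum_div]; rfl
  rw [this, div_eq_mul_inv, enorm_mul]
  refine mul_le_of_le_one_right' ?_
  rw [← ofReal_norm, ENNReal.ofReal_le_one, norm_inv, Real.norm_natCast]
  exact Nat.cast_inv_le_one _

section flow

variable {ι : Type*} [Fintype ι]

/-- The weighted `ℓ¹` norm of a vector of power series. -/
def vecNorm (r : ℝ≥0) (F : ι → MvPowerSeries (Fin n) ℝ) : ℝ≥0∞ := ∑ i, mvNorm r (F i)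

theorem vecNorm_mono {r r' : ℝ≥0} (h : r ≤ r') (F : ι → MvPowerSeries (Fin n) ℝ) :
    vecNorm r F ≤ vecNorm r' F :=
  Finset.sum_le_sum fun _ _ => mvNorm_mono h _

/-- An estimate of Cauchy–Kovalevskaya type. Spending the radius r₀/2 in m equal steps bounds Q^m F
by (2K/r₀)^m m^m, and m^m ≤ 3^m m!. The factorial cancels against 1/m! in the flow, and the powers
of t leave a geometric series in 6AKr/r₀. -/
theorem vecNorm_flow_lt_top {t : MvPowerSeries (Fin n) ℝ}
    {Q : (ι → MvPowerSeries (Fin n) ℝ) →ₗ[ℝ] (ι → MvPowerSeries (Fin n) ℝ)}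
    {A K r₀ : ℝ≥0} (hr₀ : 0 < r₀) (ht : ∀ r : ℝ≥0, mvNorm r t ≤ A * r)
    (hQ : ∀ (r δ : ℝ≥0) F, r + δ ≤ r₀ → vecNorm r (Q F) * δ ≤ K * vecNorm (r + δ) F)
    {F : ι → MvPowerSeries (Fin n) ℝ} (hF : vecNorm r₀ F < ⊤) :
    ∃ r : ℝ≥0, 0 < r ∧ r ≤ r₀ ∧ vecNorm r (flow t Q F) < ⊤ := by
  have hpow : ∀ (j : ℕ) (r δ : ℝ≥0), r + j * δ ≤ r₀ →
      vecNorm r ((Q ^ j) F) * (δ : ℝ≥0∞) ^ j ≤ (K : ℝ≥0∞) ^ j * vecNorm (r + j * δ) F := by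
    intro j
    induction j with
    | zero => intro r δ _; simp
    | succ j ih =>
      intro r δ h
      have e : r + (j + 1 : ℕ) * δ = r + δ + j * δ := by push_cast; ring
      rw [e] at h ⊢
      rw [pow_succ' Q, Module.End.mul_apply]
      calc vecNorm r (Q ((Q ^ j) F)) * (δ : ℝ≥0∞) ^ (j + 1)
          = vecNorm r (Q ((Q ^ j) F)) * δ * (δ : ℝ≥0∞) ^ j := by ring
        _ ≤ K * vecNorm (r + δ) ((Q ^ j) F) * (δ : ℝ≥0∞) ^ j :=
            mul_le_mul_left (hQ _ _ _ (le_trans le_self_add h)) _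
        _ = K * (vecNorm (r + δ) ((Q ^ j) F) * (δ : ℝ≥0∞) ^ j) := by ring
        _ ≤ K * ((K : ℝ≥0∞) ^ j * vecNorm (r + δ + j * δ) F) :=
            mul_le_mul_right (ih _ _ h) _
        _ = _ := by ring
  have hfact : ∀ m : ℕ, ((m : ℝ≥0∞)) ^ m ≤ 3 ^ m * (m.factorial : ℝ≥0∞) := by
    intro m
    have h1 : (m : ℝ) ^ m / m.factorial ≤ Real.exp m :=
      Real.pow_div_factorial_le_exp m (Nat.cast_nonneg m) m
    have h2 : Real.exp m ≤ 3 ^ m := by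
      rw [← mul_one (m : ℝ), Real.exp_nat_mul]
      exact pow_le_pow_left₀ (Real.exp_pos _).le (by linarith [Real.exp_one_lt_d9]) m
    have h3 : (m : ℝ) ^ m ≤ 3 ^ m * m.factorial := by
      rw [div_le_iff₀ (by positivity)] at h1
      exact h1.trans (by gcongr)
    have h4 : m ^ m ≤ 3 ^ m * m.factorial := by exact_mod_cast h3
    exact_mod_cast h4
  -- The bound r ≤ r₀/2 leaves r₀/2 for the Cauchy estimates. The constant 12 yields 3AKr ≤ r₀/4,
  -- hence ratio at most 1/2; the added 1 keeps the denominator positive.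
  set r : ℝ≥0 := min (r₀ / 2) (r₀ / (12 * (A * K + 1))) with hr
  have hrpos : 0 < r := lt_min (half_pos hr₀) (by positivity)
  have hr2 : r ≤ r₀ / 2 := min_le_left _ _
  have hr3 : 3 * (A * K) * r ≤ r₀ / 4 := by
    have h1 : r ≤ r₀ / (12 * (A * K + 1)) := min_le_right _ _
    calc 3 * (A * K) * r ≤ 3 * (A * K + 1) * (r₀ / (12 * (A * K + 1))) := by
          gcongr; exact le_self_add
      _ = r₀ / 4 := by field_simp; norm_num
  refine ⟨r, hrpos, hr2.trans (half_le_self hr₀.le), ?_⟩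
  have hterm : ∀ m, ∑ i, mvNorm r (flowTerm t Q F m i) ≤ (2⁻¹ : ℝ≥0∞) ^ m * vecNorm r₀ F := by
    intro m
    have hi : ∀ i, mvNorm r (flowTerm t Q F m i)
        ≤ (m.factorial : ℝ≥0∞)⁻¹ * ((A * r) ^ m * mvNorm r ((Q ^ m) F i)) := by
      intro i
      have e1 : ‖((-1) ^ m / (m.factorial : ℝ) : ℝ)‖ₑ = (m.factorial : ℝ≥0∞)⁻¹ := by
        rw [div_eq_mul_inv, enorm_mul, enorm_pow, enorm_neg, enorm_one, one_pow, one_mul,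
          enorm_inv (by positivity), Real.enorm_natCast]
      simp only [flowTerm, Pi.smul_apply, mvNorm_smul, e1, smul_eq_mul]
      gcongr
      refine (mvNorm_mul_le _ _ _).trans ?_
      gcongr
      exact (mvNorm_pow_le _ _ _).trans (by gcongr; exact ht r)
    have hsum : ∑ i, mvNorm r (flowTerm t Q F m i)
        ≤ (m.factorial : ℝ≥0∞)⁻¹ * ((A * r) ^ m * vecNorm r ((Q ^ m) F)) := by
      refine (Finset.sum_le_sum fun i _ => hi i).trans (le_of_eq ?_)
      rw [← Finset.mul_sum, ← Finset.mul_sum, vecNorm]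
    have hm0 : (m.factorial : ℝ≥0∞) ≠ 0 := by exact_mod_cast m.factorial_ne_zero
    have hm1 : (m.factorial : ℝ≥0∞) ≠ ⊤ := ENNReal.natCast_ne_top _
    have hX : vecNorm r ((Q ^ m) F) * ((r₀ / 2 : ℝ≥0) : ℝ≥0∞) ^ m
        ≤ (3 * K : ℝ≥0∞) ^ m * m.factorial * vecNorm r₀ F := by
      rcases Nat.eq_zero_or_pos m with rfl | hm
      · simpa using vecNorm_mono (hr2.trans (half_le_self hr₀.le)) F
      have e : (r₀ / 2 : ℝ≥0) = m * (r₀ / 2 / m) := by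
        field_simp
      have h1 := hpow m r (r₀ / 2 / m) (by rw [← e]; exact (add_le_add_left hr2 _).trans (add_halves _).le)
      calc vecNorm r ((Q ^ m) F) * ((r₀ / 2 : ℝ≥0) : ℝ≥0∞) ^ m
          = vecNorm r ((Q ^ m) F) * ((r₀ / 2 / m : ℝ≥0) : ℝ≥0∞) ^ m * (m : ℝ≥0∞) ^ m := by
            conv_lhs => rw [e]
            push_cast
            ring
        _ ≤ (K : ℝ≥0∞) ^ m * vecNorm r₀ F * (3 ^ m * m.factorial) := by
            refine mul_le_mul' (h1.trans (mul_le_mul_right (vecNorm_mono ?_ F) _)) (hfact m)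
            rw [← e]; exact (add_le_add_left hr2 _).trans (add_halves _).le
        _ = _ := by ring
    have hK0 : (((r₀ / 2 : ℝ≥0) : ℝ≥0∞) ^ m) ≠ 0 := by
      apply pow_ne_zero; exact_mod_cast (half_pos hr₀).ne'
    have hK1 : (((r₀ / 2 : ℝ≥0) : ℝ≥0∞) ^ m) ≠ ⊤ := ENNReal.pow_ne_top ENNReal.coe_ne_top
    rw [← ENNReal.mul_le_mul_iff_left hK0 hK1]
    calc (∑ i, mvNorm r (flowTerm t Q F m i)) * ((r₀ / 2 : ℝ≥0) : ℝ≥0∞) ^ m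
        ≤ (m.factorial : ℝ≥0∞)⁻¹ * ((A * r) ^ m * vecNorm r ((Q ^ m) F))
            * ((r₀ / 2 : ℝ≥0) : ℝ≥0∞) ^ m := by gcongr
      _ = (m.factorial : ℝ≥0∞)⁻¹ * (A * r) ^ m *
            (vecNorm r ((Q ^ m) F) * ((r₀ / 2 : ℝ≥0) : ℝ≥0∞) ^ m) := by ring
      _ ≤ (m.factorial : ℝ≥0∞)⁻¹ * (A * r) ^ m *
            ((3 * K : ℝ≥0∞) ^ m * m.factorial * vecNorm r₀ F) := by gcongr
      _ = ((m.factorial : ℝ≥0∞)⁻¹ * m.factorial) * ((3 * (A * K) * r : ℝ≥0) : ℝ≥0∞) ^ m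
            * vecNorm r₀ F := by push_cast; ring
      _ ≤ 1 * ((r₀ / 4 : ℝ≥0) : ℝ≥0∞) ^ m * vecNorm r₀ F := by
          rw [ENNReal.inv_mul_cancel hm0 hm1]
          gcongr
      _ = (2⁻¹ : ℝ≥0∞) ^ m * vecNorm r₀ F * ((r₀ / 2 : ℝ≥0) : ℝ≥0∞) ^ m := by
          have e2 : (2⁻¹ : ℝ≥0∞) = ((2⁻¹ : ℝ≥0) : ℝ≥0∞) := by simp
          have e3 : (r₀ / 4 : ℝ≥0) = 2⁻¹ * (r₀ / 2) := by field_simp; norm_num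
          rw [e2, e3]; push_cast; ring
  calc vecNorm r (flow t Q F) ≤ ∑ i, ∑' m, mvNorm r (flowTerm t Q F m i) :=
        Finset.sum_le_sum fun i _ => mvNorm_formalSum_le r _
    _ = ∑' m, ∑ i, mvNorm r (flowTerm t Q F m i) :=
        (Summable.tsum_finsetSum fun i _ => ENNReal.summable).symm
    _ ≤ ∑' m, (2⁻¹ : ℝ≥0∞) ^ m * vecNorm r₀ F := ENNReal.tsum_le_tsum hterm
    _ < ⊤ := by
        rw [ENNReal.tsum_mul_right]
        refine ENNReal.mul_lt_top ?_ hF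
        rw [ENNReal.tsum_geometric]
        simp

end flow

end MvPowerSeries
end

noncomputable section

/-! ### Formal conservation laws -/

namespace MvPowerSeries

open scoped ENNReal NNReal

variable {n : ℕ}

theorem exists_common_radius {ι : Type*} [Finite ι] {s : ι → MvPowerSeries (Fin n) ℝ}
    (hs : ∀ i, IsConvergent (s i)) : ∃ r : ℝ≥0, 0 < r ∧ ∀ i, mvNorm r (s i) < ⊤ := by
  have h : ∀ᶠ r in nhdsWithin (0 : ℝ≥0) (Set.Ioi 0), ∀ i, mvNorm r (s i) < ⊤ := by
    refine Filter.eventually_all.mpr fun i => ?_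
    obtain ⟨r, hr, h⟩ := hs i
    filter_upwards [Ioo_mem_nhdsGT hr] with x hx
    exact (mvNorm_mono hx.2.le _).trans_lt h
  obtain ⟨r, h1, h2⟩ := (h.and self_mem_nhdsWithin).exists
  exact ⟨r, h2, h1⟩

theorem constantCoeff_pderiv_eq_zero {s : MvPowerSeries (Fin n) ℝ}
    (hs : ((2 : ℕ) : ℕ∞) ≤ s.order) (k : Fin n) : constantCoeff (pderiv ℝ k s) = 0 := by
  rw [← coeff_zero_eq_constantCoeff_apply]
  exact le_order_iff.mp (le_order_pderiv (N := 1) k hs) 0 (by simp)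

variable {L : Fin n → Matrix (Fin n) (Fin n) (MvPowerSeries (Fin n) ℝ)} {v : Fin n → ℝ}
  {W W' : Matrix (Fin n) (Fin n) (MvPowerSeries (Fin n) ℝ)}

/-- The derivative in the direction of a constant vector field. -/
abbrev constDeriv (v : Fin n → ℝ) :
    Derivation ℝ (MvPowerSeries (Fin n) ℝ) (MvPowerSeries (Fin n) ℝ) :=
  dirDeriv (fun k => pderiv ℝ k) fun k => C (v k)

theorem constDeriv_apply (v : Fin n → ℝ) (s : MvPowerSeries (Fin n) ℝ) :
    constDeriv v s = ∑ k, v k • pderiv ℝ k s := by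
  simp [dirDeriv_apply, smul_eq_C_mul]

theorem constDeriv_X (v : Fin n → ℝ) (p : Fin n) : constDeriv v (X p) = C (v p) := by
  rw [constDeriv_apply, Finset.sum_eq_single p]
  · rw [pderiv_X_self, smul_eq_C_mul, mul_one]
  · intro k _ hk; rw [pderiv_X_of_ne (Ne.symm hk), smul_zero]
  · simp

/-- The operators of the first order system attached to the family, as linear maps. -/
def opLin (L : Fin n → Matrix (Fin n) (Fin n) (MvPowerSeries (Fin n) ℝ)) (v : Fin n → ℝ)
    (W W' : Matrix (Fin n) (Fin n) (MvPowerSeries (Fin n) ℝ)) (k : Fin n) :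
    (Fin n → MvPowerSeries (Fin n) ℝ) →ₗ[ℝ] (Fin n → MvPowerSeries (Fin n) ℝ) where
  toFun := CyclicFamily.op (fun k => pderiv ℝ k) L (fun k => C (v k)) W W' k
  map_add' F G := by
    have h : ∀ D : Derivation ℝ (MvPowerSeries (Fin n) ℝ) (MvPowerSeries (Fin n) ℝ),
      vecDeriv D (F + G) = vecDeriv D F + vecDeriv D G := by
        intro D; ext1 i; simp [vecDeriv]
    simp only [CyclicFamily.op, h, Matrix.add_vecMul]
    abel
  map_smul' c F := by
    have h : ∀ D : Derivation ℝ (MvPowerSeries (Fin n) ℝ) (MvPowerSeries (Fin n) ℝ),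
      vecDeriv D (c • F) = c • vecDeriv D F := by
        intro D; ext1 i; simp [vecDeriv]
    simp only [CyclicFamily.op, h, Matrix.smul_vecMul, smul_sub, RingHom.id_apply]

theorem opLin_apply (k : Fin n) (F : Fin n → MvPowerSeries (Fin n) ℝ) (i : Fin n) :
    opLin L v W W' k F i = pderiv ℝ k (F i)
      - ∑ p, constDeriv v (F p) * CyclicFamily.conj L W W' (Pi.single k 1) p i := rfl

theorem isFirstOrder_opLin (k : Fin n) : IsFirstOrder (opLin L v W W' k) where
  le_order N F hF i := by
    rw [opLin_apply]
    refine le_order_sub (le_order_pderiv k (hF i)) (le_order_sum _ fun p _ => ?_)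
    refine le_order_mul_right ?_
    rw [constDeriv_apply]
    exact le_order_sum _ fun k _ => le_trans (le_order_pderiv k (hF p)) le_order_smul

theorem opLin_smul {t : MvPowerSeries (Fin n) ℝ} (ht : constDeriv v t = 0) (k : Fin n)
    (F : Fin n → MvPowerSeries (Fin n) ℝ) :
    opLin L v W W' k (t • F) = t • opLin L v W W' k F + pderiv ℝ k t • F := by
  ext1 i
  simp only [opLin_apply, Pi.add_apply, Pi.smul_apply, smul_eq_mul, Derivation.leibniz, ht,
    mul_zero, add_zero, mul_sub, Finset.mul_sum, mul_assoc]
  ring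

/-- Each partial derivative costs one Cauchy estimate, and the matrix entries are bounded by their
norms at the largest radius `r₀`, so `K` does not depend on `r` and `δ`. -/
theorem opLin_bound (k : Fin n) {r₀ : ℝ≥0}
    (hZ : ∀ p i, mvNorm r₀ (CyclicFamily.conj L W W' (Pi.single k 1) p i) < ⊤) :
    ∃ K : ℝ≥0, ∀ (r δ : ℝ≥0) F, r + δ ≤ r₀ →
      vecNorm r (opLin L v W W' k F) * δ ≤ K * vecNorm (r + δ) F := by
  set Z := CyclicFamily.conj L W W' (Pi.single k 1) with hZdef
  set z : ℝ≥0∞ := ∑ p, ∑ i, mvNorm r₀ (Z p i) with hz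
  have hz_top : z < ⊤ := by
    simp only [hz, ENNReal.sum_lt_top]
    exact fun p _ i _ => hZ p i
  set w : ℝ≥0∞ := ∑ k, ‖v k‖ₑ with hw
  have hw_top : w < ⊤ := by
    simp only [hw, ENNReal.sum_lt_top]
    exact fun k _ => enorm_lt_top
  set K : ℝ≥0∞ := 1 + n * w * z with hK
  have hK_top : K ≠ ⊤ := by
    refine (ENNReal.add_lt_top.mpr ⟨ENNReal.one_lt_top, ENNReal.mul_lt_top (ENNReal.mul_lt_top
      (ENNReal.natCast_lt_top n) hw_top) hz_top⟩).ne
  refine ⟨K.toNNReal, fun r δ F hr => ?_⟩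
  rw [ENNReal.coe_toNNReal hK_top]
  have hD : ∀ s : MvPowerSeries (Fin n) ℝ, mvNorm r (constDeriv v s) * δ ≤ w * mvNorm (r + δ) s := by
    intro s
    rw [constDeriv_apply]
    calc mvNorm r (∑ k, v k • pderiv ℝ k s) * δ
        ≤ (∑ k, mvNorm r (v k • pderiv ℝ k s)) * δ :=
          mul_le_mul_left (mvNorm_sum_le _ _ _) _
      _ = ∑ k, ‖v k‖ₑ * (mvNorm r (pderiv ℝ k s) * δ) := by
          rw [Finset.sum_mul]
          exact Finset.sum_congr rfl fun k _ => by rw [mvNorm_smul, mul_assoc]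
      _ ≤ ∑ k, ‖v k‖ₑ * mvNorm (r + δ) s :=
          Finset.sum_le_sum fun k _ => mul_le_mul_right (mvNorm_pderiv_le r δ k s) _
      _ = _ := by rw [← Finset.sum_mul]
  have hzpi : ∀ p i, mvNorm r (Z p i) ≤ z := by
    intro p i
    refine (mvNorm_mono (le_self_add.trans hr) _).trans ?_
    refine le_trans ?_ (Finset.single_le_sum (f := fun p => ∑ i, mvNorm r₀ (Z p i))
      (fun _ _ => zero_le) (Finset.mem_univ p))
    exact Finset.single_le_sum (f := fun i => mvNorm r₀ (Z p i))
      (fun _ _ => zero_le) (Finset.mem_univ i)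
  have hi : ∀ i, mvNorm r (opLin L v W W' k F i) * δ
      ≤ mvNorm (r + δ) (F i) + w * z * vecNorm (r + δ) F := by
    intro i
    rw [opLin_apply]
    calc _ ≤ (mvNorm r (pderiv ℝ k (F i)) + ∑ p, mvNorm r (constDeriv v (F p)) * z) * δ := by
          refine mul_le_mul_left ((mvNorm_sub_le _ _ _).trans (add_le_add_right
            ((mvNorm_sum_le _ _ _).trans (Finset.sum_le_sum fun p _ => ?_)) _)) _
          exact (mvNorm_mul_le _ _ _).trans (mul_le_mul_right (hzpi p i) _)
      _ = mvNorm r (pderiv ℝ k (F i)) * δ + ∑ p, mvNorm r (constDeriv v (F p)) * δ * z := by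
          rw [add_mul, Finset.sum_mul]
          congr 1
          exact Finset.sum_congr rfl fun p _ => by ring
      _ ≤ mvNorm (r + δ) (F i) + ∑ p, w * mvNorm (r + δ) (F p) * z :=
          add_le_add (mvNorm_pderiv_le _ _ _ _)
            (Finset.sum_le_sum fun p _ => mul_le_mul_left (hD _) _)
      _ = _ := by
          rw [vecNorm, Finset.mul_sum]
          congr 1
          exact Finset.sum_congr rfl fun p _ => by ring
  rw [vecNorm, Finset.sum_mul]
  calc _ ≤ ∑ i, (mvNorm (r + δ) (F i) + w * z * vecNorm (r + δ) F) :=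
        Finset.sum_le_sum fun i _ => hi i
    _ = K * vecNorm (r + δ) F := by
        rw [Finset.sum_add_distrib, Finset.sum_const, Finset.card_univ, Fintype.card_fin, hK,
          add_mul, one_mul, nsmul_eq_mul, vecNorm]
        ring

theorem isConvergent_vecNorm {F : Fin n → MvPowerSeries (Fin n) ℝ} {r : ℝ≥0} (hr : 0 < r)
    (h : vecNorm r F < ⊤) (i : Fin n) : IsConvergent (F i) := by
  refine ⟨r, hr, lt_of_le_of_lt ?_ h⟩
  exact Finset.single_le_sum (f := fun i => mvNorm r (F i)) (fun _ _ => zero_le)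
    (Finset.mem_univ i)

theorem isConvergent_flow_opLin (k : Fin n) {t : MvPowerSeries (Fin n) ℝ} {A : ℝ≥0}
    (ht : ∀ r : ℝ≥0, mvNorm r t ≤ A * r)
    (hZ : ∀ p i, IsConvergent (CyclicFamily.conj L W W' (Pi.single k 1) p i))
    {F : Fin n → MvPowerSeries (Fin n) ℝ} (hF : ∀ i, IsConvergent (F i)) (i : Fin n) :
    IsConvergent (flow t (opLin L v W W' k) F i) := by
  obtain ⟨r₁, hr₁, h1⟩ := exists_common_radius (fun x : Fin n × Fin n => hZ x.1 x.2)
  obtain ⟨r₂, hr₂, h2⟩ := exists_common_radius hF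
  obtain ⟨K, hK⟩ := opLin_bound (L := L) (v := v) (W := W) (W' := W') k (r₀ := min r₁ r₂)
    (fun p i => (mvNorm_mono (min_le_left _ _) _).trans_lt (h1 (p, i)))
  obtain ⟨r, hr, -, h⟩ := vecNorm_flow_lt_top (lt_min hr₁ hr₂) ht hK (F := F) (by
    simp only [vecNorm, ENNReal.sum_lt_top]
    exact fun i _ => (mvNorm_mono (min_le_right _ _) _).trans_lt (h2 i))
  exact isConvergent_vecNorm hr h i

/-- Solvability of the Cauchy problem for the first order system attached to the family. -/
theorem exists_opLin_eq_zero (h : CyclicFamily (fun k => pderiv ℝ k) L (fun k => C (v k)) W W')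
    {p : Fin n} (hp : v p ≠ 0) (c : Fin n → ℝ) :
    ∃ F : Fin n → MvPowerSeries (Fin n) ℝ, (∀ k, opLin L v W W' k F = 0) ∧
      (∀ i, constantCoeff (constDeriv v (F i)) = c i) ∧
      ((∀ ξ p i, (∀ j, IsConvergent (ξ j)) → IsConvergent (CyclicFamily.conj L W W' ξ p i)) →
        ∀ i, IsConvergent (F i)) := by
  -- These are coordinates constant along `v`. For `k ≠ p`, multiplication by `t k` satisfies [Q, t]
  -- = 1 with `Q = opLin k`, and it commutes with `opLin l` for every `l` other than `k` and `p`.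
  set t : Fin n → MvPowerSeries (Fin n) ℝ := fun k => X k - (v k / v p) • X p with ht
  have ht0 : ∀ k, constantCoeff (t k) = 0 := by intro k; simp [ht]
  have htv : ∀ k, constDeriv v (t k) = 0 := by
    intro k
    rw [ht, map_sub, Derivation.map_smul, constDeriv_X, constDeriv_X, smul_eq_C_mul, ← map_mul,
      div_mul_cancel₀ _ hp, sub_self]
  have htk : ∀ k, k ≠ p → pderiv ℝ k (t k) = 1 := by
    intro k hk
    simp [ht, pderiv_X_of_ne (Ne.symm hk)]
  have htl : ∀ k l, l ≠ p → l ≠ k → pderiv ℝ l (t k) = 0 := by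
    intro k l hl hk
    simp [ht, pderiv_X_of_ne (Ne.symm hl), pderiv_X_of_ne (Ne.symm hk)]
  have htn : ∀ k, ∃ A : ℝ≥0, ∀ r : ℝ≥0, mvNorm r (t k) ≤ A * r := by
    intro k
    refine ⟨1 + ‖v k / v p‖₊, fun r => (mvNorm_sub_le _ _ _).trans (le_of_eq ?_)⟩
    rw [mvNorm_smul, mvNorm_X, mvNorm_X]
    push_cast
    rw [add_mul, one_mul]
    rfl
  -- The equations are imposed one at a time by the flows. Each flow preserves the earlier
  -- equations, the initial data and convergence. The index `p` is left out and recovered at the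
  -- end.
  have key : ∀ S : Finset (Fin n), p ∉ S → ∃ F : Fin n → MvPowerSeries (Fin n) ℝ,
      (∀ k ∈ S, opLin L v W W' k F = 0) ∧
      (∀ i, constantCoeff (constDeriv v (F i)) = c i) ∧
      ((∀ ξ p i, (∀ j, IsConvergent (ξ j)) → IsConvergent (CyclicFamily.conj L W W' ξ p i)) →
        ∀ i, IsConvergent (F i)) := by
    intro S
    induction S using Finset.induction_on with
    | empty =>
      intro _
      -- A linear function whose derivative along `v` is `c i`.
      refine ⟨fun i => (c i / v p) • X p, by simp, fun i => ?_, fun _ i =>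
        (isConvergent_X p).smul _⟩
      rw [Derivation.map_smul, constDeriv_X, smul_eq_C_mul, ← map_mul, constantCoeff_C,
        div_mul_cancel₀ _ hp]
    | insert k S hk ih =>
      intro hpS
      have hkp : k ≠ p := by rintro rfl; simp at hpS
      obtain ⟨F, h1, h2, h3⟩ := ih fun hh => hpS (by simp [hh])
      refine ⟨flow (t k) (opLin L v W W' k) F, ?_, fun i => ?_, fun hZ i => ?_⟩
      · intro l hl
        rcases Finset.mem_insert.mp hl with rfl | hlS
        · refine flow_mem_ker (isFirstOrder_opLin l) (ht0 l) (fun G => ?_) F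
          rw [opLin_smul (htv l), htk l hkp, one_smul]
        · have hlk : l ≠ k := fun e => hk (e ▸ hlS)
          have hlp : l ≠ p := fun e => hpS (e ▸ hl)
          rw [flow_commute (isFirstOrder_opLin l) (ht0 k), h1 l hlS]
          · ext1 i
            simp only [flow, flowTerm, map_zero, smul_zero, Pi.zero_apply]
            ext d
            simp [coeff_formalSum]
          · intro G; rw [opLin_smul (htv k), htl k l hlp hlk, zero_smul, add_zero]
          · exact fun G => h.op_comm (fun k l s => pderiv_comm k l s) l k G
      · rw [constantCoeff_deriv_flow (ht0 k) _ (htv k), h2]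
        intro s hs
        rw [constDeriv_apply, map_sum]
        exact Finset.sum_eq_zero fun j _ => by
          rw [smul_eq_C_mul, map_mul, constantCoeff_pderiv_eq_zero hs, mul_zero]
      · obtain ⟨A, hA⟩ := htn k
        refine isConvergent_flow_opLin k hA (fun q i => hZ _ q i fun j => ?_) (h3 hZ) i
        by_cases hj : j = k
        · subst hj; simpa using isConvergent_C 1
        · rw [Pi.single_eq_of_ne hj]; exact isConvergent_zero
  obtain ⟨F, h1, h2, h3⟩ := key (Finset.univ.erase p) (by simp)
  refine ⟨F, ?_, h2, h3⟩
  -- The remaining equation is automatic: `conj v = 1` gives ∑ v_k opLin k = D_v - D_v = 0, and `v p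
  -- ≠ 0`.
  have hsum : ∑ k, (C (v k) : MvPowerSeries (Fin n) ℝ) • opLin L v W W' k F = 0 := by
    have e1 : (fun k => C (v k) : Fin n → MvPowerSeries (Fin n) ℝ)
        = ∑ k, (C (v k) : MvPowerSeries (Fin n) ℝ) • Pi.single k 1 := by
      ext1 j; simp [Finset.sum_apply, Pi.single_apply]
    have e2 : ∑ k, (C (v k) : MvPowerSeries (Fin n) ℝ) •
        CyclicFamily.conj L W W' (Pi.single k 1) = 1 := by
      rw [← CyclicFamily.conj_sum_smul, ← e1, h.conj_cyclic]
    change ∑ k, (C (v k) : MvPowerSeries (Fin n) ℝ) • (vecDeriv (pderiv ℝ k) F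
      - vecDeriv (constDeriv v) F ᵥ* CyclicFamily.conj L W W' (Pi.single k 1)) = 0
    simp only [smul_sub, Finset.sum_sub_distrib, ← Matrix.vecMul_smul]
    rw [← Matrix.vecMul_sum, e2, Matrix.vecMul_one, sub_eq_zero]
    ext1 i
    simp [vecDeriv, constDeriv_apply, Finset.sum_apply, smul_eq_C_mul]
  rw [← Finset.add_sum_erase _ _ (Finset.mem_univ p), Finset.sum_eq_zero (s := Finset.univ.erase p)
    (fun k hk => by rw [h1 k hk, smul_zero]), add_zero] at hsum
  intro k
  by_cases hk : k = p
  · subst hk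
    ext1 i
    have := congrFun hsum i
    simp only [Pi.smul_apply, smul_eq_mul, Pi.zero_apply, ← smul_eq_C_mul] at this
    simpa [hp] using this
  · exact h1 k (by simp [hk])

/-- Existence of formal conservation laws with prescribed differential at the origin, together with
potentials of their images under the operators of the family. -/
theorem exists_formal_conservation_law
    (h : CyclicFamily (fun k => pderiv ℝ k) L (fun k => C (v k)) W W') {p : Fin n} (hp : v p ≠ 0)
    (a : Fin n → ℝ) :
    ∃ (f : MvPowerSeries (Fin n) ℝ) (F : Fin n → MvPowerSeries (Fin n) ℝ),
      (∀ i k, ((fun j => pderiv ℝ j f) ᵥ* L i) k = pderiv ℝ k (F i)) ∧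
      (∀ k, constantCoeff (pderiv ℝ k f) = a k) ∧
      ((∀ i p q, IsConvergent (L i p q)) → (∀ p q, IsConvergent (W' p q)) →
        IsConvergent f ∧ ∀ i, IsConvergent (F i)) := by
  -- The initial value of D_v F is a W(0), so that β = (D_v F) W' takes the value `a` at the origin.
  obtain ⟨F, h1, h2, h3⟩ := exists_opLin_eq_zero h hp (a ᵥ* W.map constantCoeff)
  set β := vecDeriv (constDeriv v) F ᵥ* W' with hβ
  have hpr : ∀ k, pderiv ℝ k (primitive β) = β k :=
    pderiv_primitive fun k m => h.closed_of_op (fun k l s => pderiv_comm k l s) h1 k m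
  refine ⟨primitive β, F, fun i k => ?_, fun k => ?_, fun hL hW' => ?_⟩
  · simp only [hpr]
    exact h.vecMul_apply_of_op h1 i k
  · rw [hpr]
    have e : (fun i => constantCoeff (vecDeriv (constDeriv v) F i)) = a ᵥ* W.map constantCoeff :=
      funext h2
    have e1 : constantCoeff (β k) = ((fun i => constantCoeff (vecDeriv (constDeriv v) F i)) ᵥ*
        W'.map constantCoeff) k := by
      simp [hβ, Matrix.vecMul, dotProduct]
    have e2 := congrArg (fun A : Matrix (Fin n) (Fin n) (MvPowerSeries (Fin n) ℝ) =>
      A.map constantCoeff) h.inv'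
    simp only [Matrix.map_mul, Matrix.map_one _ (map_zero constantCoeff) (map_one constantCoeff)]
      at e2
    rw [e1, e, Matrix.vecMul_vecMul, e2, Matrix.vecMul_one]
  · have hW : ∀ p q, IsConvergent (W p q) := by
      intro p q
      rw [h.frame]
      simp only [Matrix.mulVec, dotProduct]
      exact IsConvergent.sum _ fun j _ => (hL _ _ _).mul (isConvergent_C _)
    have hmul : ∀ A B : Matrix (Fin n) (Fin n) (MvPowerSeries (Fin n) ℝ),
        (∀ p q, IsConvergent (A p q)) → (∀ p q, IsConvergent (B p q)) →
        ∀ p q, IsConvergent ((A * B) p q) := by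
      intro A B hA hB p q
      rw [Matrix.mul_apply]
      exact IsConvergent.sum _ fun j _ => (hA _ _).mul (hB _ _)
    have hF := h3 fun ξ p i hξ => by
      refine hmul _ _ (hmul _ _ hW' fun p q => ?_) hW p i
      simp only [CyclicFamily.elem, Matrix.sum_apply, Matrix.mulVec, dotProduct]
      refine IsConvergent.sum _ fun j _ => ?_
      rw [Matrix.smul_apply, smul_eq_mul]
      exact (IsConvergent.sum _ fun j _ => (hW' _ _).mul (hξ _)).mul (hL _ _ _)
    refine ⟨IsConvergent.primitive fun k => ?_, hF⟩
    rw [hβ, Matrix.vecMul, dotProduct]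
    refine IsConvergent.sum _ fun j _ => IsConvergent.mul ?_ (hW' _ _)
    change IsConvergent (constDeriv v (F j))
    rw [constDeriv_apply]
    exact IsConvergent.sum _ fun k _ => ((hF j).pderiv k).smul _

end MvPowerSeries
end

noncomputable section

/-! ### Torsion of a pair of matrices and the formal category -/

section Torsion

variable {n : ℕ} {R : Type*} [CommRing R] [Algebra ℝ R] (d : Fin n → Derivation ℝ R R)

/-- The components of `⟨L, M⟩`. -/
def pairTorsion (L M : Matrix (Fin n) (Fin n) R) (ξ η : Fin n → R) : Fin n → R :=
  (M.map (dirDeriv d (L *ᵥ ξ)) - L * M.map (dirDeriv d ξ)) *ᵥ η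
    - (L.map (dirDeriv d (M *ᵥ η)) - M * L.map (dirDeriv d η)) *ᵥ ξ

variable {d}

theorem strongSym_iff {L M : Matrix (Fin n) (Fin n) R} :
    StrongSym d L M ↔ ∀ ξ η, pairTorsion d L M ξ η = 0 := by
  simp only [StrongSym, pairTorsion, sub_eq_zero]

theorem pairTorsion_swap (L M : Matrix (Fin n) (Fin n) R) (ξ η : Fin n → R) :
    pairTorsion d M L η ξ = -pairTorsion d L M ξ η := by
  simp only [pairTorsion]; abel

theorem pairTorsion_add_left (L L' M : Matrix (Fin n) (Fin n) R) (ξ η : Fin n → R) :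
    pairTorsion d (L + L') M ξ η = pairTorsion d L M ξ η + pairTorsion d L' M ξ η := by
  have h1 : ∀ ξ ξ' : Fin n → R, M.map (dirDeriv d (ξ + ξ'))
      = M.map (dirDeriv d ξ) + M.map (dirDeriv d ξ') := by
    intro ξ ξ'; ext i j; simp [dirDeriv_apply, add_mul, Finset.sum_add_distrib]
  have h2 : ∀ D : Derivation ℝ R R, (L + L').map D = L.map D + L'.map D := by
    intro D; ext i j; simp
  simp only [pairTorsion, Matrix.add_mulVec, h1, h2, Matrix.add_mul, Matrix.mul_add,
    Matrix.sub_mulVec]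
  abel

theorem pairTorsion_add_right (L M M' : Matrix (Fin n) (Fin n) R) (ξ η : Fin n → R) :
    pairTorsion d L (M + M') ξ η = pairTorsion d L M ξ η + pairTorsion d L M' ξ η := by
  rw [← neg_neg (pairTorsion d L (M + M') ξ η), ← pairTorsion_swap, pairTorsion_add_left,
    pairTorsion_swap L M, pairTorsion_swap L M', neg_add, neg_neg, neg_neg]

theorem pairTorsion_sum_smul_left (L M : Matrix (Fin n) (Fin n) R) {ι : Type*} (s : Finset ι)
    (b : ι → R) (ξ : ι → Fin n → R) (η : Fin n → R) :
    pairTorsion d L M (∑ j ∈ s, b j • ξ j) η = ∑ j ∈ s, b j • pairTorsion d L M (ξ j) η := by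
  simp only [pairTorsion, Matrix.mulVec_sum, Matrix.mulVec_smul, map_dirDeriv_sum_smul,
    Finset.mul_sum, Matrix.mul_smul, ← Finset.sum_sub_distrib, ← smul_sub, Matrix.sum_mulVec,
    Matrix.smul_mulVec]

/-- The expression `pairTorsion` is linear over `R` in both arguments, so coordinate fields suffice.
-/
theorem strongSym_of_single {L M : Matrix (Fin n) (Fin n) R}
    (h : ∀ a b, pairTorsion d L M (Pi.single a 1) (Pi.single b 1) = 0) : StrongSym d L M := by
  rw [strongSym_iff]
  intro ξ η
  have e : ∀ ξ : Fin n → R, ξ = ∑ j, ξ j • (Pi.single j 1 : Fin n → R) := by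
    intro ξ; ext1 i; simp [Finset.sum_apply, Pi.single_apply]
  have h1 : ∀ a η, pairTorsion d L M (Pi.single a 1) η = 0 := by
    intro a η
    rw [← neg_eq_zero, ← pairTorsion_swap, e η, pairTorsion_sum_smul_left]
    exact Finset.sum_eq_zero fun b _ => by rw [pairTorsion_swap, h, neg_zero, smul_zero]
  rw [e ξ, pairTorsion_sum_smul_left]
  exact Finset.sum_eq_zero fun a _ => by rw [h1, smul_zero]

/-- Polarization: a pair whose torsion has no symmetric part, and such that `L`, `M` and `L + M`
have no torsion, has vanishing torsion. -/
theorem strongSym_of_polarization {L M : Matrix (Fin n) (Fin n) R}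
    (hs : ∀ a b, pairTorsion d L M (Pi.single a 1) (Pi.single b 1)
      + pairTorsion d L M (Pi.single b 1) (Pi.single a 1) = 0)
    (hL : ∀ a b, pairTorsion d L L (Pi.single a 1) (Pi.single b 1) = 0)
    (hM : ∀ a b, pairTorsion d M M (Pi.single a 1) (Pi.single b 1) = 0)
    (hLM : ∀ a b, pairTorsion d (L + M) (L + M) (Pi.single a 1) (Pi.single b 1) = 0) :
    StrongSym d L M := by
  refine strongSym_of_single fun a b => ?_
  -- The torsion of `L + M` reduces to T(a, b) - T(b, a) for the torsion T of the pair. So T is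
  -- symmetric in its arguments as well as skew, and 2T = 0.
  have h1 := hLM a b
  rw [pairTorsion_add_left, pairTorsion_add_right, pairTorsion_add_right, hL, hM, zero_add,
    add_zero, pairTorsion_swap L M (Pi.single b 1)] at h1
  have h2 := hs a b
  have h3 : (2 : ℝ) • pairTorsion d L M (Pi.single a 1) (Pi.single b 1) = 0 := by
    rw [← sub_eq_add_neg, sub_eq_zero] at h1
    rw [← h1] at h2
    rw [two_smul, h2]
  ext1 i
  have := congrFun h3 i
  have h4 : (2 : ℝ) • (pairTorsion d L M (Pi.single a 1) (Pi.single b 1) i) = 0 := this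
  exact (smul_eq_zero_iff_right (two_ne_zero)).mp h4

end Torsion

section Formal

open MvPowerSeries

variable {n : ℕ}

/-- Coordinate fields have constant components and vanishing mutual bracket, so only derivatives of
the matrices remain. -/
theorem formalBracket_single (L M : FormalOp n) (a b : Fin n) :
    formalBracket L M (Pi.single a 1) (Pi.single b 1)
      = pairTorsion (fun k => pderiv ℝ k) L M (Pi.single a 1) (Pi.single b 1) := by
  have hc : ∀ (a k i : Fin n), pderiv ℝ k ((Pi.single a 1 : Fin n → FormalFun n) i) = 0 := by
    intro a k i
    by_cases h : i = a
    · subst h; simp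
    · simp [h]
  have hv : ∀ (D : Derivation ℝ (FormalFun n) (FormalFun n)) (M : FormalOp n) (b i : Fin n),
      D ((M *ᵥ Pi.single b 1) i) = (M.map D *ᵥ Pi.single b 1) i := by
    intro D M b i; simp
  have h0 : formalLie (Pi.single a 1 : Fin n → FormalFun n) (Pi.single b 1) = 0 := by
    ext1 i; simp [formalLie, hc]
  have h1 : ∀ (ξ η : Fin n → FormalFun n),
      formalLie ξ η = vecDeriv (dirDeriv (fun k => pderiv ℝ k) ξ) η
        - vecDeriv (dirDeriv (fun k => pderiv ℝ k) η) ξ := by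
    intro ξ η; ext1 i
    simp [formalLie, vecDeriv, dirDeriv_apply, Finset.sum_sub_distrib]
  have h2 : ∀ (D : Derivation ℝ (FormalFun n) (FormalFun n)) (M : FormalOp n) (b : Fin n),
      vecDeriv D (M *ᵥ Pi.single b 1) = M.map D *ᵥ Pi.single b 1 := by
    intro D M b; ext1 i; exact hv D M b i
  have h3 : ∀ (ξ : Fin n → FormalFun n) (a : Fin n),
      vecDeriv (dirDeriv (fun k => pderiv ℝ k) ξ) (Pi.single a 1 : Fin n → FormalFun n) = 0 := by
    intro ξ a; ext1 i; simp [vecDeriv, dirDeriv_apply, hc]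
  rw [formalBracket, h0]
  simp only [h1, h2, h3, pairTorsion, Matrix.sub_mulVec, Matrix.mulVec_zero, zero_add, sub_zero,
    zero_sub, Matrix.mulVec_neg, Matrix.mulVec_mulVec]
  abel

namespace IsFormalNijenhuisFrobeniusFamily

variable {L : Fin n → FormalOp n}

theorem strongSym (h : IsFormalNijenhuisFrobeniusFamily L) (i j : Fin n) :
    StrongSym (fun k => pderiv ℝ k) (L i) (L j) := by
  have hN : ∀ c : Fin n → ℝ, ∀ a b, pairTorsion (fun k => pderiv ℝ k) (∑ i, c i • L i)
      (∑ i, c i • L i) (Pi.single a 1) (Pi.single b 1) = 0 := by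
    intro c a b; rw [← formalBracket_single]; exact h.nijenhuis c _ _
  have hi : ∀ i, ∑ k, (Pi.single i 1 : Fin n → ℝ) k • L k = L i := fun i => by
    rw [Fintype.sum_eq_single i fun k hk => by rw [Pi.single_eq_of_ne hk, zero_smul],
      Pi.single_eq_same, one_smul]
  have hij : ∑ k, (Pi.single i 1 + Pi.single j 1 : Fin n → ℝ) k • L k = L i + L j := by
    simp only [Pi.add_apply, add_smul, Finset.sum_add_distrib]
    rw [hi, hi]
  refine strongSym_of_polarization (fun a b => ?_) (fun a b => ?_) (fun a b => ?_) fun a b => ?_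
  · rw [← formalBracket_single, ← formalBracket_single]
    exact (h.symmetries i j).2 _ _
  · have := hN (Pi.single i 1) a b
    rw [hi] at this
    exact this
  · have := hN (Pi.single j 1) a b
    rw [hi] at this
    exact this
  · have := hN (Pi.single i 1 + Pi.single j 1) a b
    rw [hij] at this
    exact this

theorem exists_conservation_law (h : IsFormalNijenhuisFrobeniusFamily L) :
    ∃ f : FormalFun n,
      (∀ i, FormalConservationLaw (L i) (fun j => pderiv ℝ j f)) ∧
      LinearIndependent ℝ (fun i => fun k => constantCoeff
        (((fun j => pderiv ℝ j f) ᵥ* L i) k)) := by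
  rcases Nat.eq_zero_or_pos n with rfl | hn
  · exact ⟨0, fun i => i.elim0, linearIndependent_empty_type⟩
  obtain ⟨v, hv⟩ := h.generic_vector
  obtain ⟨a, ha⟩ := h.generic_covector
  obtain ⟨p, hp⟩ : ∃ p, v p ≠ 0 := by
    by_contra! hv0
    have : v = 0 := funext hv0
    exact hv.ne_zero ⟨0, hn⟩ (by simp [this])
  set W : FormalOp n := Matrix.of fun p l => (L l *ᵥ fun k => C (v k)) p with hW
  -- A power series is a unit when its constant term is, and at the origin the columns of `W` are
  -- the independent vectors L_i(0) v.
  have hdet : IsUnit W.det := by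
    rw [isUnit_iff_constantCoeff, RingHom.map_det, ← Matrix.isUnit_iff_isUnit_det]
    refine Matrix.linearIndependent_cols_iff_isUnit.mp ?_
    have e : (RingHom.mapMatrix constantCoeff W).col
        = fun i => (L i).map constantCoeff *ᵥ v := by
      ext i p
      simp [hW, Matrix.mulVec, dotProduct]
    rw [e]
    exact hv
  have hcyc : CyclicFamily (fun k => pderiv ℝ k) L (fun k => C (v k)) W W⁻¹ :=
    { comm := fun i j => (h.symmetries i j).1
      strong := h.strongSym
      const := fun k i => pderiv_C
      frame := fun p l => rfl
      inv := Matrix.nonsing_inv_mul W hdet }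
  obtain ⟨f, F, h1, h2, -⟩ := exists_formal_conservation_law hcyc hp a
  refine ⟨f, fun i => ⟨fun k l => pderiv_comm k l f, fun k l => ?_⟩, ?_⟩
  · rw [h1, h1, pderiv_comm]
  · convert ha using 1
    ext i k
    simp [Matrix.vecMul, dotProduct, h2]

end IsFormalNijenhuisFrobeniusFamily

end Formal
end

noncomputable section

/-! ### Taylor series of analytic functions of several variables -/

namespace TaylorSeries

open MvPowerSeries
open scoped ENNReal NNReal Topology

variable {n : ℕ}

/-- The multi-index of a word in the coordinates. -/
def wordCount {N : ℕ} (m : Fin N → Fin n) : Fin n →₀ ℕ := ∑ i, Finsupp.single (m i) 1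

theorem wordCount_succ {N : ℕ} (m : Fin (N + 1) → Fin n) :
    wordCount m = wordCount (Fin.init m) + Finsupp.single (m (Fin.last N)) 1 := by
  rw [wordCount, Fin.sum_univ_castSucc]; rfl

theorem degree_wordCount {N : ℕ} (m : Fin N → Fin n) : (wordCount m).degree = N := by
  simp [wordCount, map_sum, Finsupp.degree_single]

theorem wordCount_comp_perm {N : ℕ} (m : Fin N → Fin n) (σ : Equiv.Perm (Fin N)) :
    wordCount (m ∘ σ) = wordCount m :=
  Equiv.sum_comp σ fun i => Finsupp.single (m i) 1

theorem wordCount_apply {N : ℕ} (m : Fin N → Fin n) (j : Fin n) :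
    wordCount m j = Fintype.card {i // m i = j} := by
  rw [wordCount, Finsupp.finsetSum_apply, Fintype.card_subtype, Finset.card_filter]
  exact Finset.sum_congr rfl fun i _ => by rw [Finsupp.single_apply]

theorem exists_perm_of_wordCount_eq {N : ℕ} {m m' : Fin N → Fin n}
    (h : wordCount m = wordCount m') : ∃ σ : Equiv.Perm (Fin N), m = m' ∘ σ := by
  have e : ∀ j, {i // m i = j} ≃ {i // m' i = j} := fun j =>
    Fintype.equivOfCardEq (by rw [← wordCount_apply, ← wordCount_apply, h])
  exact ⟨Equiv.ofFiberEquiv e, funext fun i => (Equiv.ofFiberEquiv_map e i).symm⟩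

theorem exists_word (N : ℕ) : ∀ d : Fin n →₀ ℕ, d.degree = N → ∃ m : Fin N → Fin n,
    wordCount m = d := by
  induction N with
  | zero =>
    intro d hd
    rw [Finsupp.degree_eq_zero_iff] at hd
    exact ⟨Fin.elim0, by simp [wordCount, hd]⟩
  | succ N ih =>
    intro d hd
    obtain ⟨j, hj⟩ : ∃ j, d j ≠ 0 := by
      by_contra! h
      have : d = 0 := Finsupp.ext h
      simp [this] at hd
    have hle : Finsupp.single j 1 ≤ d := by rw [Finsupp.single_le_iff]; omega
    obtain ⟨d', rfl⟩ : ∃ d', d = d' + Finsupp.single j 1 :=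
      ⟨d - Finsupp.single j 1, (tsub_add_cancel_of_le hle).symm⟩
    rw [map_add, Finsupp.degree_single] at hd
    obtain ⟨m, hm⟩ := ih d' (by omega)
    refine ⟨Fin.snoc m j, ?_⟩
    rw [wordCount_succ, Fin.init_snoc, Fin.snoc_last, hm]

/-- The factorial of a multi-index. -/
def multiFactorial (d : Fin n →₀ ℕ) : ℕ := ∏ j, (d j).factorial

theorem multiFactorial_pos (d : Fin n →₀ ℕ) : 0 < multiFactorial d :=
  Finset.prod_pos fun _ _ => Nat.factorial_pos _

theorem multiFactorial_add_single (d : Fin n →₀ ℕ) (k : Fin n) :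
    multiFactorial (d + Finsupp.single k 1) = multiFactorial d * (d k + 1) := by
  rw [multiFactorial, multiFactorial, ← Finset.mul_prod_erase _ _ (Finset.mem_univ k),
    ← Finset.mul_prod_erase _ _ (Finset.mem_univ k)]
  rw [Finset.prod_congr rfl fun j hj => by
    rw [Finsupp.add_apply, Finsupp.single_eq_of_ne (Finset.ne_of_mem_erase hj), add_zero]]
  simp [Nat.factorial_succ]
  ring

/-- The multinomial coefficient is one term in the expansion of (1 + ⋯ + 1)^|d| = n^|d|. -/
theorem factorial_le_multiFactorial (d : Fin n →₀ ℕ) :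
    d.degree.factorial ≤ n ^ d.degree * multiFactorial d := by
  have h1 := Nat.multinomial_spec Finset.univ d
  rw [← Finsupp.degree_eq_sum] at h1
  have h2 := Finset.sum_pow_eq_sum_piAntidiag (Finset.univ : Finset (Fin n)) (fun _ => (1 : ℕ))
    d.degree
  simp only [Finset.sum_const, Finset.card_univ, Fintype.card_fin, smul_eq_mul, mul_one,
    one_pow, Finset.prod_const_one] at h2
  have h3 : Nat.multinomial Finset.univ d ≤ n ^ d.degree := by
    rw [h2]
    refine Finset.single_le_sum (f := fun k : Fin n → ℕ => Nat.multinomial Finset.univ k)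
      (fun _ _ => Nat.zero_le _) ?_
    simp [Finset.mem_piAntidiag, Finsupp.degree_eq_sum]
  rw [← h1, mul_comm]
  exact Nat.mul_le_mul_right _ h3

/-- The factorial-weighted coefficient of a power series along a word. -/
def wordCoeff {N : ℕ} (m : Fin N → Fin n) (s : MvPowerSeries (Fin n) ℝ) : ℝ :=
  multiFactorial (wordCount m) * coeff (wordCount m) s

theorem wordCoeff_succ {N : ℕ} (m : Fin (N + 1) → Fin n) (s : MvPowerSeries (Fin n) ℝ) :
    wordCoeff m s = wordCoeff (Fin.init m) (pderiv ℝ (m (Fin.last N)) s) := by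
  rw [wordCoeff, wordCoeff, coeff_pderiv, wordCount_succ, multiFactorial_add_single]
  push_cast
  ring

theorem wordCoeff_add {N : ℕ} (m : Fin N → Fin n) (s t : MvPowerSeries (Fin n) ℝ) :
    wordCoeff m (s + t) = wordCoeff m s + wordCoeff m t := by
  simp [wordCoeff, mul_add]

theorem ext_wordCoeff {s t : MvPowerSeries (Fin n) ℝ}
    (h : ∀ (N : ℕ) (m : Fin N → Fin n), wordCoeff m s = wordCoeff m t) : s = t := by
  ext d
  obtain ⟨m, hm⟩ := exists_word d.degree d rfl
  have h1 := h _ m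
  simp only [wordCoeff, hm] at h1
  have : (multiFactorial d : ℝ) ≠ 0 := by
    exact_mod_cast (multiFactorial_pos _).ne'
  exact mul_left_cancel₀ this h1

/-- The Euclidean basis vectors. -/
abbrev basisVec (k : Fin n) : EuclideanSpace ℝ (Fin n) := EuclideanSpace.single k 1

/-- The partial derivative of a function. -/
def partialDeriv (k : Fin n) (f : EuclideanSpace ℝ (Fin n) → ℝ) :
    EuclideanSpace ℝ (Fin n) → ℝ := fun x => fderiv ℝ f x (basisVec k)

variable {x₀ : EuclideanSpace ℝ (Fin n)} {f g : EuclideanSpace ℝ (Fin n) → ℝ}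
  {s t : MvPowerSeries (Fin n) ℝ}

theorem analyticAt_partialDeriv (hf : AnalyticAt ℝ f x₀) (k : Fin n) :
    AnalyticAt ℝ (partialDeriv k f) x₀ :=
  ((ContinuousLinearMap.apply ℝ ℝ (basisVec k)).analyticAt _).comp hf.fderiv

theorem iteratedFDeriv_partialDeriv (hf : AnalyticAt ℝ f x₀) {N : ℕ} (m : Fin (N + 1) → Fin n) :
    iteratedFDeriv ℝ (N + 1) f x₀ (fun i => basisVec (m i))
      = iteratedFDeriv ℝ N (partialDeriv (m (Fin.last N)) f) x₀
          (fun i => basisVec (Fin.init m i)) := by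
  rw [iteratedFDeriv_succ_apply_right]
  have h := (ContinuousLinearMap.apply ℝ ℝ (basisVec (m (Fin.last N)))).iteratedFDeriv_comp_left
    (hf.fderiv.contDiffAt (n := ω)) (i := N) le_top
  have h2 := congrArg (fun A => A fun i => basisVec (Fin.init m i)) h
  exact h2.symm

/-- `s` is the Taylor series at `x₀` of the analytic function `f`. -/
structure HasTaylor (x₀ : EuclideanSpace ℝ (Fin n)) (f : EuclideanSpace ℝ (Fin n) → ℝ)
    (s : MvPowerSeries (Fin n) ℝ) : Prop where
  analyticAt : AnalyticAt ℝ f x₀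
  apply_word : ∀ (N : ℕ) (m : Fin N → Fin n),
    iteratedFDeriv ℝ N f x₀ (fun i => basisVec (m i)) = wordCoeff m s

namespace HasTaylor

theorem unique (h : HasTaylor x₀ f s) (h' : HasTaylor x₀ f t) : s = t :=
  ext_wordCoeff fun N m => by rw [← h.apply_word, ← h'.apply_word]

theorem congr (h : HasTaylor x₀ f s) (hfg : f =ᶠ[𝓝 x₀] g) : HasTaylor x₀ g s :=
  ⟨h.analyticAt.congr hfg, fun N m => by
    rw [← h.apply_word, (hfg.symm.iteratedFDeriv ℝ N).eq_of_nhds]⟩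

theorem eval (h : HasTaylor x₀ f s) : f x₀ = constantCoeff s := by
  have := h.apply_word 0 Fin.elim0
  rw [iteratedFDeriv_zero_apply] at this
  simpa [wordCoeff, wordCount, multiFactorial] using this

theorem partialDeriv (h : HasTaylor x₀ f s) (k : Fin n) :
    HasTaylor x₀ (partialDeriv k f) (pderiv ℝ k s) :=
  ⟨analyticAt_partialDeriv h.analyticAt k, fun N m => by
    have h1 := h.apply_word (N + 1) (Fin.snoc m k)
    rw [iteratedFDeriv_partialDeriv h.analyticAt, wordCoeff_succ] at h1
    simpa only [Fin.snoc_last, Fin.init_snoc] using h1⟩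

theorem add (h : HasTaylor x₀ f s) (h' : HasTaylor x₀ g t) :
    HasTaylor x₀ (fun x => f x + g x) (s + t) :=
  ⟨h.analyticAt.add h'.analyticAt, fun N m => by
    have := iteratedFDeriv_add_apply (𝕜 := ℝ) (i := N) (h.analyticAt.contDiffAt (n := N))
      (h'.analyticAt.contDiffAt (n := N))
    have e : (fun x => f x + g x) = f + g := rfl
    rw [e, this, wordCoeff_add, ← h.apply_word, ← h'.apply_word]; rfl⟩

theorem const (c : ℝ) : HasTaylor x₀ (fun _ => c) (C c) :=
  ⟨analyticAt_const, fun N m => by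
    cases N with
    | zero => simp [wordCoeff, wordCount, multiFactorial]
    | succ N => 
      rw [iteratedFDeriv_partialDeriv analyticAt_const, wordCoeff_succ, pderiv_C]
      have : TaylorSeries.partialDeriv (m (Fin.last N)) (fun _ : EuclideanSpace ℝ (Fin n) => c)
        = fun _ => 0 := by ext x; simp [TaylorSeries.partialDeriv]
      rw [this]
      simp [wordCoeff]⟩

/-- Induction on the length of the word. Removing the last letter and applying the Leibniz rule to
functions and series leaves products of f with ∂g and of g with ∂f; hence the generalization over
both factors. -/
theorem mul (h : HasTaylor x₀ f s) (h' : HasTaylor x₀ g t) :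
    HasTaylor x₀ (fun x => f x * g x) (s * t) := by
  refine ⟨h.analyticAt.mul h'.analyticAt, fun N => ?_⟩
  induction N generalizing f g s t with
  | zero =>
    intro m
    rw [iteratedFDeriv_zero_apply, h.eval, h'.eval]
    simp [wordCoeff, wordCount, multiFactorial]
  | succ N ih =>
    intro m
    have hfg := h.analyticAt.mul h'.analyticAt
    rw [show (fun x => f x * g x) = f * g from rfl, iteratedFDeriv_partialDeriv hfg,
      wordCoeff_succ]
    set k := m (Fin.last N)
    have e : TaylorSeries.partialDeriv k (f * g) =ᶠ[𝓝 x₀]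
        (fun x => f x * TaylorSeries.partialDeriv k g x)
          + fun x => g x * TaylorSeries.partialDeriv k f x := by
      filter_upwards [h.analyticAt.eventually_analyticAt, h'.analyticAt.eventually_analyticAt]
        with x hx hx'
      simp only [TaylorSeries.partialDeriv, Pi.add_apply]
      rw [fderiv_mul hx.differentiableAt hx'.differentiableAt]
      rfl
    have h1 := h.partialDeriv k
    have h2 := h'.partialDeriv k
    rw [(e.iteratedFDeriv ℝ N).eq_of_nhds,
      iteratedFDeriv_add_apply (f := fun x => f x * TaylorSeries.partialDeriv k g x)
      (g := fun x => g x * TaylorSeries.partialDeriv k f x)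
      ((h.analyticAt.mul h2.analyticAt).contDiffAt (n := N))
      ((h'.analyticAt.mul h1.analyticAt).contDiffAt (n := N)), Derivation.leibniz,
      wordCoeff_add, smul_eq_mul, smul_eq_mul, ← ih h h2, ← ih h' h1]
    rfl

theorem sum {ι : Type*} (I : Finset ι) {f : ι → EuclideanSpace ℝ (Fin n) → ℝ}
    {s : ι → MvPowerSeries (Fin n) ℝ} (h : ∀ i ∈ I, HasTaylor x₀ (f i) (s i)) :
    HasTaylor x₀ (fun x => ∑ i ∈ I, f i x) (∑ i ∈ I, s i) := by
  induction I using Finset.cons_induction with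
  | empty => simpa using HasTaylor.const (x₀ := x₀) (n := n) 0
  | cons a I ha ih =>
    simp only [Finset.sum_cons]
    exact (h a (by simp)).add (ih fun i hi => h i (by simp [hi]))

theorem sub (h : HasTaylor x₀ f s) (h' : HasTaylor x₀ g t) :
    HasTaylor x₀ (fun x => f x - g x) (s - t) := by
  have := h.add ((HasTaylor.const (x₀ := x₀) (-1)).mul h')
  convert this using 1
  · ext x; ring
  · rw [map_neg, map_one]; ring

/-- An analytic function is locally zero if its Taylor series is zero. -/
theorem eventually_eq_zero (h : HasTaylor x₀ f 0) : f =ᶠ[𝓝 x₀] 0 := by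
  obtain ⟨p, r, hp⟩ := h.analyticAt
  have hz : ∀ N, iteratedFDeriv ℝ N f x₀ = 0 := by
    intro N
    have : (iteratedFDeriv ℝ N f x₀).toMultilinearMap = 0 := by
      refine Module.Basis.ext_multilinear
        (fun _ => (EuclideanSpace.basisFun (Fin n) ℝ).toBasis) fun m => ?_
      have := h.apply_word N m
      simpa [wordCoeff] using this
    ext y
    exact congrArg (fun A => A y) this
  filter_upwards [hp.eventually_hasSum_sub] with y hy
  have hzero : ∀ N, p N (fun _ => y - x₀) = 0 := by
    intro N
    have := hp.factorial_smul (y - x₀) N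
    rw [hz] at this
    simpa [Nat.factorial_ne_zero] using this
  simp only [hzero] at hy
  exact hy.unique hasSum_zero

theorem eventually_eq (h : HasTaylor x₀ f s) (h' : HasTaylor x₀ g s) : f =ᶠ[𝓝 x₀] g := by
  have := h.sub h'
  rw [sub_self] at this
  filter_upwards [this.eventually_eq_zero] with x hx
  exact sub_eq_zero.mp hx

/-- The Taylor series of an analytic function converges. -/
theorem isConvergent (h : HasTaylor x₀ f s) : IsConvergent s := by
  obtain ⟨p, r, hp⟩ := h.analyticAt
  obtain ⟨ρ, hρ, hρr⟩ : ∃ ρ : ℝ≥0, 0 < ρ ∧ (ρ : ℝ≥0∞) < p.radius := by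
    obtain ⟨ρ, h1, h2⟩ := ENNReal.lt_iff_exists_nnreal_btwn.mp (hp.r_pos.trans_le hp.r_le)
    exact ⟨ρ, by exact_mod_cast h1, h2⟩
  have hsum := p.summable_norm_mul_pow hρr
  -- The derivative along a word is a sum of values of `p` over all |d|! permutations, and |d|! ≤
  -- n^|d| d!.
  have hbound : ∀ d : Fin n →₀ ℕ, ‖coeff d s‖ ≤ n ^ d.degree * ‖p d.degree‖ := by
    intro d
    obtain ⟨m, hm⟩ := exists_word d.degree d rfl
    have h1 := h.apply_word _ m
    rw [hp.iteratedFDeriv_eq_sum_of_completeSpace, wordCoeff, hm] at h1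
    have h2 : ‖∑ σ : Equiv.Perm (Fin d.degree), p d.degree fun i => basisVec (m (σ i))‖
        ≤ d.degree.factorial * ‖p d.degree‖ := by
      refine (norm_sum_le _ _).trans ?_
      refine (Finset.sum_le_sum (g := fun _ => ‖p d.degree‖) fun σ _ => ?_).trans ?_
      · refine ((p d.degree).le_opNorm _).trans ?_
        simp
      · simp [Fintype.card_perm]
    rw [h1, norm_mul, Real.norm_natCast] at h2
    have h3 : (d.degree.factorial : ℝ) ≤ n ^ d.degree * multiFactorial d := by
      exact_mod_cast factorial_le_multiFactorial d
    have h4 : (0 : ℝ) < multiFactorial d := by exact_mod_cast multiFactorial_pos d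
    have h5 : (multiFactorial d : ℝ) * ‖coeff d s‖
        ≤ multiFactorial d * (n ^ d.degree * ‖p d.degree‖) := by
      refine h2.trans ?_
      calc _ ≤ (n ^ d.degree * multiFactorial d : ℝ) * ‖p d.degree‖ := by gcongr
        _ = _ := by ring
    exact le_of_mul_le_mul_left h5 h4
  choose word hword using fun d : Fin n →₀ ℕ => exists_word d.degree d rfl
  -- One factor n + 1 pays for the multinomial bound, the other for the n^N words of length N. Using
  -- n + 1 in place of n avoids a zero denominator.
  set r' : ℝ≥0 := ρ / ((n + 1) * (n + 1)) with hr'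
  refine ⟨r', by positivity, ?_⟩
  have hinj : Function.Injective
      fun d : Fin n →₀ ℕ => (⟨d.degree, word d⟩ : Σ N : ℕ, (Fin N → Fin n)) := by
    intro d d' hdd
    have : ∀ x : Σ N : ℕ, (Fin N → Fin n), ∀ y, x = y → wordCount x.2 = wordCount y.2 := by
      rintro x y rfl; rfl
    have := this _ _ hdd
    simpa only [hword] using this
  have hle : mvNorm r' s ≤ ∑' x : Σ N : ℕ, (Fin N → Fin n),
      ((n : ℝ≥0∞) ^ x.1 * ‖p x.1‖ₑ) * (r' : ℝ≥0∞) ^ x.1 := by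
    refine le_trans (ENNReal.tsum_le_tsum fun d => ?_) (ENNReal.tsum_comp_le_tsum_of_injective hinj
      fun x => ((n : ℝ≥0∞) ^ x.1 * ‖p x.1‖ₑ) * (r' : ℝ≥0∞) ^ x.1)
    gcongr
    have h1 := hbound d
    have h2 : ‖coeff d s‖ ≤ ‖(n : ℝ) ^ d.degree * ‖p d.degree‖‖ := h1.trans (le_abs_self _)
    have h3 := enorm_le_iff_norm_le.mpr h2
    rwa [enorm_mul, enorm_pow, Real.enorm_natCast, enorm_norm] at h3
  refine hle.trans_lt ?_
  rw [ENNReal.tsum_sigma']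
  have hN : ∀ N : ℕ, ∑' _ : Fin N → Fin n, ((n : ℝ≥0∞) ^ N * ‖p N‖ₑ) * (r' : ℝ≥0∞) ^ N
      ≤ ‖‖p N‖ * (ρ : ℝ) ^ N‖ₑ := by
    intro N
    rw [tsum_fintype, Finset.sum_const, Finset.card_univ, Fintype.card_fun, Fintype.card_fin,
      Fintype.card_fin, nsmul_eq_mul, enorm_mul, enorm_norm, enorm_pow]
    have h1 : ‖(ρ : ℝ)‖ₑ = (ρ : ℝ≥0∞) := by simp
    have h2 : (n : ℝ≥0) * n * r' ≤ ρ := by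
      rw [hr']
      calc (n : ℝ≥0) * n * (ρ / ((n + 1) * (n + 1)))
          ≤ (n + 1) * (n + 1) * (ρ / ((n + 1) * (n + 1))) := by gcongr <;> exact le_self_add
        _ = ρ := by field_simp
    rw [h1]
    calc ((n ^ N : ℕ) : ℝ≥0∞) * ((n : ℝ≥0∞) ^ N * ‖p N‖ₑ * (r' : ℝ≥0∞) ^ N)
        = ‖p N‖ₑ * ((n * n * r' : ℝ≥0) : ℝ≥0∞) ^ N := by push_cast; ring
      _ ≤ ‖p N‖ₑ * (ρ : ℝ≥0∞) ^ N := by gcongr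
  refine (ENNReal.tsum_le_tsum hN).trans_lt ?_
  rw [lt_top_iff_ne_top]
  exact tsum_enorm_ne_top_iff_summable_norm.mpr hsum.norm

end HasTaylor

/-- Every analytic function has a Taylor series. -/
theorem exists_hasTaylor (hf : AnalyticAt ℝ f x₀) : ∃ s, HasTaylor x₀ f s := by
  choose word hword using fun d : Fin n →₀ ℕ => exists_word d.degree d rfl
  refine ⟨fun d => iteratedFDeriv ℝ d.degree f x₀ (fun i => basisVec (word d i))
    / multiFactorial d, hf, fun N m => ?_⟩
  obtain ⟨d, hd⟩ : ∃ d, d = wordCount m := ⟨_, rfl⟩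
  have hN : d.degree = N := by rw [hd, degree_wordCount]
  subst hN
  have hpos : (multiFactorial d : ℝ) ≠ 0 := by exact_mod_cast (multiFactorial_pos d).ne'
  change _ = (multiFactorial (wordCount m) : ℝ) * coeff (wordCount m) _
  rw [← hd]
  change _ = (multiFactorial d : ℝ) * (iteratedFDeriv ℝ d.degree f x₀
    (fun i => basisVec (word d i)) / multiFactorial d)
  rw [mul_div_cancel₀ _ hpos]
  -- The word `m` and the word chosen for its multi-index differ by a permutation, and the iterated
  -- derivative is symmetric.
  obtain ⟨σ, hσ⟩ := exists_perm_of_wordCount_eq ((hword d).trans hd).symm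
  have := (hf.contDiffAt (n := ω)).iteratedFDeriv_comp_perm (fun i => basisVec (word d i)) σ
  rw [← this, hσ]
  rfl

/-- The product of the coordinates along a word, as a multilinear map. -/
def wordMap {N : ℕ} (m : Fin N → Fin n) :
    ContinuousMultilinearMap ℝ (fun _ : Fin N => EuclideanSpace ℝ (Fin n)) ℝ :=
  (ContinuousMultilinearMap.mkPiAlgebra ℝ (Fin N) ℝ).compContinuousLinearMap
    fun i => EuclideanSpace.proj (m i)

theorem wordMap_apply {N : ℕ} (m : Fin N → Fin n) (y : Fin N → EuclideanSpace ℝ (Fin n)) :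
    wordMap m y = ∏ i, y i (m i) := rfl

theorem norm_wordMap_le {N : ℕ} (m : Fin N → Fin n) : ‖wordMap m‖ ≤ 1 := by
  refine ContinuousMultilinearMap.opNorm_le_bound zero_le_one fun y => ?_
  rw [wordMap_apply, norm_prod, one_mul]
  exact Finset.prod_le_prod (fun _ _ => norm_nonneg _) fun i _ => PiLp.norm_apply_le (y i) (m i)

/-- Every convergent power series is the Taylor series of an analytic function. -/
theorem exists_function (x₀ : EuclideanSpace ℝ (Fin n)) (hs : IsConvergent s) :
    ∃ f, HasTaylor x₀ f s := by
  obtain ⟨r, hr, hM⟩ := hs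
  -- The weight depends only on the letter count, so `p` is symmetric on basis vectors. Summation
  -- over N! permutations in the derivative formula then cancels the denominator.
  obtain ⟨b, hb⟩ : ∃ b : ∀ {N : ℕ}, (Fin N → Fin n) → ℝ,
    ∀ {N : ℕ} (m : Fin N → Fin n), b m = wordCoeff m s / N.factorial :=
    ⟨fun {N} m => wordCoeff m s / N.factorial, fun _ => rfl⟩
  set p : FormalMultilinearSeries ℝ (EuclideanSpace ℝ (Fin n)) ℝ :=
    fun N => ∑ m : Fin N → Fin n, b m • wordMap m with hp
  have hpm : ∀ {N : ℕ} (m : Fin N → Fin n), p N (fun i => basisVec (m i)) = b m := by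
    intro N m
    simp only [hp, sum_apply, smul_apply,
      wordMap_apply]
    rw [Finset.sum_eq_single m]
    · simp
    · intro m' _ hne
      obtain ⟨i, hi⟩ := Function.ne_iff.mp hne
      rw [Finset.prod_eq_zero (Finset.mem_univ i), smul_zero]
      simp [hi]
    · simp
  have hbn : ∀ {N : ℕ} (m : Fin N → Fin n), ‖b m‖ * (r : ℝ) ^ N ≤ (mvNorm r s).toReal := by
    intro N m
    have h1 : ‖coeff (wordCount m) s‖ * (r : ℝ) ^ N ≤ (mvNorm r s).toReal := by
      have := ENNReal.toReal_mono hM.ne (ENNReal.le_tsum (f := fun d : Fin n →₀ ℕ =>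
        ‖coeff d s‖ₑ * (r : ℝ≥0∞) ^ d.degree) (wordCount m))
      simpa [degree_wordCount] using this
    refine le_trans ?_ h1
    gcongr
    have h2 : (multiFactorial (wordCount m) : ℝ) ≤ N.factorial := by
      have := Nat.multinomial_spec Finset.univ (wordCount m)
      rw [← Finsupp.degree_eq_sum, degree_wordCount] at this
      have : multiFactorial (wordCount m) ≤ N.factorial := by
        rw [← this]
        exact Nat.le_mul_of_pos_right _ (Nat.multinomial_pos _ _)
      exact_mod_cast this
    have h3 : (0 : ℝ) < N.factorial := by positivity
    rw [hb]
    simp only [wordCoeff, norm_div, norm_mul, Real.norm_natCast]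
    rw [div_le_iff₀ h3, mul_comm]
    gcongr
  have hrad : 0 < p.radius := by
    -- There are n^N words of length N, each with weight at most a constant times r^(-N); this
    -- accounts for the radius r / (n + 1).
    refine lt_of_lt_of_le ?_ (p.le_radius_of_bound (mvNorm r s).toReal (r := r / (n + 1))
      fun N => ?_)
    · have : 0 < r / (n + 1) := by positivity
      exact_mod_cast this
    · have h1 : ‖p N‖ ≤ ∑ m : Fin N → Fin n, ‖b m‖ := by
        refine (norm_sum_le _ _).trans (Finset.sum_le_sum fun m _ => ?_)
        rw [norm_smul]
        exact mul_le_of_le_one_right (norm_nonneg _) (norm_wordMap_le m)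
      calc ‖p N‖ * ((r / (n + 1) : ℝ≥0) : ℝ) ^ N
          ≤ (∑ m : Fin N → Fin n, ‖b m‖) * ((r / (n + 1) : ℝ≥0) : ℝ) ^ N := by gcongr
        _ = (∑ m : Fin N → Fin n, ‖b m‖ * (r : ℝ) ^ N) / ((n : ℝ) + 1) ^ N := by
            push_cast
            rw [div_pow, ← Finset.sum_mul]; ring
        _ ≤ (∑ m : Fin N → Fin n, (mvNorm r s).toReal) / ((n : ℝ) + 1) ^ N := by
            gcongr with m _
            exact hbn m
        _ ≤ (mvNorm r s).toReal := by
            rw [Finset.sum_const, Finset.card_univ, Fintype.card_fun, Fintype.card_fin,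
              Fintype.card_fin, nsmul_eq_mul, div_le_iff₀ (by positivity), mul_comm]
            gcongr
            push_cast
            gcongr
            linarith
  have hball := (p.hasFPowerSeriesOnBall hrad).comp_sub x₀
  rw [zero_add] at hball
  refine ⟨fun x => p.sum (x - x₀), hball.analyticAt, fun N m => ?_⟩
  rw [hball.iteratedFDeriv_eq_sum_of_completeSpace]
  have hσ : ∀ σ : Equiv.Perm (Fin N), p N (fun i => basisVec (m (σ i))) = b m := by
    intro σ
    have := hpm (m ∘ σ)
    simp only [Function.comp_apply] at this
    rw [this, hb, hb]
    simp only [wordCoeff, wordCount_comp_perm]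
  rw [Finset.sum_congr rfl fun σ _ => hσ σ, Finset.sum_const, Finset.card_univ, Fintype.card_perm,
    Fintype.card_fin, nsmul_eq_mul, hb]
  have : (N.factorial : ℝ) ≠ 0 := by positivity
  field_simp

end TaylorSeries
end

noncomputable section

/-! ### Analytic conservation laws in coordinates -/

namespace TaylorSeries

open MvPowerSeries
open scoped Topology

variable {n : ℕ} {x₀ : EuclideanSpace ℝ (Fin n)}

theorem analyticAt_det {ι : Type*} [Fintype ι] [DecidableEq ι]
    {A : EuclideanSpace ℝ (Fin n) → Matrix ι ι ℝ}
    (hA : ∀ p q, AnalyticAt ℝ (fun x => A x p q) x₀) : AnalyticAt ℝ (fun x => (A x).det) x₀ := by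
  simp only [Matrix.det_apply']
  refine Finset.analyticAt_fun_sum _ fun σ _ => ?_
  have : AnalyticAt ℝ (fun x => ∏ i, A x (σ i) i) x₀ :=
    Finset.analyticAt_fun_prod _ fun i _ => hA _ _
  exact analyticAt_const.mul this

theorem analyticAt_inv {A : EuclideanSpace ℝ (Fin n) → Matrix (Fin n) (Fin n) ℝ}
    (hA : ∀ p q, AnalyticAt ℝ (fun x => A x p q) x₀) (h0 : (A x₀).det ≠ 0) (p q : Fin n) :
    AnalyticAt ℝ (fun x => (A x)⁻¹ p q) x₀ := by
  simp only [Matrix.inv_def, Matrix.smul_apply, Ring.inverse_eq_inv', smul_eq_mul,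
    Matrix.adjugate_apply]
  refine ((analyticAt_det hA).inv h0).mul (analyticAt_det fun i j => ?_)
  by_cases h : i = q
  · subst h
    simpa using analyticAt_const
  · simpa [Matrix.updateRow_ne h] using hA i j

theorem HasTaylor.matrix_mul {A B : EuclideanSpace ℝ (Fin n) → Matrix (Fin n) (Fin n) ℝ}
    {S T : Matrix (Fin n) (Fin n) (MvPowerSeries (Fin n) ℝ)}
    (hA : ∀ p q, HasTaylor x₀ (fun x => A x p q) (S p q))
    (hB : ∀ p q, HasTaylor x₀ (fun x => B x p q) (T p q)) (p q : Fin n) :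
    HasTaylor x₀ (fun x => (A x * B x) p q) ((S * T) p q) := by
  simp only [Matrix.mul_apply]
  exact HasTaylor.sum _ fun j _ => (hA p j).mul (hB j q)

/-- The components of `⟨L, M⟩` in coordinates. -/
def coordTorsion (L M : EuclideanSpace ℝ (Fin n) → Matrix (Fin n) (Fin n) ℝ) (a b c : Fin n)
    (x : EuclideanSpace ℝ (Fin n)) : ℝ :=
  ∑ k, L x k a * partialDeriv k (fun y => M y c b) x
    - ∑ k, L x c k * partialDeriv a (fun y => M y k b) x
    - (∑ k, M x k b * partialDeriv k (fun y => L y c a) x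
    - ∑ k, M x c k * partialDeriv b (fun y => L y k a) x)

theorem HasTaylor.coordTorsion {L M : EuclideanSpace ℝ (Fin n) → Matrix (Fin n) (Fin n) ℝ}
    {S T : Matrix (Fin n) (Fin n) (MvPowerSeries (Fin n) ℝ)}
    (hL : ∀ p q, HasTaylor x₀ (fun x => L x p q) (S p q))
    (hM : ∀ p q, HasTaylor x₀ (fun x => M x p q) (T p q)) (a b c : Fin n) :
    HasTaylor x₀ (TaylorSeries.coordTorsion L M a b c)
      (pairTorsion (fun k => pderiv ℝ k) S T (Pi.single a 1) (Pi.single b 1) c) := by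
  have e : pairTorsion (fun k => pderiv ℝ k) S T (Pi.single a 1) (Pi.single b 1) c
      = ∑ k, S k a * pderiv ℝ k (T c b) - ∑ k, S c k * pderiv ℝ a (T k b)
        - (∑ k, T k b * pderiv ℝ k (S c a) - ∑ k, T c k * pderiv ℝ b (S k a)) := by
    simp [pairTorsion, Matrix.sub_apply, Matrix.mul_apply, dirDeriv_apply, Pi.single_apply]
  rw [e]
  unfold TaylorSeries.coordTorsion
  exact ((HasTaylor.sum _ fun k _ => (hL _ _).mul ((hM _ _).partialDeriv _)).sub
    (HasTaylor.sum _ fun k _ => (hL _ _).mul ((hM _ _).partialDeriv _))).sub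
    ((HasTaylor.sum _ fun k _ => (hM _ _).mul ((hL _ _).partialDeriv _)).sub
    (HasTaylor.sum _ fun k _ => (hM _ _).mul ((hL _ _).partialDeriv _)))

/-- Existence of analytic conservation laws in coordinates, with prescribed differential at a
point, together with potentials of their images under the operators of the family. -/
theorem exists_analytic_conservation_law
    {ℓ : Fin n → EuclideanSpace ℝ (Fin n) → Matrix (Fin n) (Fin n) ℝ}
    (han : ∀ i p q, AnalyticAt ℝ (fun x => ℓ i x p q) x₀)
    (hcomm : ∀ i j, ∀ᶠ x in 𝓝 x₀, ℓ i x * ℓ j x = ℓ j x * ℓ i x)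
    (htor : ∀ i j a b c, ∀ᶠ x in 𝓝 x₀, coordTorsion (ℓ i) (ℓ j) a b c x = 0)
    {v : Fin n → ℝ} (hv : LinearIndependent ℝ fun i => ℓ i x₀ *ᵥ v) (a : Fin n → ℝ) :
    ∃ (f : EuclideanSpace ℝ (Fin n) → ℝ) (F : Fin n → EuclideanSpace ℝ (Fin n) → ℝ),
      AnalyticAt ℝ f x₀ ∧ (∀ i, AnalyticAt ℝ (F i) x₀) ∧
      (∀ k, partialDeriv k f x₀ = a k) ∧
      ∀ᶠ x in 𝓝 x₀, ∀ i k, ∑ m, partialDeriv m f x * ℓ i x m k = partialDeriv k (F i) x := by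
  rcases Nat.eq_zero_or_pos n with rfl | hn
  · exact ⟨0, 0, analyticAt_const, fun i => i.elim0, fun i => i.elim0,
      Filter.Eventually.of_forall fun x i => i.elim0⟩
  obtain ⟨p, hp⟩ : ∃ p, v p ≠ 0 := by
    by_contra! hv0
    have : v = 0 := funext hv0
    exact hv.ne_zero ⟨0, hn⟩ (by simp [this])
  choose S hS using fun i p q => exists_hasTaylor (han i p q)
  set L : Fin n → Matrix (Fin n) (Fin n) (MvPowerSeries (Fin n) ℝ) := fun i => Matrix.of (S i)
  have hL : ∀ i p q, HasTaylor x₀ (fun x => ℓ i x p q) (L i p q) := hS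
  set w : EuclideanSpace ℝ (Fin n) → Matrix (Fin n) (Fin n) ℝ :=
    fun x => Matrix.of fun p l => (ℓ l x *ᵥ v) p with hw
  set W : Matrix (Fin n) (Fin n) (MvPowerSeries (Fin n) ℝ) :=
    Matrix.of fun p l => (L l *ᵥ fun k => C (v k)) p with hW
  have hwW : ∀ p q, HasTaylor x₀ (fun x => w x p q) (W p q) := by
    intro p q
    simp only [hw, hW, Matrix.of_apply, Matrix.mulVec, dotProduct]
    exact HasTaylor.sum _ fun k _ => (hL q p k).mul (HasTaylor.const (v k))
  have hdet : (w x₀).det ≠ 0 := by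
    rw [← isUnit_iff_ne_zero, ← Matrix.isUnit_iff_isUnit_det]
    refine Matrix.linearIndependent_cols_iff_isUnit.mp ?_
    exact hv
  choose S' hS' using fun p q => exists_hasTaylor
    (analyticAt_inv (fun p q => (hwW p q).analyticAt) hdet p q)
  set W' : Matrix (Fin n) (Fin n) (MvPowerSeries (Fin n) ℝ) := Matrix.of S'
  have hW' : ∀ p q, HasTaylor x₀ (fun x => (w x)⁻¹ p q) (W' p q) := hS'
  have hdet' : ∀ᶠ x in 𝓝 x₀, (w x).det ≠ 0 :=
    (analyticAt_det fun p q => (hwW p q).analyticAt).continuousAt.eventually_ne hdet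
  -- The hypotheses are identities between analytic functions near `x₀`, so they pass to Taylor
  -- series by uniqueness.
  have hcyc : CyclicFamily (fun k => pderiv ℝ k) L (fun k => C (v k)) W W' :=
    { comm := fun i j => by
        ext1 p q
        refine (HasTaylor.matrix_mul (hL i) (hL j) p q).unique
          ((HasTaylor.matrix_mul (hL j) (hL i) p q).congr ?_)
        filter_upwards [hcomm j i] with x hx
        rw [hx]
      strong := fun i j => strongSym_of_single fun a b => by
        ext1 c
        refine (HasTaylor.coordTorsion (hL i) (hL j) a b c).unique ?_
        have h0 : HasTaylor x₀ (fun _ => (0 : ℝ)) (0 : MvPowerSeries (Fin n) ℝ) := by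
          simpa using HasTaylor.const (x₀ := x₀) (n := n) 0
        refine h0.congr ?_
        filter_upwards [htor i j a b c] with x hx using hx.symm
      const := fun k i => pderiv_C
      frame := fun p l => rfl
      inv := by
        ext1 p q
        have h1 : HasTaylor x₀ (fun _ => (1 : Matrix (Fin n) (Fin n) ℝ) p q)
            ((1 : Matrix (Fin n) (Fin n) (MvPowerSeries (Fin n) ℝ)) p q) := by
          have e : (1 : Matrix (Fin n) (Fin n) (MvPowerSeries (Fin n) ℝ)) p q
              = C ((1 : Matrix (Fin n) (Fin n) ℝ) p q) := by
            simp only [Matrix.one_apply]; split_ifs <;> simp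
          rw [e]
          exact HasTaylor.const _
        refine (HasTaylor.matrix_mul hW' hwW p q).unique (h1.congr ?_)
        filter_upwards [hdet'] with x hx
        rw [Matrix.nonsing_inv_mul _ (isUnit_iff_ne_zero.mpr hx)] }
  obtain ⟨f, F, h1, h2, h3⟩ := exists_formal_conservation_law hcyc hp a
  obtain ⟨hf, hF⟩ := h3 (fun i p q => (hL i p q).isConvergent) fun p q => (hW' p q).isConvergent
  obtain ⟨φ, hφ⟩ := exists_function x₀ hf
  choose Φ hΦ using fun i => exists_function x₀ (hF i)
  refine ⟨φ, Φ, hφ.analyticAt, fun i => (hΦ i).analyticAt, fun k => ?_, ?_⟩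
  · rw [(hφ.partialDeriv k).eval, h2]
  · refine Filter.eventually_all.mpr fun i => Filter.eventually_all.mpr fun k => ?_
    -- Back from formal to analytic: both sides have the same Taylor series and therefore agree near
    -- `x₀`.
    have e1 : HasTaylor x₀ (fun x => ∑ m, partialDeriv m φ x * ℓ i x m k)
        (pderiv ℝ k (F i)) := by
      rw [← h1]
      exact HasTaylor.sum _ fun m _ => (hφ.partialDeriv m).mul (hL i m k)
    exact e1.eventually_eq ((hΦ i).partialDeriv k)

end TaylorSeries
end

/-! ### Calculus of vector and operator fields on a manifold -/

noncomputable section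

section Toolkit

open VectorField Bundle Filter Topology

variable {n : ℕ} {X : Type*} [TopologicalSpace X] [ChartedSpace (EuclideanSpace ℝ (Fin n)) X]

variable [IsManifold (𝓡 n) ∞ X]

theorem VecSmoothAt.mdiff {ξ : VecField n X} {x : X} (h : VecSmoothAt ξ x) :
    MDifferentiableAt (𝓡 n) ((𝓡 n).prod 𝓘(ℝ, EuclideanSpace ℝ (Fin n)))
      (fun y => TotalSpace.mk' (EuclideanSpace ℝ (Fin n)) y (ξ y)) x :=
  ContMDiffAt.mdifferentiableAt h (by simp)

theorem VecSmoothAt.sum {ι : Type*} {s : Finset ι} {ξ : ι → VecField n X} {x : X}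
    (h : ∀ i ∈ s, VecSmoothAt (ξ i) x) : VecSmoothAt (fun y => ∑ i ∈ s, ξ i y) x :=
  ContMDiffAt.sum_section h

theorem VecSmoothAt.op {L : OpField n X} {ξ : VecField n X} {x : X}
    (hL : OpSmooth ∞ L) (h : VecSmoothAt ξ x) : VecSmoothAt (fun y => L y (ξ y)) x :=
  ContMDiffAt.clm_bundle_apply (hL x) h

theorem exists_vecSmoothAt (x : X) (v : TangentSpace (𝓡 n) x) :
    ∃ ξ : VecField n X, VecSmoothAt ξ x ∧ ξ x = v :=
  ⟨FiberBundle.extend (EuclideanSpace ℝ (Fin n)) v,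
    FiberBundle.contMDiffAt_extend (𝓡 n) (EuclideanSpace ℝ (Fin n)) v, by simp⟩

theorem OpSmooth.add {k : WithTop ℕ∞} {L M : OpField n X} (hL : OpSmooth k L)
    (hM : OpSmooth k M) : OpSmooth k (L + M) :=
  ContMDiff.add_section hL hM

theorem OpSmooth.smul {L : OpField n X} {f : X → ℝ} (hf : ContMDiff (𝓡 n) 𝓘(ℝ, ℝ) ∞ f)
    (hL : OpSmooth ∞ L) : OpSmooth ∞ (f • L) :=
  ContMDiff.smul_section hf hL

/-- Over the base set of a trivialization the coordinates of a product are the composition of the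
coordinates of the factors. -/
theorem opSmooth_mul {L M : OpField n X} (hL : OpSmooth ∞ L)
    (hM : OpSmooth ∞ M) : OpSmooth ∞ (L * M) := by
  intro x
  have h1 := (contMDiffAt_hom_bundle _).1 (hL x)
  have h2 := (contMDiffAt_hom_bundle _).1 (hM x)
  refine (contMDiffAt_hom_bundle _).2 ⟨h1.1, (h1.2.clm_comp h2.2).congr_of_eventuallyEq ?_⟩
  have hb := (trivializationAt (EuclideanSpace ℝ (Fin n))
    (TangentSpace (𝓡 n) : X → Type _) x).open_baseSet.mem_nhds
      (FiberBundle.mem_baseSet_trivializationAt' x)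
  filter_upwards [hb] with y hy
  simp only [TotalSpace.mk'] at *
  rw [ContinuousLinearMap.inCoordinates_eq hy hy, ContinuousLinearMap.inCoordinates_eq hy hy,
    ContinuousLinearMap.inCoordinates_eq hy hy]
  ext1 v
  simp [Trivialization.symm_apply_apply_mk _ hy]

theorem opSmooth_one : OpSmooth ∞ (1 : OpField n X) := by
  intro x
  refine (contMDiffAt_hom_bundle _).2 ⟨contMDiffAt_id,
    (contMDiffAt_const (c := ContinuousLinearMap.id ℝ _)).congr_of_eventuallyEq ?_⟩
  have hb := (trivializationAt (EuclideanSpace ℝ (Fin n))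
    (TangentSpace (𝓡 n) : X → Type _) x).open_baseSet.mem_nhds
      (FiberBundle.mem_baseSet_trivializationAt' x)
  filter_upwards [hb] with y hy
  rw [ContinuousLinearMap.inCoordinates_eq hy hy]
  ext1 v
  simp [Trivialization.apply_mk_symm _ hy]

/-! Rules for the Lie bracket at a point. -/

section Bracket

variable {ξ ξ' η : VecField n X} {x : X}

theorem lie_add_left (h : VecSmoothAt ξ x) (h' : VecSmoothAt ξ' x) :
    mlieBracket (𝓡 n) (fun y => ξ y + ξ' y) η x
      = mlieBracket (𝓡 n) ξ η x + mlieBracket (𝓡 n) ξ' η x :=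
  mlieBracket_add_left h.mdiff h'.mdiff

theorem lie_smul_left {f : X → ℝ} (hf : ContMDiffAt (𝓡 n) 𝓘(ℝ, ℝ) ∞ f x)
    (h : VecSmoothAt ξ x) :
    mlieBracket (𝓡 n) (fun y => f y • ξ y) η x
      = -(mvfderiv (𝓡 n) f x (η x)) • ξ x + f x • mlieBracket (𝓡 n) ξ η x :=
  mlieBracket_smul_left (hf.mdifferentiableAt (by simp)) h.mdiff

theorem lie_sum_left {ι : Type*} (s : Finset ι) {ξ : ι → VecField n X}
    (h : ∀ i ∈ s, VecSmoothAt (ξ i) x) :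
    mlieBracket (𝓡 n) (fun y => ∑ i ∈ s, ξ i y) η x
      = ∑ i ∈ s, mlieBracket (𝓡 n) (ξ i) η x := by
  classical
  induction s using Finset.induction_on with
  | empty =>
    simp only [Finset.sum_empty]
    exact congrFun (mlieBracket_zero_left (W := η)) x
  | insert i s hi ih =>
    simp only [Finset.sum_insert hi]
    rw [lie_add_left (h i (s.mem_insert_self i))
      (VecSmoothAt.sum fun j hj => h j (Finset.mem_insert_of_mem hj)),
      ih fun j hj => h j (Finset.mem_insert_of_mem hj)]

end Bracket

/-! Algebraic rules for `opBracket`. -/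

section OpBracket

variable {L M N : OpField n X} {ξ η : VecField n X} {x : X}

omit [IsManifold (𝓡 n) ∞ X] in
theorem opBracket_swap (L M : OpField n X) (hLM : L * M = M * L) (ξ η : VecField n X) (x : X) :
    opBracket L M ξ η x = -opBracket M L η ξ x := by
  have h : ∀ v, L x (M x v) = M x (L x v) := fun v => congr($(congrFun hLM x) v)
  unfold opBracket
  rw [mlieBracket_swap_apply (V := η) (W := ξ),
    mlieBracket_swap_apply (V := fun y => M y (η y)) (W := fun y => L y (ξ y)),
    mlieBracket_swap_apply (V := fun y => M y (η y)) (W := ξ),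
    mlieBracket_swap_apply (V := η) (W := fun y => L y (ξ y))]
  simp only [map_neg, h]
  abel

-- The terms M L [N ξ, η] and M [N ξ, L η] cancel between the two summands; no commutation is
-- needed. This closes the strong symmetries under products.
omit [IsManifold (𝓡 n) ∞ X] in
theorem opBracket_mul_left (M N L : OpField n X) (ξ η : VecField n X) (x : X) :
    opBracket (M * N) L ξ η x
      = M x (opBracket N L ξ η x) + opBracket M L (fun y => N y (ξ y)) η x := by
  have h : ∀ y v, (M y * N y) v = M y (N y v) := fun _ _ => rfl
  unfold opBracket
  simp only [Pi.mul_apply, h, map_add, map_sub]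
  abel

omit [IsManifold (𝓡 n) ∞ X] in
theorem opBracket_one_left (L : OpField n X) (ξ η : VecField n X) (x : X) :
    opBracket 1 L ξ η x = 0 := by
  unfold opBracket
  simp only [Pi.one_apply, one_apply_eq_self]
  abel

theorem opBracket_add_left (hL : OpSmooth ∞ L) (hM : OpSmooth ∞ M) (hξ : VecSmoothAt ξ x) :
    opBracket (L + M) N ξ η x = opBracket L N ξ η x + opBracket M N ξ η x := by
  unfold opBracket
  simp only [Pi.add_apply, add_apply]
  rw [lie_add_left (hξ.op hL) (hξ.op hM), lie_add_left (hξ.op hL) (hξ.op hM)]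
  simp only [map_add]
  abel

/-- Only the two brackets containing `L ξ` differentiate `f`; they produce the two correction terms.
-/
theorem opBracket_smul_left {f : X → ℝ} (hf : ContMDiff (𝓡 n) 𝓘(ℝ, ℝ) ∞ f)
    (hL : OpSmooth ∞ L) (hξ : VecSmoothAt ξ x) :
    opBracket (fun y => f y • L y) N ξ η x = f x • opBracket L N ξ η x
      - mvfderiv (𝓡 n) f x (N x (η x)) • L x (ξ x)
      + mvfderiv (𝓡 n) f x (η x) • N x (L x (ξ x)) := by
  unfold opBracket
  simp only [smul_apply]
  rw [lie_smul_left (hf x) (hξ.op hL), lie_smul_left (hf x) (hξ.op hL)]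
  simp only [map_add, map_smul, smul_add, smul_sub, neg_smul, map_neg]
  abel

theorem opBracket_sum_left {ι : Type*} (s : Finset ι) {L : ι → OpField n X}
    (hL : ∀ i ∈ s, OpSmooth ∞ (L i)) (hξ : VecSmoothAt ξ x) :
    opBracket (fun y => ∑ i ∈ s, L i y) N ξ η x = ∑ i ∈ s, opBracket (L i) N ξ η x := by
  unfold opBracket
  simp only [sum_apply]
  rw [lie_sum_left s fun i hi => hξ.op (hL i hi), lie_sum_left s fun i hi => hξ.op (hL i hi)]
  simp only [map_sum, Finset.sum_add_distrib, Finset.sum_sub_distrib]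

end OpBracket

end Toolkit

end

/-! ### Linear algebra of a commuting family with a cyclic vector -/

noncomputable section

section CyclicVector

variable {n : ℕ} {V : Type*} [AddCommGroup V] [Module ℝ V] [TopologicalSpace V]
  [IsTopologicalAddGroup V] [ContinuousSMul ℝ V] {L : Fin n → V →L[ℝ] V} {v : V}

omit [IsTopologicalAddGroup V] [ContinuousSMul ℝ V] in
theorem eq_zero_of_commute_of_apply_eq_zero
    (hv : Submodule.span ℝ (Set.range fun i => L i v) = ⊤) {T : V →L[ℝ] V}
    (hT : ∀ j, T * L j = L j * T) (h : T v = 0) : T = 0 := by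
  have hle : Submodule.span ℝ (Set.range fun i => L i v) ≤ (T : V →ₗ[ℝ] V).ker := by
    rw [Submodule.span_le]
    rintro _ ⟨j, rfl⟩
    have hj : T (L j v) = L j (T v) := congr($(hT j) v)
    simpa [h] using hj
  rw [hv] at hle
  ext w
  exact hle (Submodule.mem_top (x := w))

theorem exists_sum_apply_eq (hv : Submodule.span ℝ (Set.range fun i => L i v) = ⊤) (w : V) :
    ∃ c : Fin n → ℝ, (∑ i, c i • L i) v = w := by
  have hw : w ∈ Submodule.span ℝ (Set.range fun i => L i v) := hv ▸ Submodule.mem_top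
  obtain ⟨c, hc⟩ := (Submodule.mem_span_range_iff_exists_fun ℝ).1 hw
  exact ⟨c, by simpa [sum_apply] using hc⟩

theorem sum_smul_commute (hL : ∀ i j, L i * L j = L j * L i) (c : Fin n → ℝ) (j : Fin n) :
    (∑ i, c i • L i) * L j = L j * ∑ i, c i • L i := by
  rw [Finset.sum_mul, Finset.mul_sum]
  exact Finset.sum_congr rfl fun i _ => by rw [smul_mul_assoc, mul_smul_comm, hL i j]

theorem exists_eq_sum_smul (hL : ∀ i j, L i * L j = L j * L i)
    (hv : Submodule.span ℝ (Set.range fun i => L i v) = ⊤) {T : V →L[ℝ] V}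
    (hT : ∀ j, T * L j = L j * T) : ∃ c : Fin n → ℝ, T = ∑ i, c i • L i := by
  obtain ⟨c, hc⟩ := exists_sum_apply_eq hv (T v)
  refine ⟨c, sub_eq_zero.1 (eq_zero_of_commute_of_apply_eq_zero hv (fun j => ?_) ?_)⟩
  · rw [sub_mul, mul_sub, hT j, sum_smul_commute hL]
  · rw [sub_apply, hc, sub_self]

theorem sum_smul_injective (hv : LinearIndependent ℝ fun i => L i v) {c c' : Fin n → ℝ}
    (h : ∑ i, c i • L i = ∑ i, c' i • L i) : c = c' := by
  have h' : ∑ i, c i • L i v = ∑ i, c' i • L i v := by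
    simpa [sum_apply] using congr($h v)
  funext i
  have := Fintype.linearIndependent_iff.1 hv (fun i => c i - c' i)
    (by simp [sub_smul, Finset.sum_sub_distrib, h']) i
  exact sub_eq_zero.1 this

theorem commute_of_commute (hL : ∀ i j, L i * L j = L j * L i)
    (hv : Submodule.span ℝ (Set.range fun i => L i v) = ⊤) {S T : V →L[ℝ] V}
    (hS : ∀ j, S * L j = L j * S) (hT : ∀ j, T * L j = L j * T) : S * T = T * S := by
  obtain ⟨c, rfl⟩ := exists_eq_sum_smul hL hv hT
  rw [Finset.sum_mul, Finset.mul_sum]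
  exact Finset.sum_congr rfl fun i _ => by rw [smul_mul_assoc, mul_smul_comm, hS i]

-- Skewness at (v, v) gives D(v) v = 0, so D(v) = 0 by cyclicity. Then D(ξ) v = -D(v) ξ = 0, and
-- again D(ξ) = 0. This turns symmetries into strong symmetries.
omit [IsTopologicalAddGroup V] [ContinuousSMul ℝ V] in
theorem eq_zero_of_skew (hv : Submodule.span ℝ (Set.range fun i => L i v) = ⊤)
    {D : V → V →L[ℝ] V} (hD : ∀ ξ j, D ξ * L j = L j * D ξ)
    (h : ∀ ξ η, D η ξ + D ξ η = 0) (ξ : V) : D ξ = 0 := by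
  have h1 : D v = 0 := by
    refine eq_zero_of_commute_of_apply_eq_zero hv (hD v) ?_
    have := h v v
    rw [← two_smul ℝ, smul_eq_zero] at this
    exact this.resolve_left two_ne_zero
  refine eq_zero_of_commute_of_apply_eq_zero hv (hD ξ) ?_
  simpa [h1] using h ξ v

theorem map_apply_of_commute (hL : ∀ i j, L i * L j = L j * L i)
    (hv : Submodule.span ℝ (Set.range fun i => L i v) = ⊤)
    {A : V →ₗ[ℝ] V →L[ℝ] V} (hA : ∀ j ζ, A (L j ζ) = L j * A ζ) {T : V →L[ℝ] V}
    (hT : ∀ j, T * L j = L j * T) (ζ : V) : A (T ζ) = T * A ζ := by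
  obtain ⟨c, rfl⟩ := exists_eq_sum_smul hL hv hT
  simp [sum_apply, Finset.sum_mul, hA]

/-- With ξ = S v and η = T v in the commutative algebra, A(ξ) η = S A(v) T v, and the three factors
commute. -/
theorem apply_apply_symm (hL : ∀ i j, L i * L j = L j * L i)
    (hv : Submodule.span ℝ (Set.range fun i => L i v) = ⊤)
    {A : V →ₗ[ℝ] V →L[ℝ] V} (hA : ∀ j ζ, A (L j ζ) = L j * A ζ)
    (hc : ∀ ζ j, A ζ * L j = L j * A ζ) (ξ η : V) : A ξ η = A η ξ := by
  obtain ⟨s, rfl⟩ := exists_sum_apply_eq hv ξ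
  obtain ⟨t, rfl⟩ := exists_sum_apply_eq hv η
  set S := ∑ i, s i • L i
  set T := ∑ i, t i • L i
  have hS := sum_smul_commute hL s
  have hT := sum_smul_commute hL t
  rw [map_apply_of_commute hL hv hA hS, map_apply_of_commute hL hv hA hT]
  change (S * A v * T) v = (T * A v * S) v
  rw [mul_assoc, commute_of_commute hL hv (hc v) hT, ← mul_assoc,
    commute_of_commute hL hv hS hT, mul_assoc, ← commute_of_commute hL hv (hc v) hS, mul_assoc]

/-- The form is b(u, w) = a(u w v). The covectors a ∘ L_i span the dual space, so u in the kernel of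
b has u v = 0, and then u = 0 by cyclicity. -/
theorem isFrobeniusAlgebra_of_cyclic [FiniteDimensional ℝ V] (hn : Module.finrank ℝ V = n)
    (hL : ∀ i j, L i * L j = L j * L i) (hv : LinearIndependent ℝ fun i => L i v)
    {a : V →L[ℝ] ℝ} (ha : LinearIndependent ℝ fun i => a.comp (L i))
    (S : Subalgebra ℝ (V →L[ℝ] V)) (hS : ∀ i, L i ∈ S)
    (hc : ∀ T ∈ S, ∀ j, T * L j = L j * T) : IsFrobeniusAlgebra S := by
  have hv' := hv.span_eq_top_of_card_eq_finrank' (by simp [hn])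
  have hinj : ∀ T ∈ S, T v = 0 → T = 0 := fun T hT h =>
    eq_zero_of_commute_of_apply_eq_zero hv' (hc T hT) h
  have hcomm : ∀ u w : S, u * w = w * u := fun u w =>
    Subtype.ext (commute_of_commute hL hv' (hc _ u.2) (hc _ w.2))
  have hsep : ∀ w, (∀ i, a (L i w) = 0) → w = 0 := by
    intro w hw
    have hli : LinearIndependent ℝ fun i => ((a.comp (L i) : V →L[ℝ] ℝ) : Module.Dual ℝ V) :=
      ha.map' (ContinuousLinearMap.coeLM ℝ)
        (LinearMap.ker_eq_bot.2 ContinuousLinearMap.coe_injective)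
    have htop := hli.span_eq_top_of_card_eq_finrank'
      (by rw [Subspace.dual_finrank_eq, hn, Fintype.card_fin])
    refine (Module.forall_dual_apply_eq_zero_iff ℝ w).1 fun φ => ?_
    have hφ : φ ∈ Submodule.span ℝ (Set.range fun i =>
        ((a.comp (L i) : V →L[ℝ] ℝ) : Module.Dual ℝ V)) := htop ▸ Submodule.mem_top
    obtain ⟨c, rfl⟩ := (Submodule.mem_span_range_iff_exists_fun ℝ).1 hφ
    simp [hw]
  refine ⟨?_, hcomm, ?_⟩
  · let ev : S →ₗ[ℝ] V :=
      { toFun := fun u => (u : V →L[ℝ] V) v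
        map_add' := fun _ _ => rfl
        map_smul' := fun _ _ => rfl }
    refine FiniteDimensional.of_injective ev ((injective_iff_map_eq_zero ev).2 fun u hu => ?_)
    exact Subtype.ext (hinj _ u.2 hu)
  · let b : LinearMap.BilinForm ℝ S := LinearMap.mk₂ ℝ
      (fun u w => a ((u * w : S).1 v))
      (fun u u' w => by simp [add_mul]) (fun c u w => by simp)
      (fun u w w' => by simp [mul_add]) (fun c u w => by simp)
    have hb : b.IsSymm := ⟨fun u w => by simp only [b, LinearMap.mk₂_apply, hcomm u w]⟩
    refine ⟨b, hb, ?_, fun u w t => ?_⟩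
    · have hl : ∀ u : S, (∀ w : S, a ((w * u : S).1 v) = 0) → u = 0 := fun u hu =>
        Subtype.ext (hinj _ u.2 (hsep _ fun i => hu ⟨L i, hS i⟩))
      exact ⟨fun u hu => hl u fun w => by rw [hcomm]; exact hu w, fun u hu => hl u hu⟩
    · simp only [b, LinearMap.mk₂_apply]
      rw [hcomm u w, mul_assoc]

end CyclicVector

end

/-! ### Smoothness of coefficients in a moving frame -/

noncomputable section

section Coefficients

open VectorField Bundle Filter Topology

variable {n : ℕ} {X : Type*} [TopologicalSpace X] [ChartedSpace (EuclideanSpace ℝ (Fin n)) X]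

/-- Coefficients with respect to a moving basis are as regular as the basis and the vector. -/
theorem contMDiffAt_coeff_of_sum_smul {k : WithTop ℕ∞} {w : Fin n → X → EuclideanSpace ℝ (Fin n)}
    {b : X → EuclideanSpace ℝ (Fin n)} {g : Fin n → X → ℝ} {x₀ : X}
    (hw : ∀ i, ContMDiffAt (𝓡 n) 𝓘(ℝ, EuclideanSpace ℝ (Fin n)) k (w i) x₀)
    (hb : ContMDiffAt (𝓡 n) 𝓘(ℝ, EuclideanSpace ℝ (Fin n)) k b x₀)
    (hli : LinearIndependent ℝ fun i => w i x₀)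
    (hg : ∀ᶠ y in 𝓝 x₀, b y = ∑ i, g i y • w i y) (i : Fin n) :
    ContMDiffAt (𝓡 n) 𝓘(ℝ, ℝ) k (g i) x₀ := by
  -- `Φ y` sends coefficients to the combination of the frame at `y`. It is invertible at `x₀`,
  -- hence nearby, and inversion is smooth; the coefficients are Φ⁻¹ b.
  let Φ : X → EuclideanSpace ℝ (Fin n) →L[ℝ] EuclideanSpace ℝ (Fin n) := fun y => ∑ j, (EuclideanSpace.proj j : EuclideanSpace ℝ (Fin n) →L[ℝ] ℝ).smulRight (w j y)
  have hΦapp : ∀ y u, Φ y u = ∑ j, u j • w j y := fun y u => by simp [Φ, sum_apply]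
  have hΦ : ContMDiffAt (𝓡 n) 𝓘(ℝ, EuclideanSpace ℝ (Fin n) →L[ℝ] EuclideanSpace ℝ (Fin n)) k Φ x₀ := by
    refine ContMDiffAt.sum fun j _ => ?_
    exact ((ContinuousLinearMap.smulRightL ℝ (EuclideanSpace ℝ (Fin n)) (EuclideanSpace ℝ (Fin n))
      (EuclideanSpace.proj j : EuclideanSpace ℝ (Fin n) →L[ℝ] ℝ)).contDiff.contMDiff.contMDiffAt).comp x₀ (hw j)
  have hbij : Function.Bijective (Φ x₀) := by
    have hinj : Function.Injective (Φ x₀) := by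
      refine (injective_iff_map_eq_zero _).2 fun u hu => ?_
      rw [hΦapp] at hu
      ext j
      exact Fintype.linearIndependent_iff.1 hli _ hu j
    exact ⟨hinj, (LinearMap.injective_iff_surjective (f := (Φ x₀ : EuclideanSpace ℝ (Fin n) →ₗ[ℝ] EuclideanSpace ℝ (Fin n)))).1 hinj⟩
  let e : EuclideanSpace ℝ (Fin n) ≃L[ℝ] EuclideanSpace ℝ (Fin n) :=
    (LinearEquiv.ofBijective (Φ x₀ : EuclideanSpace ℝ (Fin n) →ₗ[ℝ] EuclideanSpace ℝ (Fin n)) hbij).toContinuousLinearEquiv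
  have he : (e : EuclideanSpace ℝ (Fin n) →L[ℝ] EuclideanSpace ℝ (Fin n)) = Φ x₀ := by ext1 u; rfl
  have hinv : ContMDiffAt (𝓡 n) 𝓘(ℝ, EuclideanSpace ℝ (Fin n) →L[ℝ] EuclideanSpace ℝ (Fin n)) k (fun y => (Φ y).inverse) x₀ := by
    have h1 : ContMDiffAt 𝓘(ℝ, EuclideanSpace ℝ (Fin n) →L[ℝ] EuclideanSpace ℝ (Fin n)) 𝓘(ℝ, EuclideanSpace ℝ (Fin n) →L[ℝ] EuclideanSpace ℝ (Fin n)) k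
        (ContinuousLinearMap.inverse : (EuclideanSpace ℝ (Fin n) →L[ℝ] EuclideanSpace ℝ (Fin n)) → (EuclideanSpace ℝ (Fin n) →L[ℝ] EuclideanSpace ℝ (Fin n))) (Φ x₀) :=
      he ▸ (contDiffAt_map_inverse e).contMDiffAt
    exact h1.comp x₀ hΦ
  have hsm := (ContMDiffAt.clm_apply hinv hb)
  have hpr : ContMDiffAt (𝓡 n) 𝓘(ℝ, ℝ) k (fun y => (EuclideanSpace.proj i : EuclideanSpace ℝ (Fin n) →L[ℝ] ℝ)
      ((Φ y).inverse (b y))) x₀ :=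
    ((EuclideanSpace.proj i : EuclideanSpace ℝ (Fin n) →L[ℝ] ℝ).contDiff.contMDiff.contMDiffAt).comp x₀ hsm
  refine hpr.congr_of_eventuallyEq ?_
  have hmem : Set.range ((↑) : (EuclideanSpace ℝ (Fin n) ≃L[ℝ] EuclideanSpace ℝ (Fin n)) → EuclideanSpace ℝ (Fin n) →L[ℝ] EuclideanSpace ℝ (Fin n)) ∈ 𝓝 (Φ x₀) := he ▸ e.nhds
  filter_upwards [hg, hΦ.continuousAt hmem] with y hy hy'
  obtain ⟨e', he'⟩ := hy'
  have hu : b y = Φ y (WithLp.toLp 2 fun j => g j y) := by rw [hΦapp, hy]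
  rw [hu, ← he', ContinuousLinearMap.inverse_equiv]
  simp

variable [IsManifold (𝓡 n) ∞ X]

omit [IsManifold (𝓡 n) ∞ X] in
theorem finrank_tangentSpace (x : X) : Module.finrank ℝ (TangentSpace (𝓡 n) x) = n :=
  finrank_euclideanSpace_fin

omit [IsManifold (𝓡 n) ∞ X] in
theorem finiteDimensional_tangentSpace (x : X) : FiniteDimensional ℝ (TangentSpace (𝓡 n) x) :=
  inferInstanceAs (FiniteDimensional ℝ (EuclideanSpace ℝ (Fin n)))

/-- Extend the cyclic vector at `x₀` to a smooth field ξ. In a trivialization the `g i` are the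
coefficients of M ξ in the frame L_i ξ. -/
theorem OpSmooth.contMDiff_coeff {L : Fin n → OpField n X} (hL : ∀ i, OpSmooth ∞ (L i))
    (hv : ∀ x, ∃ v : TangentSpace (𝓡 n) x, LinearIndependent ℝ fun i => L i x v)
    {M : OpField n X} (hM : OpSmooth ∞ M) {g : Fin n → X → ℝ}
    (hg : ∀ x, M x = ∑ i, g i x • L i x) (i : Fin n) : ContMDiff (𝓡 n) 𝓘(ℝ, ℝ) ∞ (g i) := by
  intro x₀
  obtain ⟨v, hv⟩ := hv x₀
  obtain ⟨ξ, hξ, rfl⟩ := exists_vecSmoothAt x₀ v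
  let e := trivializationAt (EuclideanSpace ℝ (Fin n)) (TangentSpace (𝓡 n) : X → Type _) x₀
  have hmem : x₀ ∈ e.baseSet := FiberBundle.mem_baseSet_trivializationAt' x₀
  have hsec : ∀ ζ : VecField n X, VecSmoothAt ζ x₀ →
      ContMDiffAt (𝓡 n) 𝓘(ℝ, EuclideanSpace ℝ (Fin n)) ∞ (fun y => (e ⟨y, ζ y⟩).2) x₀ :=
    fun ζ hζ => (contMDiffAt_section x₀).1 hζ
  refine contMDiffAt_coeff_of_sum_smul (w := fun j y => (e ⟨y, L j y (ξ y)⟩).2)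
    (b := fun y => (e ⟨y, M y (ξ y)⟩).2) (fun j => hsec _ (hξ.op (hL j))) (hsec _ (hξ.op hM))
    ?_ ?_ i
  · have := hv.map' 
      (e.continuousLinearEquivAt ℝ x₀ hmem).toLinearEquiv.toLinearMap (LinearEquiv.ker _)
    exact this
  · filter_upwards [e.open_baseSet.mem_nhds hmem] with y hy
    have : ∀ ζ, (e ⟨y, ζ⟩).2 = e.continuousLinearEquivAt ℝ y hy ζ := fun ζ => rfl
    simp only [this, hg y, sum_apply, smul_apply, map_sum, map_smul]

end Coefficients

end

/-! ### The algebra of common strong symmetries and its fibres -/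

noncomputable section

section Family

open VectorField Bundle Filter Topology

variable {n : ℕ} {X : Type*} [TopologicalSpace X] [ChartedSpace (EuclideanSpace ℝ (Fin n)) X]
  [IsManifold (𝓡 n) ∞ X] {L : Fin n → OpField n X}

theorem opBracket_add_right {L M N : OpField n X} (hL : OpSmooth ∞ L) (hM : OpSmooth ∞ M)
    (hLN : L * N = N * L) (hMN : M * N = N * M) {ξ η : VecField n X} {x : X}
    (hη : VecSmoothAt η x) :
    opBracket N (L + M) ξ η x = opBracket N L ξ η x + opBracket N M ξ η x := by
  rw [opBracket_swap N (L + M) (by rw [mul_add, add_mul, hLN, hMN]), opBracket_swap N L hLN.symm,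
    opBracket_swap N M hMN.symm, opBracket_add_left hL hM hη, neg_add]

theorem AreStrongSymmetries.symm {L M : OpField n X} (h : AreStrongSymmetries L M) :
    AreStrongSymmetries M L :=
  ⟨h.1.symm, fun x ξ η hξ hη => by rw [opBracket_swap M L h.1.symm, h.2 x η ξ hη hξ, neg_zero]⟩

theorem AreStrongSymmetries.areSymmetries {M N : OpField n X} (h : AreStrongSymmetries M N) :
    AreSymmetries M N :=
  ⟨h.1, fun x ξ η hξ hη => by rw [h.2 x ξ η hξ hη, h.2 x η ξ hη hξ, add_zero]⟩

namespace IsNijenhuisFrobeniusFamily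

variable (h : IsNijenhuisFrobeniusFamily L)

include h

/-- Polarization: expanding ⟨L_i + L_j, L_i + L_j⟩ = 0 leaves the two mixed brackets, which are
equal by the symmetry condition together with `opBracket_swap`. -/
theorem areStrongSymmetries (i j : Fin n) : AreStrongSymmetries (L i) (L j) := by
  classical
  refine ⟨(h.symmetries i j).1, fun x ξ η hξ hη => ?_⟩
  have hself : ∀ k, opBracket (L k) (L k) ξ η x = 0 := fun k => by
    have := h.nijenhuis (Pi.single k 1) x ξ η hξ hη
    simpa [Pi.single_apply] using this
  have hsum : (∑ k, (Pi.single i 1 + Pi.single j 1 : Fin n → ℝ) k • L k) = L i + L j := by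
    simp [Pi.single_apply, add_smul, Finset.sum_add_distrib]
  have hij := h.nijenhuis (Pi.single i 1 + Pi.single j 1) x ξ η hξ hη
  have hc := fun k l => (h.symmetries k l).1
  rw [hsum, opBracket_add_left (h.smooth i) (h.smooth j) hξ,
    opBracket_add_right (h.smooth i) (h.smooth j) rfl (hc j i) hη,
    opBracket_add_right (h.smooth i) (h.smooth j) (hc i j) rfl hη, hself, hself,
    opBracket_swap (L j) (L i) (hc j i),
    ← eq_neg_of_add_eq_zero_left ((h.symmetries i j).2 x ξ η hξ hη)] at hij
  rw [zero_add, add_zero, ← two_smul ℝ, smul_eq_zero] at hij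
  exact hij.resolve_left two_ne_zero

theorem mem_commonStrongSym (i : Fin n) : L i ∈ CommonStrongSym L :=
  ⟨h.smooth i, h.areStrongSymmetries i⟩

theorem commute_apply (i j : Fin n) (x : X) : L i x * L j x = L j x * L i x :=
  congrFun (h.symmetries i j).1 x

theorem exists_span (x : X) : ∃ v : TangentSpace (𝓡 n) x,
    LinearIndependent ℝ (fun i => L i x v) ∧
      Submodule.span ℝ (Set.range fun i => L i x v) = ⊤ := by
  obtain ⟨v, hv⟩ := h.generic_vector x
  have := finiteDimensional_tangentSpace (n := n) x
  exact ⟨v, hv, hv.span_eq_top_of_card_eq_finrank' (by simp [finrank_tangentSpace])⟩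

theorem coeff_unique {M : OpField n X} {g g' : Fin n → X → ℝ}
    (hg : ∀ x, M x = ∑ i, g i x • L i x) (hg' : ∀ x, M x = ∑ i, g' i x • L i x) : g' = g := by
  funext i x
  obtain ⟨v, hv, -⟩ := h.exists_span x
  exact congrFun (sum_smul_injective hv (c := fun i => g' i x) (c' := fun i => g i x)
    ((hg' x).symm.trans (hg x))) i

theorem exists_coeff {M : OpField n X} (hM : OpSmooth ∞ M) (hc : ∀ i, M * L i = L i * M) :
    ∃ g : Fin n → X → ℝ, (∀ i, ContMDiff (𝓡 n) 𝓘(ℝ, ℝ) ∞ (g i)) ∧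
      ∀ x, M x = ∑ i, g i x • L i x := by
  have hex : ∀ x, ∃ c : Fin n → ℝ, M x = ∑ i, c i • L i x := fun x => by
    obtain ⟨v, -, hv⟩ := h.exists_span x
    exact exists_eq_sum_smul (fun i j => h.commute_apply i j x) hv fun j => congrFun (hc j) x
  choose c hc using hex
  exact ⟨fun i x => c x i, OpSmooth.contMDiff_coeff h.smooth h.generic_vector hM hc, hc⟩

theorem commute_of_commute {M N : OpField n X} (hM : ∀ i, M * L i = L i * M)
    (hN : ∀ i, N * L i = L i * N) : M * N = N * M := by
  funext x
  obtain ⟨v, -, hv⟩ := h.exists_span x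
  exact _root_.commute_of_commute (fun i j => h.commute_apply i j x) hv
    (fun j => congrFun (hM j) x) fun j => congrFun (hN j) x

end IsNijenhuisFrobeniusFamily

/-- The operator-valued 1-form `∑ dgᵢ ⊗ Lᵢ` at the point `x`. -/
def coeffDifferential (L : Fin n → OpField n X) (g : Fin n → X → ℝ) (x : X) :
    TangentSpace (𝓡 n) x →ₗ[ℝ] TangentSpace (𝓡 n) x →L[ℝ] TangentSpace (𝓡 n) x where
  toFun ζ := ∑ i, mvfderiv (𝓡 n) (g i) x ζ • L i x
  map_add' ζ ζ' := by simp [add_smul, Finset.sum_add_distrib]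
  map_smul' c ζ := by simp [mul_smul, Finset.smul_sum]

omit [IsManifold (𝓡 n) ∞ X] in
theorem coeffDifferential_apply (L : Fin n → OpField n X) (g : Fin n → X → ℝ) (x : X)
    (ζ : TangentSpace (𝓡 n) x) :
    coeffDifferential L g x ζ = ∑ i, mvfderiv (𝓡 n) (g i) x ζ • L i x := rfl

/-- The undifferentiated terms vanish by `hN`, so only the differentials of the coefficients
survive. -/
theorem opBracket_sum_smul {g : Fin n → X → ℝ} (hL : ∀ i, OpSmooth ∞ (L i))
    (hg : ∀ i, ContMDiff (𝓡 n) 𝓘(ℝ, ℝ) ∞ (g i)) {M N : OpField n X}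
    (hM : ∀ x, M x = ∑ i, g i x • L i x) (hN : ∀ i, AreStrongSymmetries (L i) N)
    {x : X} {ξ η : VecField n X} (hξ : VecSmoothAt ξ x) (hη : VecSmoothAt η x) :
    opBracket M N ξ η x = N x (coeffDifferential L g x (η x) (ξ x))
      - coeffDifferential L g x (N x (η x)) (ξ x) := by
  obtain rfl : M = fun y => ∑ i, g i y • L i y := funext hM
  rw [opBracket_sum_left Finset.univ (L := fun i y => g i y • L i y)
    (fun i _ => (hL i).smul (hg i)) hξ]
  simp only [opBracket_smul_left (hg _) (hL _) hξ, (hN _).2 x ξ η hξ hη, smul_zero, zero_sub,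
    coeffDifferential_apply, sum_apply, smul_apply, map_sum, map_smul, Finset.sum_add_distrib,
    Finset.sum_neg_distrib]
  abel

/-- The common strong symmetries form a subalgebra of the algebra of operator fields. -/
def commonStrongSymSubalgebra (L : Fin n → OpField n X) : Subalgebra ℝ (OpField n X) where
  carrier := CommonStrongSym L
  mul_mem' {M N} hM hN := by
    refine ⟨opSmooth_mul hM.1 hN.1, fun i => ⟨?_, fun x ξ η hξ hη => ?_⟩⟩
    · rw [mul_assoc, (hN.2 i).1, ← mul_assoc, (hM.2 i).1, mul_assoc]
    · rw [opBracket_mul_left, (hN.2 i).2 x ξ η hξ hη, (hM.2 i).2 x _ η (hξ.op hN.1) hη, map_zero,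
        add_zero]
  add_mem' {M N} hM hN := by
    refine ⟨hM.1.add hN.1, fun i => ⟨?_, fun x ξ η hξ hη => ?_⟩⟩
    · rw [add_mul, mul_add, (hN.2 i).1, (hM.2 i).1]
    · rw [opBracket_add_left hM.1 hN.1 hξ, (hN.2 i).2 x ξ η hξ hη, (hM.2 i).2 x ξ η hξ hη,
        add_zero]
  algebraMap_mem' c := by
    have hc : algebraMap ℝ (OpField n X) c = (fun _ : X => c) • (1 : OpField n X) := by
      rw [Algebra.algebraMap_eq_smul_one]
      rfl
    have hsm : OpSmooth ∞ ((fun _ : X => c) • (1 : OpField n X)) :=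
      opSmooth_one.smul contMDiff_const
    rw [hc]
    refine ⟨hsm, fun i => ⟨?_, fun x ξ η hξ hη => ?_⟩⟩
    · rw [← hc]
      exact Algebra.commutes c (L i)
    · have := opBracket_smul_left (N := L i) (η := η) (contMDiff_const (c := c)) opSmooth_one hξ
      refine this.trans ?_
      simp [opBracket_one_left, mvfderiv_const]

namespace IsNijenhuisFrobeniusFamily

variable (h : IsNijenhuisFrobeniusFamily L)

include h

theorem coeffDifferential_commute (g : Fin n → X → ℝ) (x : X) (ζ : TangentSpace (𝓡 n) x)
    (j : Fin n) : coeffDifferential L g x ζ * L j x = L j x * coeffDifferential L g x ζ :=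
  sum_smul_commute (fun i j => h.commute_apply i j x) _ j

/-- The first-order equation on the coefficients of a common symmetry. -/
theorem coeffDifferential_apply_of_symmetry {M : OpField n X} {g : Fin n → X → ℝ}
    (hg : ∀ i, ContMDiff (𝓡 n) 𝓘(ℝ, ℝ) ∞ (g i)) (hM : ∀ x, M x = ∑ i, g i x • L i x)
    (hs : ∀ i, AreSymmetries M (L i)) (x : X) (j : Fin n) (ζ : TangentSpace (𝓡 n) x) :
    coeffDifferential L g x (L j x ζ) = L j x * coeffDifferential L g x ζ := by
  obtain ⟨v, -, hv⟩ := h.exists_span x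
  have hcomm := fun i j => h.commute_apply i j x
  set A := coeffDifferential L g x
  have hA := h.coeffDifferential_commute g x
  -- The defect D(η) = L_j A(η) - A(L_j η) commutes with the family, and the symmetry condition is
  -- precisely its skewness.
  have := eq_zero_of_skew (L := fun i => L i x) hv
    (D := fun η => L j x * A η - A (L j x η)) (fun η i => ?_) (fun ξ η => ?_) ζ
  · exact (sub_eq_zero.1 this).symm
  · rw [sub_mul, mul_sub, hA, mul_assoc, hA, ← mul_assoc, hcomm, mul_assoc]
  · obtain ⟨ξ', hξ, rfl⟩ := exists_vecSmoothAt x ξ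
    obtain ⟨η', hη, rfl⟩ := exists_vecSmoothAt x η
    have := (hs j).2 x ξ' η' hξ hη
    rwa [opBracket_sum_smul h.smooth hg hM (fun i => h.areStrongSymmetries i j) hξ hη,
      opBracket_sum_smul h.smooth hg hM (fun i => h.areStrongSymmetries i j) hη hξ] at this

theorem mem_commonStrongSym_of_areSymmetries {M : OpField n X} (hM : OpSmooth ∞ M)
    (hs : ∀ i, AreSymmetries M (L i)) : M ∈ CommonStrongSym L := by
  refine ⟨hM, fun j => ⟨(hs j).1, fun x ξ η hξ hη => ?_⟩⟩
  obtain ⟨g, hg, hMg⟩ := h.exists_coeff hM fun i => (hs i).1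
  rw [opBracket_sum_smul h.smooth hg hMg (fun i => h.areStrongSymmetries i j) hξ hη,
    h.coeffDifferential_apply_of_symmetry hg hMg hs]
  exact sub_self _

/-- At each point `N` is a combination of the `L j`, so the coefficient differential of `M`, which
intertwines every `L j`, also intertwines `N`. -/
theorem areStrongSymmetries_of_mem {M N : OpField n X} (hM : M ∈ CommonStrongSym L)
    (hN : N ∈ CommonStrongSym L) : AreStrongSymmetries M N := by
  refine ⟨h.commute_of_commute (fun i => (hM.2 i).1) fun i => (hN.2 i).1, fun x ξ η hξ hη => ?_⟩
  obtain ⟨g, hg, hMg⟩ := h.exists_coeff hM.1 fun i => (hM.2 i).1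
  obtain ⟨v, -, hv⟩ := h.exists_span x
  rw [opBracket_sum_smul h.smooth hg hMg (fun i => (hN.2 i).symm) hξ hη,
    map_apply_of_commute (fun i j => h.commute_apply i j x) hv
      (h.coeffDifferential_apply_of_symmetry hg hMg (fun i => (hM.2 i).areSymmetries) x)
      fun j => congrFun (hN.2 j).1 x]
  exact sub_self _

theorem exists_subalgebra_fiber (x : X) :
    ∃ S : Subalgebra ℝ (TangentSpace (𝓡 n) x →L[ℝ] TangentSpace (𝓡 n) x),
      (S : Set (TangentSpace (𝓡 n) x →L[ℝ] TangentSpace (𝓡 n) x))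
        = {T | ∃ M ∈ CommonStrongSym L, M x = T} ∧ IsFrobeniusAlgebra S := by
  let ev : OpField n X →ₐ[ℝ] (TangentSpace (𝓡 n) x →L[ℝ] TangentSpace (𝓡 n) x) :=
    Pi.evalAlgHom ℝ (fun y : X => TangentSpace (𝓡 n) y →L[ℝ] TangentSpace (𝓡 n) y) x
  refine ⟨(commonStrongSymSubalgebra L).map ev, rfl, ?_⟩
  obtain ⟨v, hv⟩ := h.generic_vector x
  obtain ⟨a, ha⟩ := h.generic_covector x
  have := finiteDimensional_tangentSpace (n := n) x
  refine isFrobeniusAlgebra_of_cyclic (finrank_tangentSpace x)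
    (fun i j => h.commute_apply i j x) hv ha _ (fun i => ⟨L i, h.mem_commonStrongSym i, rfl⟩) ?_
  rintro _ ⟨M, hM, rfl⟩ j
  exact congrFun (hM.2 j).1 x

end IsNijenhuisFrobeniusFamily

end Family

end

/-! ### Conservation laws and common strong symmetries -/

noncomputable section

section ClosedForms

open VectorField Bundle Filter Topology

variable {n : ℕ} {X : Type*} [TopologicalSpace X] [ChartedSpace (EuclideanSpace ℝ (Fin n)) X]

theorem mvfderiv_sum_mul {ι : Type*} (s : Finset ι) {g f : ι → X → ℝ} {x : X}
    (hg : ∀ i ∈ s, MDifferentiableAt (𝓡 n) 𝓘(ℝ, ℝ) (g i) x)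
    (hf : ∀ i ∈ s, MDifferentiableAt (𝓡 n) 𝓘(ℝ, ℝ) (f i) x) (ζ : TangentSpace (𝓡 n) x) :
    MDifferentiableAt (𝓡 n) 𝓘(ℝ, ℝ) (fun y => ∑ i ∈ s, g i y * f i y) x ∧
    mvfderiv (𝓡 n) (fun y => ∑ i ∈ s, g i y * f i y) x ζ
      = ∑ i ∈ s, (mvfderiv (𝓡 n) (g i) x ζ * f i x + g i x * mvfderiv (𝓡 n) (f i) x ζ) := by
  classical
  induction s using Finset.induction_on with
  | empty => simp [mvfderiv_const, mdifferentiableAt_const]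
  | insert i s hi ih =>
    have ih := ih (fun j hj => hg j (Finset.mem_insert_of_mem hj))
      fun j hj => hf j (Finset.mem_insert_of_mem hj)
    have hgi := hg i (s.mem_insert_self i)
    have hfi := hf i (s.mem_insert_self i)
    simp only [Finset.sum_insert hi]
    refine ⟨(hgi.mul hfi).add ih.1, ?_⟩
    have h1 := mvfderiv_add (hgi.mul hfi) ih.1
    have h2 := mvfderiv_mul hgi hfi
    refine (congr($h1 ζ)).trans ?_
    rw [add_apply, ih.2, h2]
    simp only [add_apply, smul_apply, smul_eq_mul]
    ring

variable [IsManifold (𝓡 n) ∞ X]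

theorem contMDiffAt_form_apply {α : CovecField n X} {U : Set X} (hU : IsOpen U)
    (hα : FormSmoothOn α U) {x : X} (hx : x ∈ U) {ξ : VecField n X} (hξ : VecSmoothAt ξ x) :
    ContMDiffAt (𝓡 n) 𝓘(ℝ, ℝ) ∞ (fun y => α y (ξ y)) x := by
  have h1 := ContMDiffAt.clm_bundle_apply ((hα x hx).contMDiffAt (hU.mem_nhds hx)) hξ
  exact (contMDiffAt_totalSpace.1 h1).2

theorem FormSmoothOn.sum_smul {ι : Type*} (s : Finset ι) {g : ι → X → ℝ} {α : ι → CovecField n X}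
    {U : Set X} (hg : ∀ i, ContMDiff (𝓡 n) 𝓘(ℝ, ℝ) ∞ (g i)) (hα : ∀ i, FormSmoothOn (α i) U) :
    FormSmoothOn (fun y => ∑ i ∈ s, g i y • α i y) U :=
  ContMDiffOn.sum_section fun i _ => ContMDiffOn.smul_section (hg i).contMDiffOn (hα i)

/-- Here M^*α = ∑ g_i L_i^*α, so d(M^*α) = ∑ dg_i ∧ L_i^*α. Its value at (ξ, η) is α(A(ξ) η - A(η)
ξ) for A = ∑ dg_i ⊗ L_i, which vanishes by `apply_apply_symm`. -/
theorem IsNijenhuisFrobeniusFamily.isClosedFormOn_dualApply {L : Fin n → OpField n X}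
    (h : IsNijenhuisFrobeniusFamily L) {U : Set X} (hU : IsOpen U) {α : CovecField n X}
    (hα : ∀ i, IsConservationLawOn (L i) α U) {M : OpField n X} (hM : M ∈ CommonStrongSym L) :
    IsClosedFormOn (dualApply M α) U := by
  obtain ⟨g, hg, hMg⟩ := h.exists_coeff hM.1 fun i => (hM.2 i).1
  have heq : dualApply M α = fun y => ∑ i, g i y • dualApply (L i) α y := by
    funext y
    ext v
    simp [dualApply, hMg, sum_apply]
  rw [heq]
  refine ⟨FormSmoothOn.sum_smul _ hg fun i => (hα i).2.1, fun x hx ξ η hξ hη => ?_⟩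
  have hd : ∀ {ζ : VecField n X}, VecSmoothAt ζ x → ∀ i ∈ Finset.univ,
      MDifferentiableAt (𝓡 n) 𝓘(ℝ, ℝ) (fun y => dualApply (L i) α y (ζ y)) x := fun hζ i _ =>
    (contMDiffAt_form_apply hU (hα i).2.1 hx hζ).mdifferentiableAt (by simp)
  have hgd : ∀ i ∈ Finset.univ, MDifferentiableAt (𝓡 n) 𝓘(ℝ, ℝ) (g i) x := fun i _ =>
    (hg i).contMDiffAt.mdifferentiableAt (by simp)
  simp only [sum_apply, smul_apply, smul_eq_mul]
  rw [(mvfderiv_sum_mul _ hgd (hd hη) _).2, (mvfderiv_sum_mul _ hgd (hd hξ) _).2,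
    ← Finset.sum_sub_distrib, ← Finset.sum_sub_distrib]
  obtain ⟨v, -, hv⟩ := h.exists_span x
  have hsymm := apply_apply_symm (fun i j => h.commute_apply i j x) hv
    (h.coeffDifferential_apply_of_symmetry hg hMg (fun i => (hM.2 i).areSymmetries) x)
    (fun ζ j => h.coeffDifferential_commute g x ζ j) (ξ x) (η x)
  have hsymm' := congrArg (α x) hsymm
  simp only [coeffDifferential_apply, sum_apply, smul_apply, map_sum, map_smul,
    smul_eq_mul] at hsymm'
  rw [← sub_eq_zero, ← Finset.sum_sub_distrib] at hsymm'
  refine Eq.trans (Finset.sum_congr rfl fun i _ => ?_) hsymm'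
  have hi := (hα i).2.2 x hx ξ η hξ hη
  simp only [dualApply, ContinuousLinearMap.comp_apply] at hi ⊢
  linear_combination g i x * hi

end ClosedForms

end

/-! ### Vector and operator fields read in a chart -/

noncomputable section

section ChartRepresentation

open VectorField Bundle Filter Topology

variable {n : ℕ} {X : Type*} [TopologicalSpace X] [ChartedSpace (EuclideanSpace ℝ (Fin n)) X]
  [IsManifold (𝓡 n) ∞ X]

/-- Coordinates of tangent vectors in the trivialization of the tangent bundle centred at `p`. -/
def tangentCoord (p y : X) : TangentSpace (𝓡 n) y →L[ℝ] EuclideanSpace ℝ (Fin n) :=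
  (trivializationAt (EuclideanSpace ℝ (Fin n))
    (TangentSpace (𝓡 n) : X → Type _) p).continuousLinearMapAt ℝ y

/-- The tangent vector with given coordinates in the trivialization centred at `p`. -/
def tangentCoordSymm (p y : X) : EuclideanSpace ℝ (Fin n) →L[ℝ] TangentSpace (𝓡 n) y :=
  (trivializationAt (EuclideanSpace ℝ (Fin n))
    (TangentSpace (𝓡 n) : X → Type _) p).symmL ℝ y

variable {p y : X} {z : EuclideanSpace ℝ (Fin n)}

theorem mem_tangent_baseSet (hy : y ∈ (extChartAt (𝓡 n) p).source) :
    y ∈ (trivializationAt (EuclideanSpace ℝ (Fin n))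
      (TangentSpace (𝓡 n) : X → Type _) p).baseSet := by
  rw [TangentBundle.trivializationAt_baseSet, ← extChartAt_source (𝓡 n)]
  exact hy

omit [IsManifold (𝓡 n) ∞ X] in
theorem symm_mem_source (hz : z ∈ (extChartAt (𝓡 n) p).target) :
    (extChartAt (𝓡 n) p).symm z ∈ (extChartAt (𝓡 n) p).source :=
  (extChartAt (𝓡 n) p).map_target hz

theorem tangentCoord_tangentCoordSymm (hy : y ∈ (extChartAt (𝓡 n) p).source)
    (w : EuclideanSpace ℝ (Fin n)) : tangentCoord p y (tangentCoordSymm p y w) = w :=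
  Trivialization.continuousLinearMapAt_symmL _ (mem_tangent_baseSet hy) w

theorem tangentCoordSymm_tangentCoord (hy : y ∈ (extChartAt (𝓡 n) p).source)
    (v : TangentSpace (𝓡 n) y) : tangentCoordSymm p y (tangentCoord p y v) = v :=
  Trivialization.symmL_continuousLinearMapAt _ (mem_tangent_baseSet hy) v

theorem tangentCoord_apply (hy : y ∈ (extChartAt (𝓡 n) p).source) (v : TangentSpace (𝓡 n) y) :
    tangentCoord p y v = ((trivializationAt (EuclideanSpace ℝ (Fin n))
      (TangentSpace (𝓡 n) : X → Type _) p) ⟨y, v⟩).2 := by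
  unfold tangentCoord
  rw [Trivialization.continuousLinearMapAt_apply, Trivialization.linearMapAt_apply,
    if_pos (mem_tangent_baseSet hy)]

/-- A vector field read in the chart at `p`. -/
def vecRep (p : X) (ξ : VecField n X) (z : EuclideanSpace ℝ (Fin n)) : EuclideanSpace ℝ (Fin n) :=
  tangentCoord p ((extChartAt (𝓡 n) p).symm z) (ξ ((extChartAt (𝓡 n) p).symm z))

/-- An operator field read in the chart at `p`. -/
def opRep (p : X) (L : OpField n X) (z : EuclideanSpace ℝ (Fin n)) :
    EuclideanSpace ℝ (Fin n) →L[ℝ] EuclideanSpace ℝ (Fin n) :=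
  (tangentCoord p ((extChartAt (𝓡 n) p).symm z)).comp
    ((L ((extChartAt (𝓡 n) p).symm z)).comp (tangentCoordSymm p ((extChartAt (𝓡 n) p).symm z)))

theorem vecRep_op (hz : z ∈ (extChartAt (𝓡 n) p).target) (L : OpField n X) (ξ : VecField n X) :
    vecRep p (fun y => L y (ξ y)) z = opRep p L z (vecRep p ξ z) := by
  simp only [vecRep, opRep, ContinuousLinearMap.comp_apply,
    tangentCoordSymm_tangentCoord (symm_mem_source hz)]

theorem opRep_mul (hz : z ∈ (extChartAt (𝓡 n) p).target) (L M : OpField n X) :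
    opRep p (L * M) z = opRep p L z * opRep p M z := by
  ext1 w
  change _ = opRep p L z (opRep p M z w)
  simp only [opRep, ContinuousLinearMap.comp_apply,
    tangentCoordSymm_tangentCoord (symm_mem_source hz)]
  rfl

/-- The derivative of the inverse chart is the inverse of the tangent trivialization. This makes
naturality of the Lie bracket under pullback available for `vecRep`. -/
theorem mpullback_eq_vecRep (hz : z ∈ (extChartAt (𝓡 n) p).target) (ξ : VecField n X) :
    mpullback 𝓘(ℝ, EuclideanSpace ℝ (Fin n)) (𝓡 n) (extChartAt (𝓡 n) p).symm ξ z
      = vecRep p ξ z := by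
  have hs := symm_mem_source hz
  have hs' : (extChartAt (𝓡 n) p).symm z ∈ (chartAt (EuclideanSpace ℝ (Fin n)) p).source := by
    rwa [← extChartAt_source (𝓡 n)]
  have h1 := TangentBundle.symmL_trivializationAt (I := 𝓡 n) hs'
  let G : EuclideanSpace ℝ (Fin n) → EuclideanSpace ℝ (Fin n) →L[ℝ] EuclideanSpace ℝ (Fin n) :=
    fun w => mfderivWithin 𝓘(ℝ, EuclideanSpace ℝ (Fin n)) (𝓡 n) (extChartAt (𝓡 n) p).symm
      (Set.range (𝓡 n)) w
  have h2 := congrArg G ((extChartAt (𝓡 n) p).right_inv hz)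
  have h3 : mfderiv 𝓘(ℝ, EuclideanSpace ℝ (Fin n)) (𝓡 n) (extChartAt (𝓡 n) p).symm z
      = G z := by
    simp only [G, ModelWithCorners.range_eq_univ, mfderivWithin_univ]
  have h4 : mfderiv 𝓘(ℝ, EuclideanSpace ℝ (Fin n)) (𝓡 n) (extChartAt (𝓡 n) p).symm z
      = tangentCoordSymm p ((extChartAt (𝓡 n) p).symm z) :=
    h3.trans (h2.symm.trans h1.symm)
  rw [mpullback_apply]
  have hinv : (mfderiv 𝓘(ℝ, EuclideanSpace ℝ (Fin n)) (𝓡 n)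
      (extChartAt (𝓡 n) p).symm z).inverse = tangentCoord p ((extChartAt (𝓡 n) p).symm z) := by
    refine ContinuousLinearMap.inverse_eq ?_ ?_
    · rw [h4]
      ext1 w
      exact tangentCoordSymm_tangentCoord hs w
    · rw [h4]
      ext1 w
      exact tangentCoord_tangentCoordSymm hs w
  rw [hinv]
  rfl

end ChartRepresentation

end

/-! ### Brackets in coordinates -/

noncomputable section

section ChartRepresentation

open VectorField Bundle Filter Topology

variable {n : ℕ} {X : Type*} [TopologicalSpace X] [ChartedSpace (EuclideanSpace ℝ (Fin n)) X]
  [IsManifold (𝓡 n) ∞ X] {p y : X} {z : EuclideanSpace ℝ (Fin n)}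

omit [IsManifold (𝓡 n) ∞ X] in
theorem target_mem_nhds (hz : z ∈ (extChartAt (𝓡 n) p).target) :
    (extChartAt (𝓡 n) p).target ∈ 𝓝 z :=
  (isOpen_extChartAt_target p).mem_nhds hz

theorem contMDiffAt_chart_symm (hz : z ∈ (extChartAt (𝓡 n) p).target) :
    ContMDiffAt 𝓘(ℝ, EuclideanSpace ℝ (Fin n)) (𝓡 n) ∞ (extChartAt (𝓡 n) p).symm z :=
  (contMDiffOn_extChartAt_symm p).contMDiffAt (target_mem_nhds hz)

theorem contDiffAt_vecRep (hz : z ∈ (extChartAt (𝓡 n) p).target) {ξ : VecField n X}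
    (hξ : VecSmoothAt ξ ((extChartAt (𝓡 n) p).symm z)) : ContDiffAt ℝ ∞ (vecRep p ξ) z := by
  have h1 := (Trivialization.contMDiffAt_section_iff (e := trivializationAt
    (EuclideanSpace ℝ (Fin n)) (TangentSpace (𝓡 n) : X → Type _) p)
      (mem_tangent_baseSet (symm_mem_source hz))).1 hξ
  have h2 := h1.comp z (contMDiffAt_chart_symm hz)
  refine ContMDiffAt.contDiffAt (h2.congr_of_eventuallyEq ?_)
  filter_upwards [target_mem_nhds hz] with w hw
  exact tangentCoord_apply (symm_mem_source hw) _

theorem vecRep_mlieBracket (hz : z ∈ (extChartAt (𝓡 n) p).target) {ξ η : VecField n X}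
    (hξ : VecSmoothAt ξ ((extChartAt (𝓡 n) p).symm z))
    (hη : VecSmoothAt η ((extChartAt (𝓡 n) p).symm z)) :
    vecRep p (mlieBracket (𝓡 n) ξ η) z = lieBracket ℝ (vecRep p ξ) (vecRep p η) z := by
  have hev : ∀ ζ : VecField n X,
      mpullback 𝓘(ℝ, EuclideanSpace ℝ (Fin n)) (𝓡 n) (extChartAt (𝓡 n) p).symm ζ
        =ᶠ[𝓝 z] vecRep p ζ := fun ζ => by
    filter_upwards [target_mem_nhds hz] with w hw
    exact mpullback_eq_vecRep hw ζ
  have : IsManifold (𝓡 n) (minSmoothness ℝ 2) X := by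
    rw [minSmoothness_of_isRCLikeNormedField]
    infer_instance
  rw [← mpullback_eq_vecRep hz, mpullback_mlieBracket hξ.mdiff hη.mdiff
    (contMDiffAt_chart_symm hz) (by
      rw [minSmoothness_of_isRCLikeNormedField]
      exact WithTop.coe_le_coe.2 (le_top (a := (2 : ℕ∞))))]
  refine ((hev ξ).mlieBracket_vectorField_eq (hev η)).trans ?_
  have h := mlieBracketWithin_eq_lieBracketWithin (𝕜 := ℝ) (V := vecRep p ξ) (W := vecRep p η)
    (s := Set.univ)
  exact (congrFun h z).trans (by rw [lieBracketWithin_univ])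

/-- The coordinate vector field with constant components `w` in the chart at `p`. -/
def constField (p : X) (w : EuclideanSpace ℝ (Fin n)) : VecField n X :=
  fun y => tangentCoordSymm p y w

theorem vecRep_constField (hz : z ∈ (extChartAt (𝓡 n) p).target) (w : EuclideanSpace ℝ (Fin n)) :
    vecRep p (constField p w) z = w :=
  tangentCoord_tangentCoordSymm (symm_mem_source hz) w

theorem vecSmoothAt_constField (hy : y ∈ (extChartAt (𝓡 n) p).source)
    (w : EuclideanSpace ℝ (Fin n)) : VecSmoothAt (constField p w) y := by
  refine (Trivialization.contMDiffAt_section_iff (e := trivializationAt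
    (EuclideanSpace ℝ (Fin n)) (TangentSpace (𝓡 n) : X → Type _) p)
      (mem_tangent_baseSet hy)).2 ?_
  refine (contMDiffAt_const (c := w)).congr_of_eventuallyEq ?_
  filter_upwards [(isOpen_extChartAt_source p).mem_nhds hy] with x hx
  rw [← tangentCoord_apply hx]
  exact tangentCoord_tangentCoordSymm hx w

/-- The bracket `⟨L, M⟩` of two coordinate fields, in the chart. -/
theorem vecRep_opBracket_constField (hz : z ∈ (extChartAt (𝓡 n) p).target) {L M : OpField n X}
    (hL : OpSmooth ∞ L) (hM : OpSmooth ∞ M) (u w : EuclideanSpace ℝ (Fin n)) :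
    vecRep p (opBracket L M (constField p u) (constField p w)) z
      = fderiv ℝ (fun z => opRep p M z w) z (opRep p L z u)
        - fderiv ℝ (fun z => opRep p L z u) z (opRep p M z w)
        - opRep p L z (fderiv ℝ (fun z => opRep p M z w) z u)
        + opRep p M z (fderiv ℝ (fun z => opRep p L z u) z w) := by
  have hs := symm_mem_source hz
  have hu := vecSmoothAt_constField hs u
  have hw := vecSmoothAt_constField hs w
  have hevc : ∀ u : EuclideanSpace ℝ (Fin n), vecRep p (constField p u) =ᶠ[𝓝 z] fun _ => u := by
    intro u
    filter_upwards [target_mem_nhds hz] with x hx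
    exact vecRep_constField hx u
  have hev : ∀ (L : OpField n X) (u : EuclideanSpace ℝ (Fin n)),
      vecRep p (fun y => L y (constField p u y)) =ᶠ[𝓝 z] fun z => opRep p L z u := by
    intro L u
    filter_upwards [target_mem_nhds hz] with x hx
    rw [vecRep_op hx, vecRep_constField hx]
  have h1 : vecRep p (opBracket L M (constField p u) (constField p w)) z
      = opRep p L z (opRep p M z
          (vecRep p (mlieBracket (𝓡 n) (constField p u) (constField p w)) z))
        + vecRep p (mlieBracket (𝓡 n) (fun y => L y (constField p u y))
            (fun y => M y (constField p w y))) z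
        - opRep p L z (vecRep p (mlieBracket (𝓡 n) (constField p u)
            (fun y => M y (constField p w y))) z)
        - opRep p M z (vecRep p (mlieBracket (𝓡 n) (fun y => L y (constField p u y))
            (constField p w)) z) := by
    simp only [← vecRep_op hz]
    simp only [vecRep, opBracket, map_add, map_sub]
  rw [h1, vecRep_mlieBracket hz hu hw, vecRep_mlieBracket hz (hu.op hL) (hw.op hM),
    vecRep_mlieBracket hz hu (hw.op hM), vecRep_mlieBracket hz (hu.op hL) hw,
    (hevc u).lieBracket_vectorField_eq (hevc w),
    (hev L u).lieBracket_vectorField_eq (hev M w),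
    (hevc u).lieBracket_vectorField_eq (hev M w),
    (hev L u).lieBracket_vectorField_eq (hevc w)]
  simp only [lieBracket, fderiv_fun_const, Pi.zero_apply, zero_apply, sub_zero, map_zero,
    zero_sub, map_neg]
  abel

/-- The components of an operator field in the chart at `p`. -/
def opMatrix (p : X) (L : OpField n X) (z : EuclideanSpace ℝ (Fin n)) :
    Matrix (Fin n) (Fin n) ℝ :=
  Matrix.of fun i j => opRep p L z (EuclideanSpace.single j 1) i

theorem opRep_apply (L : OpField n X) (z w : EuclideanSpace ℝ (Fin n)) (i : Fin n) :
    opRep p L z w i = ∑ j, opMatrix p L z i j * w j := by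
  have hw : w = ∑ j, w j • EuclideanSpace.single j (1 : ℝ) := by
    ext k
    simp [Finset.sum_apply, Pi.single_apply]
  conv_lhs => rw [hw]
  simp [opMatrix, mul_comm]

theorem opMatrix_mul (hz : z ∈ (extChartAt (𝓡 n) p).target) (L M : OpField n X) :
    opMatrix p (L * M) z = opMatrix p L z * opMatrix p M z := by
  ext i j
  simp only [Matrix.mul_apply]
  have : opMatrix p (L * M) z i j = opRep p L z (opRep p M z (EuclideanSpace.single j 1)) i := by
    simp only [opMatrix, opRep_mul hz]
    rfl
  rw [this, opRep_apply]
  rfl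

end ChartRepresentation

end

/-! ### Torsion components and analyticity of operator matrices -/

noncomputable section

section ChartRepresentation

open VectorField Bundle Filter Topology TaylorSeries

variable {n : ℕ} {X : Type*} [TopologicalSpace X] [ChartedSpace (EuclideanSpace ℝ (Fin n)) X]
  [IsManifold (𝓡 n) ∞ X] {p y : X} {z : EuclideanSpace ℝ (Fin n)}

theorem differentiableAt_opRep_apply (hz : z ∈ (extChartAt (𝓡 n) p).target) {L : OpField n X}
    (hL : OpSmooth ∞ L) (w : EuclideanSpace ℝ (Fin n)) :
    DifferentiableAt ℝ (fun z => opRep p L z w) z := by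
  have h := contDiffAt_vecRep hz ((vecSmoothAt_constField (symm_mem_source hz) w).op hL)
  refine (h.differentiableAt (by simp)).congr_of_eventuallyEq ?_
  filter_upwards [target_mem_nhds hz] with x hx
  rw [vecRep_op hx, vecRep_constField hx]

theorem partialDeriv_opMatrix (hz : z ∈ (extChartAt (𝓡 n) p).target) {L : OpField n X}
    (hL : OpSmooth ∞ L) (k i j : Fin n) :
    partialDeriv k (fun x => opMatrix p L x i j) z
      = fderiv ℝ (fun z => opRep p L z (basisVec j)) z (basisVec k) i := by
  have h1 := (differentiableAt_opRep_apply hz hL (basisVec j)).hasFDerivAt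
  have h2 := ((EuclideanSpace.proj i : EuclideanSpace ℝ (Fin n) →L[ℝ] ℝ).hasFDerivAt).comp z h1
  have h3 : partialDeriv k (fun x => opMatrix p L x i j) z = _ := congr($(h2.fderiv) (basisVec k))
  rw [h3]
  rfl

theorem fderiv_opRep_apply (hz : z ∈ (extChartAt (𝓡 n) p).target) {L : OpField n X}
    (hL : OpSmooth ∞ L) (w : EuclideanSpace ℝ (Fin n)) (i j : Fin n) :
    fderiv ℝ (fun z => opRep p L z (basisVec j)) z w i
      = ∑ k, w k * partialDeriv k (fun x => opMatrix p L x i j) z := by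
  have hw : w = ∑ k, w k • basisVec k := by
    ext k
    simp [Pi.single_apply]
  conv_lhs => rw [hw]
  simp [partialDeriv_opMatrix hz hL]

theorem coordTorsion_opMatrix (hz : z ∈ (extChartAt (𝓡 n) p).target) {L M : OpField n X}
    (hL : OpSmooth ∞ L) (hM : OpSmooth ∞ M) (a b c : Fin n) :
    coordTorsion (opMatrix p L) (opMatrix p M) a b c z
      = vecRep p (opBracket L M (constField p (basisVec a)) (constField p (basisVec b))) z c := by
  rw [vecRep_opBracket_constField hz hL hM]
  simp only [PiLp.add_apply, PiLp.sub_apply, fderiv_opRep_apply hz hL, fderiv_opRep_apply hz hM,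
    opRep_apply _ _ (fderiv _ _ _ _), coordTorsion]
  have : ∀ (L : OpField n X) (k a : Fin n), opRep p L z (basisVec a) k = opMatrix p L z k a :=
    fun _ _ _ => rfl
  have hb : ∀ (k : Fin n) (F : Fin n → ℝ), ∑ x, (basisVec k) x * F x = F k := fun k F => by
    simp
  simp only [this, hb]
  ring

theorem coordTorsion_opMatrix_eq_zero (hz : z ∈ (extChartAt (𝓡 n) p).target) {L M : OpField n X}
    (hL : OpSmooth ∞ L) (hM : OpSmooth ∞ M) (h : AreStrongSymmetries L M) (a b c : Fin n) :
    coordTorsion (opMatrix p L) (opMatrix p M) a b c z = 0 := by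
  rw [coordTorsion_opMatrix hz hL hM]
  have hs := symm_mem_source hz
  unfold vecRep
  rw [h.2 _ _ _ (vecSmoothAt_constField hs _) (vecSmoothAt_constField hs _), map_zero]
  rfl

theorem analyticAt_opMatrix [IsManifold (𝓡 n) ω X] (p : X) {L : OpField n X} (hL : OpSmooth ω L)
    (i j : Fin n) : AnalyticAt ℝ (fun x => opMatrix p L x i j) (extChartAt (𝓡 n) p p) := by
  have hp := mem_extChartAt_target (I := 𝓡 n) p
  have hsymm : ContMDiffAt 𝓘(ℝ, EuclideanSpace ℝ (Fin n)) (𝓡 n) ω (extChartAt (𝓡 n) p).symm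
      (extChartAt (𝓡 n) p p) :=
    (contMDiffOn_extChartAt_symm p).contMDiffAt (target_mem_nhds hp)
  have h1 := ((contMDiffAt_hom_bundle _).1 (hL p)).2
  have h2 := h1.comp_of_eq hsymm (extChartAt_to_inv p)
  -- The hom bundle coordinates of `L`, composed with the inverse chart, unfold to `opRep`.
  have h3 : ContMDiffAt 𝓘(ℝ, EuclideanSpace ℝ (Fin n))
      𝓘(ℝ, EuclideanSpace ℝ (Fin n) →L[ℝ] EuclideanSpace ℝ (Fin n)) ω (opRep p L)
      (extChartAt (𝓡 n) p p) := h2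
  have h4 := h3.contDiffAt.analyticAt
  exact (((EuclideanSpace.proj i : EuclideanSpace ℝ (Fin n) →L[ℝ] ℝ).comp
    (ContinuousLinearMap.apply ℝ (EuclideanSpace ℝ (Fin n))
      (basisVec j))).analyticAt _).comp h4

end ChartRepresentation

end

/-! ### Exact forms are closed -/

noncomputable section

section ExactForms

open VectorField Bundle Filter Topology

variable {n : ℕ} {X : Type*} [TopologicalSpace X] [ChartedSpace (EuclideanSpace ℝ (Fin n)) X]

theorem mvfderiv_congr {f g : X → ℝ} {x : X} (h : f =ᶠ[𝓝 x] g) (v : TangentSpace (𝓡 n) x) :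
    mvfderiv (𝓡 n) f x v = mvfderiv (𝓡 n) g x v :=
  congr($(h.mfderiv_eq (I := 𝓡 n) (I' := 𝓘(ℝ, ℝ))) v)

variable [IsManifold (𝓡 n) ∞ X] {p y : X} {z : EuclideanSpace ℝ (Fin n)}

theorem mvfderiv_comp_chart (hy : y ∈ (extChartAt (𝓡 n) p).source)
    {G : EuclideanSpace ℝ (Fin n) → ℝ} (hG : DifferentiableAt ℝ G (extChartAt (𝓡 n) p y))
    (v : TangentSpace (𝓡 n) y) :
    mvfderiv (𝓡 n) (fun x => G (extChartAt (𝓡 n) p x)) y v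
      = fderiv ℝ G (extChartAt (𝓡 n) p y) (tangentCoord p y v) := by
  have hy' : y ∈ (chartAt (EuclideanSpace ℝ (Fin n)) p).source := by
    rwa [← extChartAt_source (𝓡 n)]
  have h1 := mvfderiv_comp_apply y hG.mdifferentiableAt
    (mdifferentiableAt_extChartAt (I := 𝓡 n) hy') v
  refine h1.trans ?_
  have h2 := TangentBundle.continuousLinearMapAt_trivializationAt (I := 𝓡 n) hy'
  have h3 : mfderiv (𝓡 n) 𝓘(ℝ, EuclideanSpace ℝ (Fin n)) (extChartAt (𝓡 n) p) y v
      = tangentCoord p y v := congr($(h2.symm) v)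
  have h4 : ∀ w : EuclideanSpace ℝ (Fin n),
      mvfderiv 𝓘(ℝ, EuclideanSpace ℝ (Fin n)) G (extChartAt (𝓡 n) p y) w
        = fderiv ℝ G (extChartAt (𝓡 n) p y) w := fun w =>
    congr($(mfderiv_eq_fderiv (f := G) (x := extChartAt (𝓡 n) p y)) w)
  exact (h4 _).trans (congrArg _ h3)

theorem vecRep_chart (hy : y ∈ (extChartAt (𝓡 n) p).source) (ξ : VecField n X) :
    vecRep p ξ (extChartAt (𝓡 n) p y) = tangentCoord p y (ξ y) := by
  unfold vecRep
  rw [(extChartAt (𝓡 n) p).left_inv hy]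

theorem opRep_chart (hy : y ∈ (extChartAt (𝓡 n) p).source) (L : OpField n X)
    (v : TangentSpace (𝓡 n) y) :
    tangentCoord p y (L y v) = opRep p L (extChartAt (𝓡 n) p y) (tangentCoord p y v) := by
  unfold opRep
  rw [(extChartAt (𝓡 n) p).left_inv hy]
  simp only [ContinuousLinearMap.comp_apply, tangentCoordSymm_tangentCoord hy]

/-- Exact forms are closed. -/
theorem isClosedFormOn_mvfderiv {F : X → ℝ} {U : Set X} (hU : IsOpen U)
    (hF : ContMDiffOn (𝓡 n) 𝓘(ℝ, ℝ) ∞ F U) : IsClosedFormOn (fun x => mvfderiv (𝓡 n) F x) U := by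
  -- The coordinate formula for dF is needed on a neighbourhood of `y`, since it is differentiated
  -- once more below.
  have hrep : ∀ y ∈ U, ∃ G : EuclideanSpace ℝ (Fin n) → ℝ,
      ContDiffAt ℝ ∞ G (extChartAt (𝓡 n) y y) ∧
      ∀ᶠ x in 𝓝 y, x ∈ (extChartAt (𝓡 n) y).source ∧ ∀ v, mvfderiv (𝓡 n) F x v
        = fderiv ℝ G (extChartAt (𝓡 n) y x) (tangentCoord y x v) := by
    intro y hy
    have hG : ContDiffAt ℝ ∞ (fun z => F ((extChartAt (𝓡 n) y).symm z))
        (extChartAt (𝓡 n) y y) := by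
      have h1 := (hF y hy).contMDiffAt (hU.mem_nhds hy)
      exact (h1.comp_of_eq (contMDiffAt_chart_symm (mem_extChartAt_target y))
        (extChartAt_to_inv y)).contDiffAt
    refine ⟨_, hG, ?_⟩
    have hd : ∀ᶠ z in 𝓝 (extChartAt (𝓡 n) y y),
        DifferentiableAt ℝ (fun z => F ((extChartAt (𝓡 n) y).symm z)) z :=
      ((hG.of_le (m := 1) (WithTop.coe_le_coe.2 le_top)).eventually (by simp)).mono
        fun z hz => hz.differentiableAt (by simp)
    filter_upwards [(continuousAt_extChartAt (I := 𝓡 n) y).eventually hd,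
      extChartAt_source_mem_nhds (I := 𝓡 n) y] with x hx hxs
    refine ⟨hxs, fun v => ?_⟩
    rw [← mvfderiv_comp_chart hxs hx]
    refine mvfderiv_congr ?_ v
    filter_upwards [(isOpen_extChartAt_source y).mem_nhds hxs] with w hw
    rw [(extChartAt (𝓡 n) y).left_inv hw]
  refine ⟨fun y hy => ?_, fun y hy ξ η hξ hη => ?_⟩
  · obtain ⟨G, hG, hev⟩ := hrep y hy
    refine ContMDiffAt.contMDiffWithinAt ((contMDiffAt_hom_bundle _).2 ⟨contMDiffAt_id, ?_⟩)
    have h1 : ContMDiffAt 𝓘(ℝ, EuclideanSpace ℝ (Fin n))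
        𝓘(ℝ, EuclideanSpace ℝ (Fin n) →L[ℝ] ℝ) ∞ (fderiv ℝ G) (extChartAt (𝓡 n) y y) :=
      (hG.fderiv_right (m := ∞) (by simp)).contMDiffAt
    refine (h1.comp y contMDiffAt_extChartAt).congr_of_eventuallyEq ?_
    filter_upwards [hev] with x hx
    ext1 w
    have : fderiv ℝ G (extChartAt (𝓡 n) y x) w
        = mvfderiv (𝓡 n) F x (tangentCoordSymm y x w) := by
      rw [hx.2, tangentCoord_tangentCoordSymm hx.1]
    refine Eq.trans ?_ this.symm
    simp [ContinuousLinearMap.inCoordinates]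
    rfl
  · obtain ⟨G, hG, hev⟩ := hrep y hy
    set z := extChartAt (𝓡 n) y y with hz
    have hzt : z ∈ (extChartAt (𝓡 n) y).target := mem_extChartAt_target y
    have hyz : (extChartAt (𝓡 n) y).symm z = y := extChartAt_to_inv y
    have hys : y ∈ (extChartAt (𝓡 n) y).source := mem_extChartAt_source y
    have hGd : DifferentiableAt ℝ (fderiv ℝ G) z :=
      (hG.fderiv_right (m := 1) (WithTop.coe_le_coe.2 le_top)).differentiableAt (by simp)
    have hvd : ∀ ζ : VecField n X, VecSmoothAt ζ y → DifferentiableAt ℝ (vecRep y ζ) z :=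
      fun ζ hζ => (contDiffAt_vecRep hzt (by rwa [hyz])).differentiableAt (by simp)
    have key : ∀ ζ ζ' : VecField n X, VecSmoothAt ζ y →
        mvfderiv (𝓡 n) (fun x => mvfderiv (𝓡 n) F x (ζ x)) y (ζ' y)
          = fderiv ℝ (fderiv ℝ G) z (vecRep y ζ' z) (vecRep y ζ z)
            + fderiv ℝ G z (fderiv ℝ (vecRep y ζ) z (vecRep y ζ' z)) := by
      intro ζ ζ' hζ
      have h1 : (fun x => mvfderiv (𝓡 n) F x (ζ x)) =ᶠ[𝓝 y]
          fun x => (fun w => fderiv ℝ G w (vecRep y ζ w)) (extChartAt (𝓡 n) y x) := by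
        filter_upwards [hev] with x hx
        rw [hx.2, vecRep_chart hx.1]
      rw [mvfderiv_congr h1, mvfderiv_comp_chart hys (hGd.clm_apply (hvd ζ hζ)),
        ← vecRep_chart hys, fderiv_clm_apply hGd (hvd ζ hζ)]
      simp [add_comm, hz]
    have hlie : mvfderiv (𝓡 n) F y (mlieBracket (𝓡 n) ξ η y)
        = fderiv ℝ G z (lieBracket ℝ (vecRep y ξ) (vecRep y η) z) := by
      rw [hev.self_of_nhds.2, ← vecRep_chart hys, ← hz,
        vecRep_mlieBracket hzt (by rwa [hyz]) (by rwa [hyz])]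
    -- Symmetry of the second derivative removes the Hessian terms; the remaining ones form the Lie
    -- bracket.
    have hsymm : IsSymmSndFDerivAt ℝ G z := hG.isSymmSndFDerivAt (by
      rw [minSmoothness_of_isRCLikeNormedField]
      exact WithTop.coe_le_coe.2 le_top)
    rw [key η ξ hη, key ξ η hξ, hlie, hsymm.eq]
    simp only [lieBracket, map_sub]
    ring

theorem IsClosedFormOn.congr {α β : CovecField n X} {U : Set X} (hU : IsOpen U)
    (hα : IsClosedFormOn α U) (h : ∀ x ∈ U, β x = α x) : IsClosedFormOn β U := by
  refine ⟨ContMDiffOn.congr hα.1 fun x hx => by rw [h x hx], fun x hx ξ η hξ hη => ?_⟩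
  have hev : ∀ ζ : VecField n X, (fun y => β y (ζ y)) =ᶠ[𝓝 x] fun y => α y (ζ y) := fun ζ => by
    filter_upwards [hU.mem_nhds hx] with y hy
    rw [h y hy]
  rw [mvfderiv_congr (hev η), mvfderiv_congr (hev ξ), h x hx]
  exact hα.2 x hx ξ η hξ hη

end ExactForms

end

/-! ### Local analytic conservation laws -/

noncomputable section

section AnalyticFamily

open VectorField Bundle Filter Topology TaylorSeries

variable {n : ℕ} {X : Type*} [TopologicalSpace X] [ChartedSpace (EuclideanSpace ℝ (Fin n)) X]
  [IsManifold (𝓡 n) ∞ X] {p y : X}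

theorem map_eq_sum_basisVec {V : Type*} [AddCommGroup V] [Module ℝ V]
    (φ : EuclideanSpace ℝ (Fin n) →ₗ[ℝ] V) (w : EuclideanSpace ℝ (Fin n)) :
    φ w = ∑ k, w k • φ (basisVec k) := by
  have hw : w = ∑ k, w k • basisVec k := by
    ext k
    simp [Pi.single_apply]
  conv_lhs => rw [hw]
  simp

/-- A covector composed with an operator field, in coordinates. -/
theorem map_opRep_basisVec (φ : EuclideanSpace ℝ (Fin n) →ₗ[ℝ] ℝ) (L : OpField n X)
    (z : EuclideanSpace ℝ (Fin n)) (k : Fin n) :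
    φ (opRep p L z (basisVec k)) = ∑ m, φ (basisVec m) * opMatrix p L z m k := by
  rw [map_eq_sum_basisVec φ]
  exact Finset.sum_congr rfl fun m _ => mul_comm _ _

theorem linearIndependent_opMatrix_mulVec {L : Fin n → OpField n X} {v : TangentSpace (𝓡 n) p}
    (hv : LinearIndependent ℝ fun i => L i p v) :
    LinearIndependent ℝ fun i =>
      opMatrix p (L i) (extChartAt (𝓡 n) p p) *ᵥ (tangentCoord p p v : Fin n → ℝ) := by
  have hp := mem_extChartAt_source (I := 𝓡 n) p
  have hinj : Function.Injective (tangentCoord p p) := fun u w h => by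
    rw [← tangentCoordSymm_tangentCoord hp u, h, tangentCoordSymm_tangentCoord hp]
  have h1 := hv.map' (tangentCoord p p).toLinearMap (LinearMap.ker_eq_bot.2 hinj)
  have h2 := h1.map' (WithLp.linearEquiv 2 ℝ (Fin n → ℝ)).toLinearMap (LinearEquiv.ker _)
  have heq : (fun i => opMatrix p (L i) (extChartAt (𝓡 n) p p) *ᵥ
      (tangentCoord p p v : Fin n → ℝ)) = fun i => (tangentCoord p p (L i p v) : Fin n → ℝ) := by
    funext i k
    rw [opRep_chart hp, opRep_apply]
    rfl
  rw [heq]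
  exact h2

theorem linearIndependent_covector_opMatrix {L : Fin n → OpField n X}
    (hy : y ∈ (extChartAt (𝓡 n) p).source)
    (a : TangentSpace (𝓡 n) y →L[ℝ] ℝ) :
    LinearIndependent ℝ (fun i => a.comp (L i y)) ↔
      LinearIndependent ℝ (fun i k => ∑ m, a (tangentCoordSymm p y (basisVec m))
        * opMatrix p (L i) (extChartAt (𝓡 n) p y) m k) := by
  have hrow : ∀ i k, ∑ m, a (tangentCoordSymm p y (basisVec m))
      * opMatrix p (L i) (extChartAt (𝓡 n) p y) m k
        = a (L i y (tangentCoordSymm p y (basisVec k))) := by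
    intro i k
    have h1 := map_opRep_basisVec (p := p)
      (a.comp (tangentCoordSymm p y) : EuclideanSpace ℝ (Fin n) →ₗ[ℝ] ℝ) (L i)
      (extChartAt (𝓡 n) p y) k
    refine Eq.trans h1.symm ?_
    have h2 := opRep_chart hy (L i) (tangentCoordSymm p y (basisVec k))
    rw [tangentCoord_tangentCoordSymm hy] at h2
    change a (tangentCoordSymm p y (opRep p (L i) (extChartAt (𝓡 n) p y) (basisVec k))) = _
    rw [← h2, tangentCoordSymm_tangentCoord hy]
  simp only [hrow]
  rw [Fintype.linearIndependent_iff, Fintype.linearIndependent_iff]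
  refine forall_congr' fun c => imp_congr_left ⟨fun h => ?_, fun h => ?_⟩
  · funext k
    have := congr($h (tangentCoordSymm p y (basisVec k)))
    simpa [sum_apply, Finset.sum_apply] using this
  · ext v
    have h1 := map_eq_sum_basisVec ((∑ i, c i • a.comp (L i y)).comp (tangentCoordSymm p y) :
      EuclideanSpace ℝ (Fin n) →ₗ[ℝ] ℝ) (tangentCoord p y v)
    have h2 : (∑ i, c i • a.comp (L i y)) (tangentCoordSymm p y (tangentCoord p y v)) = _ := h1
    rw [tangentCoordSymm_tangentCoord hy] at h2
    refine h2.trans (Finset.sum_eq_zero fun k _ => ?_)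
    have h3 := congrFun h k
    simp only [Finset.sum_apply, Pi.smul_apply, Pi.zero_apply, smul_eq_mul] at h3
    refine smul_eq_zero_of_right _ ?_
    simpa [sum_apply] using h3

theorem IsNijenhuisFrobeniusFamily.exists_local_conservation_law {L : Fin n → OpField n X}
    (h : IsNijenhuisFrobeniusFamily L) [IsManifold (𝓡 n) ω X] (hL : ∀ i, OpSmooth ω (L i))
    (p : X) : ∃ U : Set X, IsOpen U ∧ p ∈ U ∧
      ∃ f : X → ℝ, ContMDiffOn (𝓡 n) 𝓘(ℝ, ℝ) ω f U ∧
        (∀ i, IsConservationLawOn (L i) (fun x => mvfderiv (𝓡 n) f x) U) ∧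
        ∀ x ∈ U, LinearIndependent ℝ
          (fun i => dualApply (L i) (fun y => mvfderiv (𝓡 n) f y) x) := by
  obtain ⟨v, hv⟩ := h.generic_vector p
  obtain ⟨a, ha⟩ := h.generic_covector p
  have hp := mem_extChartAt_source (I := 𝓡 n) p
  set z₀ := extChartAt (𝓡 n) p p with hz₀
  have htarget := target_mem_nhds (mem_extChartAt_target (I := 𝓡 n) p)
  have han : ∀ i r q, AnalyticAt ℝ (fun x => opMatrix p (L i) x r q) z₀ := fun i =>
    analyticAt_opMatrix p (hL i)
  obtain ⟨f, F, hf, hF, hfa, heq⟩ := exists_analytic_conservation_law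
    (ℓ := fun i => opMatrix p (L i)) han
    (fun i j => by
      filter_upwards [htarget] with x hx
      rw [← opMatrix_mul hx, ← opMatrix_mul hx, (h.symmetries i j).1])
    (fun i j b c d => by
      filter_upwards [htarget] with x hx
      exact coordTorsion_opMatrix_eq_zero hx (h.smooth i) (h.smooth j)
        (h.areStrongSymmetries i j) b c d)
    (linearIndependent_opMatrix_mulVec hv) (fun k => a (tangentCoordSymm p p (basisVec k)))
  -- The rows of `N` are the components of L_i^* df. Independence means nonzero determinant, an open
  -- condition that holds at `z₀` because df is the generic covector there.
  let N : EuclideanSpace ℝ (Fin n) → Matrix (Fin n) (Fin n) ℝ := fun x =>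
    Matrix.of fun i k => ∑ m, partialDeriv m f x * opMatrix p (L i) x m k
  have hN : ∀ᶠ x in 𝓝 z₀, (N x).det ≠ 0 := by
    have h1 : AnalyticAt ℝ (fun x => (N x).det) z₀ := analyticAt_det fun i k => by
      have h2 := Finset.analyticAt_fun_sum Finset.univ fun m _ =>
        (analyticAt_partialDeriv hf m).mul (han i m k)
      exact h2
    refine h1.continuousAt.eventually_ne ?_
    have h2 := (linearIndependent_covector_opMatrix (L := L) hp a).1 ha
    rw [← isUnit_iff_ne_zero, ← Matrix.isUnit_iff_isUnit_det,
      ← Matrix.linearIndependent_rows_iff_isUnit]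
    simp only [← hfa] at h2
    exact h2
  have hall := hf.eventually_analyticAt.and ((eventually_all.2 fun i =>
    (hF i).eventually_analyticAt).and (heq.and hN))
  obtain ⟨W, hW, hWo, hzW⟩ := eventually_nhds_iff.1 hall
  have hUo : IsOpen ((extChartAt (𝓡 n) p).source ∩ extChartAt (𝓡 n) p ⁻¹' W) :=
    (continuousOn_extChartAt p).isOpen_inter_preimage (isOpen_extChartAt_source p) hWo
  have hsm : ∀ g : EuclideanSpace ℝ (Fin n) → ℝ, (∀ z ∈ W, AnalyticAt ℝ g z) →
      ContMDiffOn (𝓡 n) 𝓘(ℝ, ℝ) ω (fun x => g (extChartAt (𝓡 n) p x))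
        ((extChartAt (𝓡 n) p).source ∩ extChartAt (𝓡 n) p ⁻¹' W) := by
    intro g hg x hx
    have h1 : ContMDiffAt (𝓡 n) 𝓘(ℝ, EuclideanSpace ℝ (Fin n)) ω (extChartAt (𝓡 n) p) x :=
      contMDiffAt_extChartAt' (by rw [← extChartAt_source (𝓡 n)]; exact hx.1)
    exact ((hg _ hx.2).contDiffAt.contMDiffAt.comp x h1).contMDiffWithinAt
  have hclosed : ∀ g : EuclideanSpace ℝ (Fin n) → ℝ, (∀ z ∈ W, AnalyticAt ℝ g z) →
      IsClosedFormOn (fun x => mvfderiv (𝓡 n) (fun x => g (extChartAt (𝓡 n) p x)) x)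
        ((extChartAt (𝓡 n) p).source ∩ extChartAt (𝓡 n) p ⁻¹' W) := fun g hg =>
    isClosedFormOn_mvfderiv hUo ((hsm g hg).of_le le_top)
  have hfW : ∀ z ∈ W, AnalyticAt ℝ f z := fun z hz => (hW z hz).1
  refine ⟨_, hUo, ⟨hp, hzW⟩, fun x => f (extChartAt (𝓡 n) p x), hsm f hfW,
    fun i => ⟨hclosed f hfW, ?_⟩, fun x hx => ?_⟩
  -- On `U` the form L_i^* df is the differential of the potential `F i` read in the chart, hence
  -- closed.
  · refine (hclosed (F i) fun z hz => (hW z hz).2.1 i).congr hUo fun x hx => ?_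
    ext u
    have hWx := hW _ hx.2
    rw [mvfderiv_comp_chart hx.1 (hWx.2.1 i).differentiableAt]
    change mvfderiv (𝓡 n) (fun x => f (extChartAt (𝓡 n) p x)) x (L i x u) = _
    rw [mvfderiv_comp_chart hx.1 hWx.1.differentiableAt, opRep_chart hx.1]
    have h1 := map_eq_sum_basisVec (((fderiv ℝ f (extChartAt (𝓡 n) p x)).comp
      (opRep p (L i) (extChartAt (𝓡 n) p x)) : EuclideanSpace ℝ (Fin n) →L[ℝ] ℝ) :
        EuclideanSpace ℝ (Fin n) →ₗ[ℝ] ℝ) (tangentCoord p x u)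
    have h2 := map_eq_sum_basisVec (fderiv ℝ (F i) (extChartAt (𝓡 n) p x) :
        EuclideanSpace ℝ (Fin n) →ₗ[ℝ] ℝ) (tangentCoord p x u)
    refine h1.trans (Eq.trans (Finset.sum_congr rfl fun k _ => ?_) h2.symm)
    refine congrArg _ (Eq.trans ?_ (hWx.2.2.1 i k))
    exact map_opRep_basisVec (fderiv ℝ f (extChartAt (𝓡 n) p x) :
      EuclideanSpace ℝ (Fin n) →ₗ[ℝ] ℝ) (L i) _ k
  · refine (linearIndependent_covector_opMatrix hx.1 _).2 ?_
    have hWx := hW _ hx.2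
    have h1 := hWx.2.2.2
    rw [← isUnit_iff_ne_zero, ← Matrix.isUnit_iff_isUnit_det,
      ← Matrix.linearIndependent_rows_iff_isUnit] at h1
    have hd : ∀ m, mvfderiv (𝓡 n) (fun x => f (extChartAt (𝓡 n) p x)) x
        (tangentCoordSymm p x (basisVec m)) = partialDeriv m f (extChartAt (𝓡 n) p x) := by
      intro m
      rw [mvfderiv_comp_chart hx.1 hWx.1.differentiableAt, tangentCoord_tangentCoordSymm hx.1]
      rfl
    simp only [hd]
    exact h1

end AnalyticFamily

end

/-! ### Assembly of the theorem -/

theorem theorem3 (n : ℕ) :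
    -- smooth and analytic categories
    (∀ (X : Type*) [TopologicalSpace X] [ChartedSpace (EuclideanSpace ℝ (Fin n)) X]
      [IsManifold (𝓡 n) ∞ X] (L : Fin n → OpField n X), IsNijenhuisFrobeniusFamily L →
      -- (1)
      ((∀ M ∈ CommonStrongSym L, ∃ g : Fin n → X → ℝ,
          (∀ i, ContMDiff (𝓡 n) 𝓘(ℝ, ℝ) ∞ (g i)) ∧
          (∀ x, M x = ∑ i, g i x • L i x) ∧
          ∀ g' : Fin n → X → ℝ, (∀ x, M x = ∑ i, g' i x • L i x) → g' = g) ∧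
        (∃ A : Subalgebra ℝ (OpField n X), (A : Set (OpField n X)) = CommonStrongSym L) ∧
        (∀ M ∈ CommonStrongSym L, ∀ N ∈ CommonStrongSym L, M * N = N * M) ∧
        ∀ x : X, ∃ S : Subalgebra ℝ (TangentSpace (𝓡 n) x →L[ℝ] TangentSpace (𝓡 n) x),
          (S : Set (TangentSpace (𝓡 n) x →L[ℝ] TangentSpace (𝓡 n) x))
            = {T | ∃ M ∈ CommonStrongSym L, M x = T} ∧
          IsFrobeniusAlgebra S) ∧
      -- (2)
      ((∀ M : OpField n X, OpSmooth ∞ M → (∀ i, AreSymmetries M (L i)) → M ∈ CommonStrongSym L) ∧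
        ∀ M ∈ CommonStrongSym L, ∀ N ∈ CommonStrongSym L, AreStrongSymmetries M N) ∧
      -- (3)
      (∀ U : Set X, IsOpen U → ∀ α : CovecField n X,
        (∀ i, IsConservationLawOn (L i) α U) →
        ∀ M ∈ CommonStrongSym L, IsClosedFormOn (dualApply M α) U) ∧
      -- (4), analytic category
      (IsManifold (𝓡 n) ω X → (∀ i, OpSmooth ω (L i)) →
        ∀ p : X, ∃ U : Set X, IsOpen U ∧ p ∈ U ∧
          ∃ f : X → ℝ, ContMDiffOn (𝓡 n) 𝓘(ℝ, ℝ) ω f U ∧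
            (∀ i, IsConservationLawOn (L i) (fun x => mvfderiv (𝓡 n) f x) U) ∧
            ∀ x ∈ U, LinearIndependent ℝ
              (fun i => dualApply (L i) (fun y => mvfderiv (𝓡 n) f y) x))) ∧
    -- (4), formal category
    (∀ L : Fin n → FormalOp n, IsFormalNijenhuisFrobeniusFamily L →
      ∃ f : FormalFun n,
        (∀ i, FormalConservationLaw (L i) (fun j => MvPowerSeries.pderiv ℝ j f)) ∧
        LinearIndependent ℝ (fun i => fun k => MvPowerSeries.constantCoeff
          (((fun j => MvPowerSeries.pderiv ℝ j f) ᵥ* L i) k))) := by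
  refine ⟨fun X _ _ _ L h => ⟨⟨fun M hM => ?_, ⟨commonStrongSymSubalgebra L, rfl⟩,
    fun M hM N hN => h.commute_of_commute (fun i => (hM.2 i).1) fun i => (hN.2 i).1,
    h.exists_subalgebra_fiber⟩,
    ⟨fun M hM hs => h.mem_commonStrongSym_of_areSymmetries hM hs,
      fun M hM N hN => h.areStrongSymmetries_of_mem hM hN⟩,
    fun U hU α hα M hM => h.isClosedFormOn_dualApply hU hα hM,
    fun hω hL p => h.exists_local_conservation_law hL p⟩,
    fun L h => h.exists_conservation_law⟩
  obtain ⟨g, hg, hMg⟩ := h.exists_coeff hM.1 fun i => (hM.2 i).1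
  exact ⟨g, hg, hMg, fun g' hg' => h.coeff_unique hMg hg'⟩
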